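/- Conventions. Graphs are finite and simple, $\omega(G)$ is the clique number, $G\cup H$ is the disjoint union, and $G+H$ is the join (the disjoint union with all edges between $G$ and $H$ added). For $n\ge 2$ let $\mathbf B_{n,0}$ be the set of graphs on $n$ vertices of maximal degree $n-1$, and for $d>0$, $n\ge 2(d+1)$ let $\mathbf B_{n,d}=\bigcup_{m=2d}^{n-2}\{K_{n-m-2}+(K_2\cup H) : H\in\mathbf B_{m,d-1}\}$. A graph is $\mathbf B_{n,d}$-free if no induced subgraph of it is isomorphic to a member of $\mathbf B_{n,d}$. For $d\ge 0$, $n\ge 2(d+1)$, $\omega\ge 1$ let $g_{n,d}(1)=1$, let $g_{n,0}(\omega)=n-1$ for $\omega>1$, and let $g_{n,d}(\omega)=\sum_{k=1}^{\omega}(\omega-k+1)\,g_{\max(n+k-\omega-2,\,2d),\,d-1}(k)$ for $\omega>1$, $d>0$. For a field $\mathbf k$ let $\beta_{i,j}(I_G)=\sum_{W\subseteq V(G),\,|W|=j}\dim_{\mathbf k}\tilde H_{j-i-2}(\mathrm{Ind}(G[W]);\mathbf k)$, where $\mathrm{Ind}$ is the simplicial complex of independent sets. Algorithms are programs for a word RAM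 with unit-cost instructions and words of $O(\log N)$ bits. The input is a non-empty graph on $N$ vertices, given by adjacency lists; the output is a proper coloring of it. A program is said to find a coloring with $K$ colors in time $T$ if it halts after at most $T$ steps and outputs a proper coloring with at most $K$ colors. Theorem. (1) For all integers $d\ge 0$ and $n\ge 2(d+1)$ there are a program and a constant $C$ such that every non-empty $\mathbf B_{n,d}$-free graph $G$ on $n'$ vertices and $m'$ edges is $g_{n,d}(\omega(G))$-colorable, and the program finds such a coloring in time $C\,\omega(G)\,(m'+n')$. (2) Let $i,j$ be positive integers with $i+2\le j\le 2i+2$. There are a program and a constant $C$ such that, for every non-empty graph $G$ on $N$ vertices with clique number $\omega$ and with $\beta_{i,j}(I_G)=0$ over some field, $$\chi(G)\le\binom{\omega-1+2(j-i-2)}{2(j-i-2)}+\binom{j-2}{2(j-i-2)+1},$$ and the program finds a coloring of $G$ with at most that many colors in time $C N^3$. (3) Let $i,j$ be positive integers with $i+2\le j\le 2i+2$. There are a program and a constant $C$ such that every non-empty triangle-free graph $G$ on $N$ vertices with $\beta_{i,j}(I_G)=0$ over some field is $(j-1)$-colorable, and the program finds such a coloring in time $C N^2$. -/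

import Mathlib

open scoped SimpleGraph

noncomputable section

/-! ### The forbidden graphs and the binding functions -/

/-- The join `G + H`: the disjoint union with all edges between the two parts added. -/
def graphJoin {V W : Type*} (G : SimpleGraph V) (H : SimpleGraph W) : SimpleGraph (V ⊕ W) :=
  (G ⊕g H) ⊔ completeBipartiteGraph V W

open Classical in
/-- `IsBGraph d n G`: the graph `G` on `n` vertices is a member of `B_{n,d}` (a class of graphs up
to isomorphism).  `B_{n,0}` consists of the graphs on `n ≥ 2` vertices of maximal degree `n - 1`,
and for `d > 0`, `B_{n,d}` is the union over `2d ≤ m ≤ n - 2` of `K_{n-m-2} + (K_2 ∪ B_{m,d-1})`. -/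
def IsBGraph : (d n : ℕ) → SimpleGraph (Fin n) → Prop
  | 0, n, G => 2 ≤ n ∧ G.maxDegree = n - 1
  | d + 1, n, G => ∃ m : ℕ, 2 * (d + 1) ≤ m ∧ m + 2 ≤ n ∧
      ∃ H : SimpleGraph (Fin m), IsBGraph d m H ∧
        Nonempty (G ≃g graphJoin (⊤ : SimpleGraph (Fin (n - m - 2)))
          ((⊤ : SimpleGraph (Fin 2)) ⊕g H))

/-- `G` is `B_{n,d}`-free: no member of `B_{n,d}` is an induced subgraph of `G`. -/
def BFree (n d : ℕ) {V : Type*} (G : SimpleGraph V) : Prop :=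
  ∀ H : SimpleGraph (Fin n), IsBGraph d n H → ¬ H ⊴ G

/-- The function `g_{n,d}(ω)`, written `gBound d n ω`, for `n ≥ 2(d+1)` and `ω ≥ 1`.  (The truncated
subtraction `n + k - ω - 2` is harmless, as the maximum with `2d` is taken.) -/
def gBound : (d n ω : ℕ) → ℕ
  | 0, n, ω => if ω ≤ 1 then 1 else n - 1
  | d + 1, n, ω => if ω ≤ 1 then 1 else
      ∑ k ∈ Finset.Icc 1 ω, (ω - k + 1) * gBound d (max (n + k - ω - 2) (2 * (d + 1))) k

/-! ### Reduced simplicial homology of independence complexes, and Betti numbers -/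

section Homology

variable (𝕜 : Type*) [Field 𝕜] {V : Type*} [LinearOrder V]

/-- The simplicial boundary map on formal linear combinations of finite vertex sets:
`∂ σ = ∑_{v ∈ σ} (-1)^{#{u ∈ σ | u < v}} (σ \ {v})`. -/
def simplicialBoundary : (Finset V →₀ 𝕜) →ₗ[𝕜] (Finset V →₀ 𝕜) :=
  Finsupp.linearCombination 𝕜 fun σ : Finset V =>
    ∑ v ∈ σ, Finsupp.single (σ.erase v) ((-1 : 𝕜) ^ (σ.filter (· < v)).card)

/-- The independence complex `Ind(G)`, as its set of faces (including the empty face). -/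
def indepComplex (G : SimpleGraph V) : Set (Finset V) := {σ | G.IsIndepSet (σ : Set V)}

/-- The chains of `Ind(G)` on faces with `c` vertices, that is, of dimension `c - 1`; for `c = 0`
this is the augmentation term, spanned by the empty face. -/
def indepChains (G : SimpleGraph V) (c : ℕ) : Submodule 𝕜 (Finset V →₀ 𝕜) :=
  Finsupp.supported 𝕜 𝕜 {σ | σ ∈ indepComplex G ∧ σ.card = c}

/-- The cycles on faces with `c` vertices. -/
def indepCycles (G : SimpleGraph V) (c : ℕ) : Submodule 𝕜 (Finset V →₀ 𝕜) :=
  indepChains 𝕜 G c ⊓ LinearMap.ker (simplicialBoundary 𝕜)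

/-- The boundaries on faces with `c` vertices. -/
def indepBoundaries (G : SimpleGraph V) (c : ℕ) : Submodule 𝕜 (Finset V →₀ 𝕜) :=
  (indepChains 𝕜 G (c + 1)).map (simplicialBoundary 𝕜)

/-- The dimension over `𝕜` of the reduced homology of `Ind(G)` in degree `c - 1`, which is the
degree of the faces with `c` vertices.  The homology, cycles modulo boundaries, is taken as the
image of the cycles in the quotient of the chains by the boundaries. -/
def indepHomologyDim (G : SimpleGraph V) (c : ℕ) : ℕ :=
  Module.finrank 𝕜 ((indepCycles 𝕜 G c).map (indepBoundaries 𝕜 G c).mkQ)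

/-- The graded Betti number
`β_{i,j}(I_G) = ∑_{W ⊆ V(G), |W| = j} dim H̃_{j-i-2}(Ind(G[W]); 𝕜)`.
Degree `j - i - 2` is that of the faces with `j - i - 1` vertices; for `j ≤ i` the degree is less
than `-1` and the homology vanishes. -/
def edgeIdealBetti [Fintype V] (G : SimpleGraph V) (i j : ℕ) : ℕ :=
  if i < j then
    ∑ W ∈ (Finset.univ : Finset V).powersetCard j,
      indepHomologyDim 𝕜 (G.induce (W : Set V)) (j - i - 1)
  else 0

end Homology

/-! ### A word RAM with unit-cost instructions -/

namespace WordRAM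

/-- An operand of an instruction: a register or a literal. -/
inductive Operand where
  | reg (x : ℕ)
  | lit (c : ℕ)

/-- The arithmetic instructions. -/
inductive Arith where
  | add
  | sub
  | mul

/-- The tests. -/
inductive Test where
  | lt (a b : Operand)
  | eq (a b : Operand)

/-- Programs.  A program is a finite object, so that it refers to finitely many registers and to
finitely many arrays, each indexed by the natural numbers. -/
inductive Prog where
  | skip
  /-- `x := a` -/
  | mov (x : ℕ) (a : Operand)
  /-- `x := a + b`, `x := a - b` (truncated at zero) or `x := a * b` -/
  | arith (x : ℕ) (f : Arith) (a b : Operand)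
  /-- `x := A[a]` -/
  | load (x : ℕ) (A : ℕ) (a : Operand)
  /-- `A[a] := b` -/
  | store (A : ℕ) (a b : Operand)
  | seq (p q : Prog)
  | ite (t : Test) (p q : Prog)
  | loop (t : Test) (p : Prog)

/-- A memory state: the contents of the registers and of the arrays. -/
@[ext]
structure Memory where
  reg : ℕ → ℕ
  arr : ℕ → ℕ → ℕ

def Memory.setReg (s : Memory) (x v : ℕ) : Memory :=
  { s with reg := Function.update s.reg x v }

def Memory.setArr (s : Memory) (A i v : ℕ) : Memory :=
  { s with arr := Function.update s.arr A (Function.update (s.arr A) i v) }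

def Operand.val (s : Memory) : Operand → ℕ
  | .reg x => s.reg x
  | .lit c => c

def Arith.val : Arith → ℕ → ℕ → ℕ
  | .add, a, b => a + b
  | .sub, a, b => a - b
  | .mul, a, b => a * b

def Test.holds (s : Memory) : Test → Prop
  | .lt a b => a.val s < b.val s
  | .eq a b => a.val s = b.val s

/-- `Exec B p s s' t`: started in memory state `s`, the program `p` halts in state `s'` after
executing exactly `t` instructions and tests, and no word that is written exceeds `B`.  (There is no
rule for a write of a larger word: such a run gets stuck.) -/
inductive Exec (B : ℕ) : Prog → Memory → Memory → ℕ → Prop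
  | skip (s : Memory) : Exec B .skip s s 1
  | mov (s : Memory) (x : ℕ) (a : Operand) (h : a.val s ≤ B) :
      Exec B (.mov x a) s (s.setReg x (a.val s)) 1
  | arith (s : Memory) (x : ℕ) (f : Arith) (a b : Operand) (h : f.val (a.val s) (b.val s) ≤ B) :
      Exec B (.arith x f a b) s (s.setReg x (f.val (a.val s) (b.val s))) 1
  | load (s : Memory) (x A : ℕ) (a : Operand) (h : s.arr A (a.val s) ≤ B) :
      Exec B (.load x A a) s (s.setReg x (s.arr A (a.val s))) 1
  | store (s : Memory) (A : ℕ) (a b : Operand) (h : b.val s ≤ B) :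
      Exec B (.store A a b) s (s.setArr A (a.val s) (b.val s)) 1
  | seq {p q : Prog} {s s' s'' : Memory} {t t' : ℕ} (hp : Exec B p s s' t)
      (hq : Exec B q s' s'' t') : Exec B (.seq p q) s s'' (t + t')
  | iteTrue {c : Test} {p q : Prog} {s s' : Memory} {t : ℕ} (hc : c.holds s)
      (hp : Exec B p s s' t) : Exec B (.ite c p q) s s' (t + 1)
  | iteFalse {c : Test} {p q : Prog} {s s' : Memory} {t : ℕ} (hc : ¬ c.holds s)
      (hq : Exec B q s s' t) : Exec B (.ite c p q) s s' (t + 1)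
  | loopDone {c : Test} {p : Prog} {s : Memory} (hc : ¬ c.holds s) :
      Exec B (.loop c p) s s 1
  | loopStep {c : Test} {p : Prog} {s s' s'' : Memory} {t t' : ℕ} (hc : c.holds s)
      (hp : Exec B p s s' t) (hl : Exec B (.loop c p) s' s'' t') :
      Exec B (.loop c p) s s'' (t + t' + 1)

/-- The memory state `s` holds adjacency lists of the graph `G` on the vertices `0, …, N - 1`, and
nothing else.  Register `0` holds `N`; the neighbours of the vertex `v` are listed, each once and in
any order, in the cells `start v, …, start (v + 1) - 1` of array `1`, where array `0` is the table
of the values `start 0, …, start N`.  All other cells are zero. -/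
structure HoldsAdjLists {N : ℕ} (G : SimpleGraph (Fin N)) (s : Memory) : Prop where
  order : s.reg 0 = N
  start_zero : s.arr 0 0 = 0
  start_mono : ∀ v < N, s.arr 0 v ≤ s.arr 0 (v + 1)
  neighbours : ∀ v : Fin N, Set.BijOn (s.arr 1) (Set.Ico (s.arr 0 v) (s.arr 0 (v + 1)))
    ((fun w : Fin N => (w : ℕ)) '' G.neighborSet v)
  reg_other : ∀ x, x ≠ 0 → s.reg x = 0
  start_other : ∀ v, N < v → s.arr 0 v = 0
  neighbours_other : ∀ p, s.arr 0 N ≤ p → s.arr 1 p = 0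
  arr_other : ∀ A, 2 ≤ A → ∀ p, s.arr A p = 0

/-- Given any adjacency lists of the graph `G` on `N` vertices, the program `p` halts after at most
`T` steps, never writes a word larger than `(N + 1) ^ c` (so that words of `O(log N)` bits suffice),
and leaves in the cells `0, …, N - 1` of array `2` a proper coloring of `G` with colors from
`{0, …, K - 1}`. -/
def Prog.FindsColoring (p : Prog) (c : ℕ) {N : ℕ} (G : SimpleGraph (Fin N)) (K T : ℕ) : Prop :=
  ∀ s : Memory, HoldsAdjLists G s →
    ∃ (s' : Memory) (t : ℕ), Exec ((N + 1) ^ c) p s s' t ∧ t ≤ T ∧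
      ∃ col : G.Coloring (Fin K), ∀ v : Fin N, s'.arr 2 v = (col v : ℕ)

end WordRAM

end

noncomputable section

namespace WordRAM

/-! ### A logic for the word RAM: total correctness with a bound on the number of steps -/

section Logic

/-! Coloring. Fix a class of vertices containing no member of $\mathbf B_{n,d}$, $d>0$, with cliques
of size at most $w$, and an ordered clique $K_0,\dots,K_{k-1}$ in it. Give each vertex the type
$(i,j)$ of the first two positions holding no neighbour of it, positions from $k$ on counting as
empty. If adjacent $u,v$ share a type with $j\ge k$, putting $u$ at $i$ and $v$ at $j$ yields a
larger clique (`ValidRow.augment`). Repeat until no such pair is left; the clique need not be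
maximum. Types with $j\ge k$ are then independent, and at most $w$ of them occur. For $j=b<k$, the
class of type $(a,b)$ is anticomplete to the edge $K_aK_b$ and complete to the other $b-1$ vertices
before position $b$. So it is free of $\mathbf B_{\max(n-1-b,2d),d-1}$ (`BFreeOn.of_split`) and its
cliques have at most $w-b+1$ vertices. There are $b$ choices of $a$, and the total is the recursion
for $g_{n,d}(w)$ (`gBound_succ_eq`, `ncard_image_le_gBound`). After $d$ refinements each class has
small maximal degree, and greedy coloring inside the classes finishes.

Time. One round computes all types and enlarges each class's clique at most once, in time
$O(m'+n')$. A class unstable in round $r$ has a clique with at least $r$ vertices after that round,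
so at most $\omega+1$ rounds occur per refinement (`ends_round`, `ends_refineLabels`). Finding the
type of $v$ costs $O(\deg v+1)$, because all positions scanned before $j$, except $i$, hold distinct
neighbours of $v$. Arrays are never cleared: stale stamps are either still true or too small to
matter.

Betti numbers. A member of $\mathbf B_{j,d}$ has an induced matching $a_lb_l$ of $d+1$ edges for
which $\{a_l\}$ is a maximal independent set (`exists_isFacetMatching`). The boundary of the
cross-polytope on the pairs $a_l,b_l$ is a cycle containing the facet $\{a_l\}$, which lies in the
support of no boundary; so homology in degree $d$ is nonzero. Thus $\beta_{i,j}=0$ excludes $\mathbf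
B_{j,j-i-2}$ (`bFree_of_edgeIdealBetti_eq_zero`). The closed formulas follow from
`gBound_le_choose_add_choose` and `gBound_two`. -/

@[simp] theorem Memory.setReg_reg (s : Memory) (x v y : ℕ) :
    (s.setReg x v).reg y = if y = x then v else s.reg y := by
  simp [Memory.setReg, Function.update_apply]

@[simp] theorem Memory.setReg_arr (s : Memory) (x v : ℕ) : (s.setReg x v).arr = s.arr := rfl

@[simp] theorem Memory.setArr_reg (s : Memory) (A i v : ℕ) : (s.setArr A i v).reg = s.reg := rfl

@[simp] theorem Memory.setArr_arr (s : Memory) (A i v A' : ℕ) :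
    (s.setArr A i v).arr A' = if A' = A then Function.update (s.arr A) i v else s.arr A' := by
  simp only [Memory.setArr, Function.update_apply]

@[simp] theorem Operand.val_reg (s : Memory) (x : ℕ) : (Operand.reg x).val s = s.reg x := rfl

@[simp] theorem Operand.val_lit (s : Memory) (x : ℕ) : (Operand.lit x).val s = x := rfl

@[simp] theorem Arith.val_add (a b : ℕ) : Arith.add.val a b = a + b := rfl

@[simp] theorem Arith.val_sub (a b : ℕ) : Arith.sub.val a b = a - b := rfl

@[simp] theorem Arith.val_mul (a b : ℕ) : Arith.mul.val a b = a * b := rfl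

@[simp] theorem Test.holds_lt (s : Memory) (a b : Operand) :
    (Test.lt a b).holds s ↔ a.val s < b.val s := Iff.rfl

@[simp] theorem Test.holds_eq (s : Memory) (a b : Operand) :
    (Test.eq a b).holds s ↔ a.val s = b.val s := Iff.rfl

/-- The registers that a program may write. -/
@[simp] def Prog.regs : Prog → Set ℕ
  | .skip => ∅
  | .mov x _ => {x}
  | .arith x _ _ _ => {x}
  | .load x _ _ => {x}
  | .store _ _ _ => ∅
  | .seq p q => p.regs ∪ q.regs
  | .ite _ p q => p.regs ∪ q.regs
  | .loop _ p => p.regs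

/-- The arrays that a program may write. -/
@[simp] def Prog.arrs : Prog → Set ℕ
  | .skip => ∅
  | .mov _ _ => ∅
  | .arith _ _ _ _ => ∅
  | .load _ _ _ => ∅
  | .store A _ _ => {A}
  | .seq p q => p.arrs ∪ q.arrs
  | .ite _ p q => p.arrs ∪ q.arrs
  | .loop _ p => p.arrs

/-- Frame rule: a specification of a subprogram need only describe what it changes; everything
outside its syntactic write sets is recovered from here. -/
theorem Exec.frame {B : ℕ} {p : Prog} {s s' : Memory} {t : ℕ} (h : Exec B p s s' t) :
    (∀ x ∉ p.regs, s'.reg x = s.reg x) ∧ ∀ A ∉ p.arrs, s'.arr A = s.arr A := by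
  induction h with
  | skip => simp
  | mov => simp +contextual
  | arith => simp +contextual
  | load => simp +contextual
  | store => simp +contextual
  | seq hp hq ihp ihq =>
    simp only [Prog.regs, Prog.arrs, Set.mem_union, not_or]
    exact ⟨fun x hx => (ihq.1 x hx.2).trans (ihp.1 x hx.1),
      fun x hx => (ihq.2 x hx.2).trans (ihp.2 x hx.1)⟩
  | iteTrue hc hp ih =>
    simp only [Prog.regs, Prog.arrs, Set.mem_union, not_or]
    exact ⟨fun x hx => ih.1 x hx.1, fun x hx => ih.2 x hx.1⟩
  | iteFalse hc hp ih =>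
    simp only [Prog.regs, Prog.arrs, Set.mem_union, not_or]
    exact ⟨fun x hx => ih.1 x hx.2, fun x hx => ih.2 x hx.2⟩
  | loopDone => simp
  | loopStep hc hp hl ihp ihl =>
    exact ⟨fun x hx => (ihl.1 x hx).trans (ihp.1 x hx),
      fun x hx => (ihl.2 x hx).trans (ihp.2 x hx)⟩

/-- Started in `s`, the program halts within `T` steps in a state with the property `Q`. -/
def Ends (B : ℕ) (p : Prog) (s : Memory) (T : ℕ) (Q : Memory → Prop) : Prop :=
  ∃ (s' : Memory) (t : ℕ), Exec B p s s' t ∧ t ≤ T ∧ Q s'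

variable {B : ℕ}

theorem Ends.mono {p : Prog} {s : Memory} {T T' : ℕ} {Q Q' : Memory → Prop}
    (h : Ends B p s T Q) (hT : T ≤ T') (hQ : ∀ s', Q s' → Q' s') : Ends B p s T' Q' := by
  obtain ⟨s', t, he, ht, hq⟩ := h
  exact ⟨s', t, he, ht.trans hT, hQ s' hq⟩

theorem Ends.framed {p : Prog} {s : Memory} {T : ℕ} {Q : Memory → Prop} (h : Ends B p s T Q) :
    Ends B p s T fun s' => Q s' ∧ (∀ x ∉ p.regs, s'.reg x = s.reg x) ∧
      ∀ A ∉ p.arrs, s'.arr A = s.arr A := by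
  obtain ⟨s', t, he, ht, hq⟩ := h
  exact ⟨s', t, he, ht, hq, he.frame⟩

theorem Ends.skip {s : Memory} {Q : Memory → Prop} (h : Q s) : Ends B .skip s 1 Q :=
  ⟨s, 1, .skip s, le_rfl, h⟩

theorem Ends.mov {s : Memory} {x : ℕ} {a : Operand} {Q : Memory → Prop} (h : a.val s ≤ B)
    (hQ : Q (s.setReg x (a.val s))) : Ends B (.mov x a) s 1 Q :=
  ⟨_, 1, .mov s x a h, le_rfl, hQ⟩

theorem Ends.arith {s : Memory} {x : ℕ} {f : Arith} {a b : Operand} {Q : Memory → Prop}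
    (h : f.val (a.val s) (b.val s) ≤ B) (hQ : Q (s.setReg x (f.val (a.val s) (b.val s)))) :
    Ends B (.arith x f a b) s 1 Q :=
  ⟨_, 1, .arith s x f a b h, le_rfl, hQ⟩

theorem Ends.load {s : Memory} {x A : ℕ} {a : Operand} {Q : Memory → Prop}
    (h : s.arr A (a.val s) ≤ B) (hQ : Q (s.setReg x (s.arr A (a.val s)))) :
    Ends B (.load x A a) s 1 Q :=
  ⟨_, 1, .load s x A a h, le_rfl, hQ⟩

theorem Ends.store {s : Memory} {A : ℕ} {a b : Operand} {Q : Memory → Prop}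
    (h : b.val s ≤ B) (hQ : Q (s.setArr A (a.val s) (b.val s))) :
    Ends B (.store A a b) s 1 Q :=
  ⟨_, 1, .store s A a b h, le_rfl, hQ⟩

theorem Ends.seq {p q : Prog} {s : Memory} {T T' : ℕ} {Q : Memory → Prop}
    (h : Ends B p s T fun s' => Ends B q s' T' Q) : Ends B (.seq p q) s (T + T') Q := by
  obtain ⟨s', t, he, ht, s'', t', he', ht', hq⟩ := h
  exact ⟨s'', t + t', he.seq he', by omega, hq⟩

theorem Ends.ite {c : Test} {p q : Prog} {s : Memory} {T : ℕ} {Q : Memory → Prop}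
    (hp : c.holds s → Ends B p s T Q) (hq : ¬ c.holds s → Ends B q s T Q) :
    Ends B (.ite c p q) s (T + 1) Q := by
  by_cases hc : c.holds s
  · obtain ⟨s', t, he, ht, h⟩ := hp hc
    exact ⟨s', t + 1, .iteTrue hc he, by omega, h⟩
  · obtain ⟨s', t, he, ht, h⟩ := hq hc
    exact ⟨s', t + 1, .iteFalse hc he, by omega, h⟩

/-- The rule for loops: `Φ` bounds the time that is left. -/
theorem Ends.loop {c : Test} {p : Prog} {I : Memory → Prop} {Φ : Memory → ℕ}
    (hpos : ∀ s, I s → 1 ≤ Φ s)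
    (hstep : ∀ s, I s → c.holds s →
      ∃ τ, Ends B p s τ fun s' => I s' ∧ Φ s' + τ + 1 ≤ Φ s)
    {s : Memory} (hs : I s) : Ends B (.loop c p) s (Φ s) fun s' => I s' ∧ ¬ c.holds s' := by
  -- The potential drops by more than the cost of the body, the extra one paying for the test; so it
  -- bounds the time and proves termination.
  induction hn : Φ s using Nat.strong_induction_on generalizing s with
  | _ n ih =>
    subst hn
    by_cases hc : c.holds s
    · obtain ⟨τ, s', t, he, ht, hI, hΦ⟩ := hstep s hs hc
      obtain ⟨s'', t', he', ht', h⟩ := ih (Φ s') (by omega) hI rfl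
      exact ⟨s'', t + t' + 1, .loopStep hc he he', by omega, h⟩
    · exact ⟨s, 1, .loopDone hc, hpos s hs, hs, hc⟩

/-- A list of programs, run one after the other. -/
def block : List Prog → Prog
  | [] => .skip
  | p :: l => .seq p (block l)

@[simp] theorem regs_block_nil : (block []).regs = ∅ := rfl

@[simp] theorem regs_block_cons (p : Prog) (l : List Prog) :
    (block (p :: l)).regs = p.regs ∪ (block l).regs := rfl

@[simp] theorem arrs_block_nil : (block []).arrs = ∅ := rfl

@[simp] theorem arrs_block_cons (p : Prog) (l : List Prog) :
    (block (p :: l)).arrs = p.arrs ∪ (block l).arrs := rfl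

theorem Ends.nil {s : Memory} {Q : Memory → Prop} {T : ℕ} (h : Q s) :
    Ends B (block []) s (T + 1) Q :=
  (Ends.skip h).mono (by omega) fun _ h => h

theorem Ends.cons {p : Prog} {l : List Prog} {s : Memory} {T T' : ℕ} {Q : Memory → Prop}
    (h : Ends B p s T fun s' => Ends B (block l) s' T' Q) :
    Ends B (block (p :: l)) s (T' + T) Q :=
  (Ends.seq h).mono (by omega) fun _ h => h

variable {l : List Prog} {s : Memory} {T : ℕ} {Q : Memory → Prop}

theorem Ends.cons_mov {x : ℕ} {a : Operand} (h : a.val s ≤ B)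
    (hQ : Ends B (block l) (s.setReg x (a.val s)) T Q) :
    Ends B (block (.mov x a :: l)) s (T + 1) Q :=
  Ends.cons (Ends.mov h hQ)

theorem Ends.cons_arith {x : ℕ} {f : Arith} {a b : Operand}
    (h : f.val (a.val s) (b.val s) ≤ B)
    (hQ : Ends B (block l) (s.setReg x (f.val (a.val s) (b.val s))) T Q) :
    Ends B (block (.arith x f a b :: l)) s (T + 1) Q :=
  Ends.cons (Ends.arith h hQ)

theorem Ends.cons_load {x A : ℕ} {a : Operand} (h : s.arr A (a.val s) ≤ B)
    (hQ : Ends B (block l) (s.setReg x (s.arr A (a.val s))) T Q) :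
    Ends B (block (.load x A a :: l)) s (T + 1) Q :=
  Ends.cons (Ends.load h hQ)

theorem Ends.cons_store {A : ℕ} {a b : Operand} (h : b.val s ≤ B)
    (hQ : Ends B (block l) (s.setArr A (a.val s) (b.val s)) T Q) :
    Ends B (block (.store A a b :: l)) s (T + 1) Q :=
  Ends.cons (Ends.store h hQ)

/-- A program that is followed by a block: its effect is given by a postcondition. -/
theorem Ends.cons_of {p : Prog} {T' : ℕ} {R : Memory → Prop} (h : Ends B p s T' R)
    (hQ : ∀ s', R s' → (∀ x ∉ p.regs, s'.reg x = s.reg x) →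
      (∀ A ∉ p.arrs, s'.arr A = s.arr A) → Ends B (block l) s' T Q) :
    Ends B (block (p :: l)) s (T + T') Q :=
  Ends.cons (h.framed.mono le_rfl fun s' hs' => hQ s' hs'.1 hs'.2.1 hs'.2.2)

end Logic

end WordRAM

/-! ### Counting the colors -/

section Counting

variable {V : Type*} (G : SimpleGraph V)

/-- No induced subgraph of `G` on vertices of `S` is isomorphic to a member of `B_{n,d}`. -/
def BFreeOn (n d : ℕ) (S : Set V) : Prop :=
  ∀ H : SimpleGraph (Fin n), IsBGraph d n H → ∀ f : H ↪g G, ∃ x, f x ∉ S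

/-- The vertices `K 0, …, K (k - 1)` of `S` form a clique, and `i v < j v` are the first two
positions at which `v ∈ S` has no neighbour in this sequence; vertices of the same type `(i, j)`
with `j ≥ k` are not adjacent. -/
structure IsSplit (S : Set V) (k : ℕ) (K : ℕ → V) (i j : V → ℕ) : Prop where
  mem : ∀ a < k, K a ∈ S
  adj : ∀ a < k, ∀ b < k, a ≠ b → G.Adj (K a) (K b)
  lt : ∀ v ∈ S, i v < j v
  nb : ∀ v ∈ S, ∀ a < j v, a ≠ i v → a < k ∧ G.Adj v (K a)
  not_nb_left : ∀ v ∈ S, i v < k → ¬ G.Adj v (K (i v))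
  not_nb_right : ∀ v ∈ S, j v < k → ¬ G.Adj v (K (j v))
  indep : ∀ u ∈ S, ∀ v ∈ S, i u = i v → j u = j v → k ≤ j v → ¬ G.Adj u v

/-- The classes of `lab'` are the sets of vertices of the same type in the classes of `lab`. -/
def Refines (lab lab' : V → ℕ) : Prop :=
  ∀ c, ∃ (k : ℕ) (K : ℕ → V) (i j : V → ℕ), IsSplit G {v | lab v = c} k K i j ∧
    ∀ u v, lab u = c → (lab' u = lab' v ↔ lab v = c ∧ i u = i v ∧ j u = j v)

/-- The codes are obtained from the labels by `d` refinements, followed by a greedy choice within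
each class. -/
def IsLayered : ℕ → (V → ℕ) → (V → ℕ) → Prop
  | 0, lab, code => ∃ M, ∀ v, lab v * M + 1 ≤ code v ∧
      code v ≤ lab v * M + {w | G.Adj v w ∧ lab w = lab v}.ncard + 1
  | d + 1, lab, code => ∃ lab', Refines G lab lab' ∧ IsLayered d lab' code

variable {G}

/-- A vertex with `n - 1` neighbours in `S` would, together with them, induce a graph on `n`
vertices with a dominating vertex. -/
theorem BFreeOn.degree_add_two_le [Finite V] {n : ℕ} {S : Set V} (h : BFreeOn G n 0 S)
    (hn : 2 ≤ n) {v : V} (hv : v ∈ S) : {w | G.Adj v w ∧ w ∈ S}.ncard + 2 ≤ n := by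
  classical
  by_contra! hlt
  obtain ⟨m, rfl⟩ : ∃ m, n = m + 1 := ⟨n - 1, by omega⟩
  have hfin : {w | G.Adj v w ∧ w ∈ S}.Finite := Set.toFinite _
  have hcard : m ≤ {w | G.Adj v w ∧ w ∈ S}.ncard := by omega
  have : Nonempty (Fin m ↪ {w | G.Adj v w ∧ w ∈ S}) := by
    have := hfin.fintype
    rw [Function.Embedding.nonempty_iff_card_le, Fintype.card_fin, ← Nat.card_eq_fintype_card]
    exact hcard
  obtain ⟨g⟩ := this
  let f : Fin (m + 1) → V := Fin.cons v fun x => (g x : V)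
  have hf : Function.Injective f := by
    rw [Fin.cons_injective_iff]
    refine ⟨?_, fun x y hxy => g.injective (Subtype.ext hxy)⟩
    rintro ⟨x, hx⟩
    exact (g x).2.1.ne hx.symm
  have hdeg : IsBGraph 0 (m + 1) (G.comap f) := by
    refine ⟨hn, le_antisymm ?_ ?_⟩
    · exact Nat.le_of_lt_succ
        ((SimpleGraph.maxDegree_lt_card_verts (G.comap f)).trans_eq (Fintype.card_fin _))
    · refine le_trans ?_ (SimpleGraph.degree_le_maxDegree _ (0 : Fin (m + 1)))
      rw [← SimpleGraph.card_neighborFinset_eq_degree]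
      have hsub : Finset.univ.image (Fin.succ : Fin m → Fin (m + 1)) ⊆
          (G.comap f).neighborFinset 0 := by
        intro x hx
        obtain ⟨y, -, rfl⟩ := Finset.mem_image.1 hx
        rw [SimpleGraph.mem_neighborFinset]
        exact (g y).2.1
      calc m + 1 - 1 = (Finset.univ.image (Fin.succ : Fin m → Fin (m + 1))).card := by
            rw [Finset.card_image_of_injective _ (Fin.succ_injective m)]; simp
        _ ≤ _ := Finset.card_le_card hsub
  obtain ⟨x, hx⟩ := h (G.comap f) hdeg ⟨⟨f, hf⟩, Iff.rfl⟩
  refine hx (Fin.cases ?_ (fun y => ?_) x)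
  · exact hv
  · exact (g y).2.2

/-- A forbidden graph for `d` inside `T`, the edge `x y` anticomplete to it, and `n - m - 2`
vertices of `L` complete to both assemble into a forbidden graph for `d + 1` inside `S`. This is the
descent in `d`. -/
theorem BFreeOn.of_split {n m d : ℕ} {S T : Set V} (h : BFreeOn G n (d + 1) S)
    (hm : 2 * (d + 1) ≤ m) (hmn : m + 2 ≤ n) {x y : V} (hx : x ∈ S) (hy : y ∈ S)
    (hxy : G.Adj x y) {L : Finset V} (hLS : ∀ z ∈ L, z ∈ S) (hL : G.IsClique (L : Set V))
    (hLx : ∀ z ∈ L, G.Adj z x) (hLy : ∀ z ∈ L, G.Adj z y) (hcard : n - m - 2 ≤ L.card)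
    (hTS : T ⊆ S) (hTx : ∀ t ∈ T, t ≠ x ∧ ¬ G.Adj x t) (hTy : ∀ t ∈ T, t ≠ y ∧ ¬ G.Adj y t)
    (hTL : ∀ t ∈ T, ∀ z ∈ L, G.Adj z t) : BFreeOn G m d T := by
  intro H hH f
  by_contra! hf
  have : Nonempty (Fin (n - m - 2) ↪ L) := by
    rw [Function.Embedding.nonempty_iff_card_le]
    simpa using hcard
  obtain ⟨g⟩ := this
  let J := graphJoin (⊤ : SimpleGraph (Fin (n - m - 2))) ((⊤ : SimpleGraph (Fin 2)) ⊕g H)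
  let φ : Fin (n - m - 2) ⊕ (Fin 2 ⊕ Fin m) → V :=
    Sum.elim (fun a => (g a : V)) (Sum.elim ![x, y] f)
  have hg : ∀ a, (g a : V) ∈ L := fun a => (g a).2
  have hadj : ∀ p q, J.Adj p q ↔ G.Adj (φ p) (φ q) := by
    have hne : ∀ a b : Fin (n - m - 2), a ≠ b ↔ G.Adj (g a : V) (g b) := by
      refine fun a b => ⟨fun hab => hL (hg a) (hg b) fun hh => hab (g.injective (Subtype.ext hh)),
        ?_⟩
      rintro hab rfl
      exact hab.ne rfl
    rintro (a | a | a) (b | b | b)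
    · simpa [J, φ, graphJoin] using hne a b
    · fin_cases b <;> simp [J, φ, graphJoin, hLx _ (hg a), hLy _ (hg a)]
    · simp [J, φ, graphJoin, hTL _ (hf b) _ (hg a)]
    · fin_cases a <;> simp [J, φ, graphJoin, (hLx _ (hg b)).symm, (hLy _ (hg b)).symm]
    · fin_cases a <;> fin_cases b <;> simp [J, φ, graphJoin, hxy, hxy.symm]
    · fin_cases a <;> simp [J, φ, graphJoin, (hTx _ (hf b)).2, (hTy _ (hf b)).2]
    · simp [J, φ, graphJoin, (hTL _ (hf a) _ (hg b)).symm]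
    · have h1 := (hTx _ (hf a)).2
      have h2 := (hTy _ (hf a)).2
      rw [G.adj_comm] at h1 h2
      fin_cases b <;> simp [J, φ, graphJoin, h1, h2]
    · simp [J, φ, graphJoin]
  have hinj : Function.Injective φ := by
    have hgf : ∀ a b, (g a : V) ≠ f b := fun a b => (hTL _ (hf b) _ (hg a)).ne
    have hgx : ∀ a, (g a : V) ≠ x := fun a => (hLx _ (hg a)).ne
    have hgy : ∀ a, (g a : V) ≠ y := fun a => (hLy _ (hg a)).ne
    have hfx : ∀ a, f a ≠ x := fun a => (hTx _ (hf a)).1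
    have hfy : ∀ a, f a ≠ y := fun a => (hTy _ (hf a)).1
    refine Function.Injective.sumElim (fun a b hab => g.injective (Subtype.ext hab))
      (Function.Injective.sumElim ?_ f.injective ?_) ?_
    · intro a b
      fin_cases a <;> fin_cases b <;> simp [hxy.ne, hxy.ne.symm]
    · intro a b
      fin_cases a
      · exact (hfx b).symm
      · exact (hfy b).symm
    · rintro a (b | b)
      · fin_cases b
        · exact hgx a
        · exact hgy a
      · exact hgf a b
  have e : Fin n ≃ Fin (n - m - 2) ⊕ (Fin 2 ⊕ Fin m) := by
    refine Fintype.equivOfCardEq ?_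
    simp only [Fintype.card_fin, Fintype.card_sum]
    omega
  obtain ⟨z, hz⟩ := h (J.comap e) ⟨m, hm, hmn, H, hH, ⟨⟨e, Iff.rfl⟩⟩⟩
    ⟨⟨φ ∘ e, hinj.comp e.injective⟩, fun {a b} => (hadj (e a) (e b)).symm⟩
  refine hz ?_
  change φ (e z) ∈ S
  rcases e z with a | a | a
  · exact hLS _ (hg a)
  · fin_cases a
    · exact hx
    · exact hy
  · exact hTS (hf a)

theorem gBound_of_le_one {d n w : ℕ} (hw : w ≤ 1) : gBound d n w = 1 := by
  cases d <;> simp [gBound, hw]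

/-- The defining sum reindexed by `k = w + 1 - j`, so that `j` is the second position of a type and
the factor `j` counts the possible first positions. The term `k = 1` becomes the isolated `w`. -/
theorem gBound_succ_eq {d n w : ℕ} (hw : 1 ≤ w) :
    gBound (d + 1) n w = w + ∑ j ∈ Finset.range w,
      j * gBound d (max (n - 1 - j) (2 * (d + 1))) (w - j + 1) := by
  rcases hw.eq_or_lt with rfl | hw
  · simp [gBound]
  rw [gBound, if_neg (by omega), Finset.range_eq_Ico,
    Finset.sum_eq_sum_Ico_succ_bot (a := 0) (by omega)]
  rw [← Finset.Ico_add_one_right_eq_Icc, Finset.sum_eq_sum_Ico_succ_bot (by omega),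
    gBound_of_le_one le_rfl]
  congr 1
  · omega
  rw [zero_mul, zero_add]
  refine Finset.sum_bij' (fun k _ => w + 1 - k) (fun j _ => w + 1 - j) ?_ ?_ ?_ ?_ ?_
  all_goals simp only [Finset.mem_Ico]
  · omega
  · omega
  · omega
  · omega
  · intro k hk
    congr 1
    · omega
    · congr 1
      · congr 1
        omega
      · omega

namespace IsSplit

variable {S : Set V} {k : ℕ} {K : ℕ → V} {i j : V → ℕ}

theorem injOn (h : IsSplit G S k K i j) : Set.InjOn K (Set.Iio k) := by
  intro a ha b hb hab
  by_contra hne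
  exact (h.adj a ha b hb hne).ne hab

/-- The positions `k` and `k + 1` both lie beyond the clique, and `i v` can account for only one of
them. -/
theorem right_le (h : IsSplit G S k K i j) {v : V} (hv : v ∈ S) : j v ≤ k + 1 := by
  by_contra! hlt
  have h0 := h.nb v hv k (by omega)
  have h1 := h.nb v hv (k + 1) (by omega)
  omega

theorem left_le (h : IsSplit G S k K i j) {v : V} (hv : v ∈ S) : i v ≤ k := by
  by_contra! hlt
  have := h.lt v hv
  have h0 := h.nb v hv k (by omega)
  omega

/-- Among types reaching past the clique the second position is determined by the first; hence there
is only one such type for each value of `i`. -/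
theorem right_eq (h : IsSplit G S k K i j) {v : V} (hv : v ∈ S) (hk : k ≤ j v) :
    j v = if i v = k then k + 1 else k := by
  have h1 := h.right_le hv
  have h2 := h.left_le hv
  have h3 := h.lt v hv
  split_ifs with hi
  · omega
  · by_contra hne
    have h0 := h.nb v hv k (by omega)
    omega

end IsSplit

/-- An independent class is never split: its vertices see no clique vertex, so all have type `(0,
1)`. In the end the greedy choice meets no neighbour and takes the first code. -/
theorem ncard_image_le_one_of_indep {d : ℕ} {lab code : V → ℕ} (h : IsLayered G d lab code) {c : ℕ}
    (hc : ∀ u v, lab u = c → lab v = c → ¬ G.Adj u v) :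
    (code '' {v | lab v = c}).ncard ≤ 1 := by
  induction d generalizing lab c with
  | zero =>
    obtain ⟨M, hM⟩ := h
    have : code '' {v | lab v = c} ⊆ {c * M + 1} := by
      rintro _ ⟨v, rfl, rfl⟩
      have h1 := hM v
      have : {w | G.Adj v w ∧ lab w = lab v} = ∅ := by
        ext w
        simp only [Set.mem_ofPred_eq, Set.mem_empty_iff_false, iff_false, not_and]
        exact fun hw hl => hc v w rfl hl hw
      rw [this, Set.ncard_empty] at h1
      simp only [Set.mem_singleton_iff]
      omega
    simpa using Set.ncard_le_ncard this
  | succ d ih =>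
    obtain ⟨lab', hR, h⟩ := h
    obtain ⟨k, K, i, j, hs, hlab⟩ := hR c
    rcases Set.eq_empty_or_nonempty {v | lab v = c} with he | ⟨v₀, hv₀⟩
    · simp [he]
    have key : ∀ v, lab v = c → i v = 0 ∧ j v = 1 := by
      intro v hv
      have h1 := hs.lt v hv
      have h2 := fun a ha hn => (hc v (K a) hv (hs.mem a (hs.nb v hv a ha hn).1))
        (hs.nb v hv a ha hn).2
      have hi : i v = 0 := by
        by_contra hne
        exact h2 0 (by omega) (Ne.symm hne)
      refine ⟨hi, ?_⟩
      by_contra hne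
      exact h2 1 (by omega) (by omega)
    have hsub : {v | lab v = c} ⊆ {v | lab' v = lab' v₀} := by
      intro v hv
      have := (hlab v v₀ hv).2 ⟨hv₀, by rw [(key v hv).1, (key v₀ hv₀).1],
        by rw [(key v hv).2, (key v₀ hv₀).2]⟩
      exact this
    have hsub' : {v | lab' v = lab' v₀} ⊆ {v | lab v = c} := fun v hv =>
      ((hlab v₀ v hv₀).1 (Eq.symm hv)).1
    rw [hsub.antisymm hsub']
    exact ih h fun u v hu hv => hc u v (hsub' hu) (hsub' hv)

/-- The count behind the recursion, by induction on `d` with `n` and `w` varying. It needs only that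
the clique is stable under the exchange, not that it is maximum. -/
theorem ncard_image_le_gBound [Finite V] {d n w : ℕ} {lab code : V → ℕ}
    (h : IsLayered G d lab code) (hn : 2 * (d + 1) ≤ n) (hw : 1 ≤ w) {c : ℕ}
    (hB : BFreeOn G n d {v | lab v = c})
    (hK : ∀ T : Finset V, (∀ v ∈ T, lab v = c) → G.IsClique (T : Set V) → T.card ≤ w) :
    (code '' {v | lab v = c}).ncard ≤ gBound d n w := by
  classical
  induction d generalizing lab c n w with
  | zero =>
    rw [gBound]
    split_ifs with hw1
    · refine ncard_image_le_one_of_indep h fun u v hu hv huv => ?_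
      have := hK {u, v} (by simp [hu, hv]) (by
        rw [Finset.coe_pair]
        exact SimpleGraph.isClique_pair.2 fun _ => huv)
      rw [Finset.card_pair huv.ne] at this
      omega
    · obtain ⟨M, hM⟩ := h
      have : code '' {v | lab v = c} ⊆ Set.Icc (c * M + 1) (c * M + (n - 1)) := by
        rintro _ ⟨v, rfl, rfl⟩
        have h1 := hM v
        have h2 := hB.degree_add_two_le (by omega) (v := v) rfl
        simp only [Set.mem_ofPred_eq] at h2
        simp only [Set.mem_Icc]
        omega
      refine (Set.ncard_le_ncard this (Set.finite_Icc _ _)).trans ?_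
      rw [Set.ncard_eq_toFinset_card']
      simp only [Set.toFinset_Icc, Nat.card_Icc]
      omega
  | succ d ih =>
    obtain ⟨lab', hR, h⟩ := h
    obtain ⟨k, K, i, j, hs, hlab⟩ := hR c
    have hcl : ∀ a < k, lab (K a) = c := hs.mem
    have hkw : k ≤ w := by
      have := hK ((Finset.range k).image K) (by simpa using hcl) (by
        intro x hx y hy hxy
        simp only [Finset.coe_image, Finset.coe_range, Set.mem_image, Set.mem_Iio] at hx hy
        obtain ⟨a, ha, rfl⟩ := hx
        obtain ⟨b, hb, rfl⟩ := hy
        exact hs.adj a ha b hb fun hab => hxy (by rw [hab]))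
      rwa [Finset.card_image_of_injOn (by simpa using hs.injOn), Finset.card_range] at this
    let X : ℕ → ℕ → Set V := fun a b => {v | lab v = c ∧ i v = a ∧ j v = b}
    have hX : ∀ a b, X a b = ∅ ∨ ∃ c', X a b = {v | lab' v = c'} := by
      intro a b
      rcases Set.eq_empty_or_nonempty (X a b) with he | ⟨v, hv, rfl, rfl⟩
      · exact Or.inl he
      · refine Or.inr ⟨lab' v, ?_⟩
        ext u
        have := hlab v u hv
        simp only [X, Set.mem_ofPred_eq]
        rw [eq_comm (a := lab' u), this]
        simp only [eq_comm]
    -- Types with second position at least `k` are independent, hence cost one color each.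
    have h1 : ∀ a, (code '' X a (if a = k then k + 1 else k)).ncard ≤ 1 := by
      intro a
      rcases hX a (if a = k then k + 1 else k) with he | ⟨c', he⟩
      · simp [he]
      · rw [he]
        refine ncard_image_le_one_of_indep h fun u v hu hv => ?_
        have hu' : u ∈ X a (if a = k then k + 1 else k) := by rw [he]; exact hu
        have hv' : v ∈ X a (if a = k then k + 1 else k) := by rw [he]; exact hv
        exact hs.indep u hu'.1 v hv'.1 (hu'.2.1.trans hv'.2.1.symm) (hu'.2.2.trans hv'.2.2.symm)
          (by rw [hv'.2.2]; split_ifs <;> omega)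
    -- Types inside the clique fall under the induction hypothesis with smaller parameters.
    have h2 : ∀ b < k, ∀ a < b, (code '' X a b).ncard ≤
        gBound d (max (n - 1 - b) (2 * (d + 1))) (w - b + 1) := by
      intro b hb a hab
      rcases hX a b with he | ⟨c', he⟩
      · simp [he]
      rw [he]
      -- The `b - 1` clique vertices before position `b` other than `K a`; all vertices of type `(a,
      -- b)` are adjacent to them.
      let L : Finset V := ((Finset.range b).erase a).image K
      have hLinj : Set.InjOn K ((Finset.range b).erase a : Finset ℕ) := by
        refine hs.injOn.mono fun z hz => ?_
        simp only [Finset.coe_erase, Finset.coe_range, Set.mem_sdiff, Set.mem_Iio] at hz ⊢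
        omega
      have hLcard : L.card = b - 1 := by
        rw [Finset.card_image_of_injOn hLinj, Finset.card_erase_of_mem (by simpa using hab),
          Finset.card_range]
      have hLmem : ∀ z ∈ L, ∃ e < b, e ≠ a ∧ K e = z := by
        intro z hz
        obtain ⟨e, he, rfl⟩ := Finset.mem_image.1 hz
        simp only [Finset.mem_erase, Finset.mem_range] at he
        exact ⟨e, he.2, he.1, rfl⟩
      have hLcl : G.IsClique (L : Set V) := by
        intro y hy z hz hyz
        obtain ⟨e, he, -, rfl⟩ := hLmem y hy
        obtain ⟨f, hf, -, rfl⟩ := hLmem z hz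
        exact hs.adj e (by omega) f (by omega) fun hh => hyz (by rw [hh])
      have hTL : ∀ t ∈ X a b, ∀ z ∈ L, G.Adj z t := by
        rintro t ⟨ht, rfl, rfl⟩ z hz
        obtain ⟨e, he, hne, rfl⟩ := hLmem z hz
        exact (hs.nb t ht e he hne).2.symm
      refine ih h (le_max_right _ _) (by omega) ?_ ?_
      · rw [← he]
        refine hB.of_split (x := K a) (y := K b) (L := L) (le_max_right _ _) (by omega)
          (hcl a (by omega)) (hcl b hb) (hs.adj a (by omega) b hb (by omega)) ?_ hLcl ?_ ?_
          (by omega) (fun v hv => hv.1) ?_ ?_ hTL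
        · intro z hz
          obtain ⟨e, he, -, rfl⟩ := hLmem z hz
          exact hcl e (by omega)
        · intro z hz
          obtain ⟨e, he, hne, rfl⟩ := hLmem z hz
          exact hs.adj e (by omega) a (by omega) hne
        · intro z hz
          obtain ⟨e, he, hne, rfl⟩ := hLmem z hz
          exact hs.adj e (by omega) b (by omega) (by omega)
        · rintro t ⟨ht, rfl, rfl⟩
          -- The vertex `K a` does not itself have type `(a, b)`, since it is adjacent to `K b`.
          refine ⟨?_, fun hh => hs.not_nb_left t ht (by omega) hh.symm⟩
          intro hh
          refine hs.not_nb_right t ht hb ?_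
          conv_lhs => rw [hh]
          exact hs.adj _ (by omega) _ hb (by omega)
        · rintro t ⟨ht, rfl, rfl⟩
          refine ⟨?_, fun hh => hs.not_nb_right t ht (by omega) hh.symm⟩
          intro hh
          refine hs.not_nb_left t ht (by omega) ?_
          conv_lhs => rw [hh]
          exact hs.adj _ hb _ (by omega) (by omega)
      · intro T hT hTc
        have hTX : ∀ t ∈ T, t ∈ X a b := fun t ht => by rw [he]; exact hT t ht
        have hdisj : Disjoint T L := by
          rw [Finset.disjoint_left]
          intro t ht hl
          exact (hTL t (hTX t ht) t hl).ne rfl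
        -- A clique among the vertices of this type extends by `L`, so it has at most `w - (b - 1)`
        -- vertices.
        have := hK (T ∪ L) (by
            intro v hv
            rcases Finset.mem_union.1 hv with hv | hv
            · exact (hTX v hv).1
            · obtain ⟨e, he, -, rfl⟩ := hLmem v hv
              exact hcl e (by omega)) (by
            intro u hu v hv huv
            rw [Finset.mem_coe, Finset.mem_union] at hu hv
            rcases hu with hu | hu <;> rcases hv with hv | hv
            · exact hTc hu hv huv
            · exact (hTL u (hTX u hu) v hv).symm
            · exact hTL v (hTX v hv) u hu
            · exact hLcl hu hv huv)
        rw [Finset.card_union_of_disjoint hdisj, hLcard] at this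
        omega
    -- For types past the clique it suffices to let `a` range below `w`: if `a = k`, the vertex
    -- extends the clique, so `k + 1 ≤ w`.
    have hcover : {v | lab v = c} ⊆
        (⋃ a ∈ Finset.range w, X a (if a = k then k + 1 else k)) ∪
        ⋃ b ∈ Finset.range k, ⋃ a ∈ Finset.range b, X a b := by
      intro v hv
      rcases lt_or_ge (j v) k with hj | hj
      · right
        simp only [Set.mem_iUnion, Finset.mem_range]
        exact ⟨j v, hj, i v, hs.lt v hv, hv, rfl, rfl⟩
      · left
        simp only [Set.mem_iUnion, Finset.mem_range]
        refine ⟨i v, ?_, hv, rfl, hs.right_eq hv hj⟩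
        have hi := hs.left_le hv
        rcases hi.eq_or_lt with hi | hi
        · have hadj : ∀ a < k, G.Adj v (K a) := fun a ha =>
            (hs.nb v hv a (by omega) (by omega)).2
          have := hK (insert v ((Finset.range k).image K)) (by
              simpa using ⟨hv, hcl⟩) (by
              rw [Finset.coe_insert, SimpleGraph.isClique_insert]
              refine ⟨?_, ?_⟩
              · intro x hx y hy hxy
                simp only [Finset.coe_image, Finset.coe_range, Set.mem_image, Set.mem_Iio] at hx hy
                obtain ⟨a, ha, rfl⟩ := hx
                obtain ⟨b, hb, rfl⟩ := hy
                exact hs.adj a ha b hb fun hab => hxy (by rw [hab])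
              · intro x hx _
                simp only [Finset.coe_image, Finset.coe_range, Set.mem_image, Set.mem_Iio] at hx
                obtain ⟨a, ha, rfl⟩ := hx
                exact hadj a ha)
          rw [Finset.card_insert_of_notMem, Finset.card_image_of_injOn (by simpa using hs.injOn),
            Finset.card_range] at this
          · omega
          · intro hmem
            obtain ⟨a, ha, hav⟩ := Finset.mem_image.1 hmem
            exact (hadj a (by simpa using ha)).ne hav.symm
        · omega
    calc (code '' {v | lab v = c}).ncard
        ≤ (code '' ((⋃ a ∈ Finset.range w, X a (if a = k then k + 1 else k)) ∪
            ⋃ b ∈ Finset.range k, ⋃ a ∈ Finset.range b, X a b)).ncard :=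
          Set.ncard_le_ncard (Set.image_mono hcover) (Set.toFinite _)
      _ ≤ (⋃ a ∈ Finset.range w, code '' X a (if a = k then k + 1 else k)).ncard +
            (⋃ b ∈ Finset.range k, ⋃ a ∈ Finset.range b, code '' X a b).ncard := by
          simp only [Set.image_union, Set.image_iUnion]
          exact Set.ncard_union_le _ _
      _ ≤ ∑ a ∈ Finset.range w, (code '' X a (if a = k then k + 1 else k)).ncard +
            ∑ b ∈ Finset.range k, ∑ a ∈ Finset.range b, (code '' X a b).ncard :=
          add_le_add (Finset.set_ncard_biUnion_le _ _)
            ((Finset.set_ncard_biUnion_le _ _).trans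
              (Finset.sum_le_sum fun b _ => Finset.set_ncard_biUnion_le _ _))
      _ ≤ ∑ a ∈ Finset.range w, 1 + ∑ b ∈ Finset.range k, ∑ a ∈ Finset.range b,
            gBound d (max (n - 1 - b) (2 * (d + 1))) (w - b + 1) :=
          add_le_add (Finset.sum_le_sum fun a _ => h1 a)
            (Finset.sum_le_sum fun b hb => Finset.sum_le_sum fun a ha =>
              h2 b (by simpa using hb) a (by simpa using ha))
      _ ≤ gBound (d + 1) n w := by
          rw [gBound_succ_eq hw]
          simp only [Finset.sum_const, Finset.card_range, smul_eq_mul, mul_one]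
          exact Nat.add_le_add_left (Finset.sum_le_sum_of_subset (by simpa using hkw)) _

end Counting

/-! ### Binomial bounds for `gBound` -/

section Binomial

theorem sum_range_sub_add_choose (a r : ℕ) :
    ∑ t ∈ Finset.range (a + 1), (a - t + r).choose r = (a + r + 1).choose (r + 1) := by
  induction a with
  | zero => simp
  | succ a ih =>
    rw [Finset.sum_range_succ', show a + 1 + r + 1 = (a + r + 1) + 1 by ring,
      Nat.choose_succ_succ, add_comm, ← ih]
    congr 1
    · congr 1
      omega
    · exact Finset.sum_congr rfl fun t _ => by rw [show a + 1 - (t + 1) = a - t by omega]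

/-- The hockey-stick identity applied twice: raising `a` by one adds exactly one sum of the
unweighted kind. -/
theorem sum_range_succ_mul_choose (a r : ℕ) :
    ∑ t ∈ Finset.range (a + 1), (t + 1) * (a - t + r).choose r = (a + r + 2).choose (r + 2) := by
  induction a with
  | zero => simp
  | succ a ih =>
    have h1 : ∑ t ∈ Finset.range (a + 1 + 1), (t + 1) * (a + 1 - t + r).choose r =
        ∑ t ∈ Finset.range (a + 1), (t + 1) * (a - t + r).choose r +
        ∑ t ∈ Finset.range (a + 1 + 1), (a + 1 - t + r).choose r := by
      rw [Finset.sum_range_succ', Finset.sum_range_succ' (fun t => (a + 1 - t + r).choose r),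
        ← add_assoc, ← Finset.sum_add_distrib]
      congr 1
      · refine Finset.sum_congr rfl fun t ht => ?_
        rw [show a + 1 - (t + 1) = a - t by omega]
        ring
      · simp
    rw [h1, ih, sum_range_sub_add_choose, show a + 1 + r + 2 = (a + r + 2) + 1 by ring,
      Nat.choose_succ_succ (a + r + 2), add_comm]
    congr 2
    omega

/-- Terms with `t > q - r` vanish, so the upper limit is irrelevant. The condition on `r` makes this
true also where `q - t` is truncated to zero. -/
theorem sum_range_succ_mul_choose_le (q m r : ℕ) (hr : 1 ≤ r) :
    ∑ t ∈ Finset.range m, (t + 1) * (q - t).choose r ≤ (q + 2).choose (r + 2) := by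
  rcases lt_or_ge q r with hq | hq
  · rw [Finset.sum_eq_zero]
    · exact Nat.zero_le _
    · intro t _
      rw [Nat.choose_eq_zero_of_lt (by omega), mul_zero]
  · obtain ⟨b, rfl⟩ := Nat.exists_eq_add_of_le' hq
    rw [← sum_range_succ_mul_choose]
    calc ∑ t ∈ Finset.range m, (t + 1) * (b + r - t).choose r
        ≤ ∑ t ∈ Finset.range (b + 1), (t + 1) * (b + r - t).choose r := by
          refine Finset.sum_le_sum_of_ne_zero fun t _ hne => ?_
          by_contra ht
          rw [Finset.mem_range] at ht
          exact hne (by rw [Nat.choose_eq_zero_of_lt (by omega), mul_zero])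
      _ = _ := by
          refine Finset.sum_congr rfl fun t ht => ?_
          rw [Finset.mem_range] at ht
          rw [show b + r - t = b - t + r by omega]

/-- Both binomials reproduce under the recursion, as each step is a convolution with the weights `t
+ 1`, which raises the lower index by two. -/
theorem gBound_le_choose_add_choose {d n w : ℕ} (hn : 2 * (d + 1) ≤ n) (hw : 1 ≤ w) :
    gBound d n w ≤ (w - 1 + 2 * d).choose (2 * d) + (n - 2).choose (2 * d + 1) := by
  induction d generalizing n w with
  | zero =>
    rw [gBound]
    split_ifs
    · simp
    · simp only [mul_zero, add_zero, Nat.choose_zero_right, zero_add, Nat.choose_one_right]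
      omega
  | succ d ih =>
    obtain ⟨a, rfl⟩ := Nat.exists_eq_add_of_le' hw
    rw [gBound_succ_eq hw, Finset.sum_range_succ', zero_mul, add_zero]
    have h1 : ∀ t ∈ Finset.range a,
        (t + 1) * gBound d (max (n - 1 - (t + 1)) (2 * (d + 1))) (a + 1 - (t + 1) + 1) ≤
        (t + 1) * (a - t + 2 * d).choose (2 * d) +
          (t + 1) * (n - 4 - t).choose (2 * d + 1) := by
      intro t ht
      rw [← mul_add]
      refine Nat.mul_le_mul_left _ ((ih (le_max_right _ _) (by omega)).trans ?_)
      refine add_le_add (le_of_eq (by congr 1; omega)) ?_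
      -- When the maximum is attained by `2 * (d + 1)`, the second binomial is `(2d).choose (2d +
      -- 1)`, which is zero.
      rcases le_total (n - 1 - (t + 1)) (2 * (d + 1)) with h | h
      · rw [max_eq_right h, Nat.choose_eq_zero_of_lt (by omega)]
        exact Nat.zero_le _
      · rw [max_eq_left h]
        exact Nat.choose_le_choose _ (by omega)
    calc a + 1 + ∑ t ∈ Finset.range a,
          (t + 1) * gBound d (max (n - 1 - (t + 1)) (2 * (d + 1))) (a + 1 - (t + 1) + 1)
        ≤ a + 1 + (∑ t ∈ Finset.range a, (t + 1) * (a - t + 2 * d).choose (2 * d) +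
            ∑ t ∈ Finset.range a, (t + 1) * (n - 4 - t).choose (2 * d + 1)) := by
          rw [← Finset.sum_add_distrib]
          exact Nat.add_le_add_left (Finset.sum_le_sum h1) _
      -- The isolated summand `a + 1` is the missing term `t = a` of the first sum.
      _ = ∑ t ∈ Finset.range (a + 1), (t + 1) * (a - t + 2 * d).choose (2 * d) +
            ∑ t ∈ Finset.range a, (t + 1) * (n - 4 - t).choose (2 * d + 1) := by
          rw [Finset.sum_range_succ, Nat.sub_self, zero_add, Nat.choose_self]
          ring
      _ ≤ _ := by
          rw [sum_range_succ_mul_choose]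
          refine add_le_add (le_of_eq (by congr 1)) ?_
          refine (sum_range_succ_mul_choose_le (n - 4) a (2 * d + 1) (by omega)).trans
            (le_of_eq ?_)
          congr 1
          omega

/-- For clique number two only `j = 1` contributes, giving `2 + (n - 3)`. -/
theorem gBound_two {d n : ℕ} (hn : 2 * (d + 1) ≤ n) : gBound d n 2 = n - 1 := by
  induction d generalizing n with
  | zero => simp [gBound]
  | succ d ih =>
    rw [gBound_succ_eq (by omega), Finset.sum_range_succ, Finset.sum_range_one, zero_mul,
      max_eq_left (by omega), ih (by omega)]
    omega

end Binomial

/-! ### Graphs with vanishing Betti numbers are free of the forbidden graphs -/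

section Matchings

/-- The edges `a l — b l` form an induced matching, and the vertices `a l` form a maximal
independent set. -/
structure IsFacetMatching {V : Type*} (G : SimpleGraph V) {c : ℕ} (a b : Fin c → V) : Prop where
  adj : ∀ l, G.Adj (a l) (b l)
  sep_left : ∀ l l', l ≠ l' → a l ≠ a l' ∧ ¬ G.Adj (a l) (a l')
  sep_mixed : ∀ l l', l ≠ l' → a l ≠ b l' ∧ ¬ G.Adj (a l) (b l')
  sep_right : ∀ l l', l ≠ l' → b l ≠ b l' ∧ ¬ G.Adj (b l) (b l')
  dominating : ∀ x, (∀ l, x ≠ a l) → ∃ l, G.Adj (a l) x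

theorem IsFacetMatching.map {V W : Type*} {G : SimpleGraph V} {H : SimpleGraph W} {c : ℕ}
    {a b : Fin c → V} (h : IsFacetMatching G a b) (e : G ≃g H) :
    IsFacetMatching H (e ∘ a) (e ∘ b) where
  adj l := e.map_adj_iff.2 (h.adj l)
  sep_left l l' hl := ⟨e.injective.ne (h.sep_left l l' hl).1,
    fun hh => (h.sep_left l l' hl).2 (e.map_adj_iff.1 hh)⟩
  sep_mixed l l' hl := ⟨e.injective.ne (h.sep_mixed l l' hl).1,
    fun hh => (h.sep_mixed l l' hl).2 (e.map_adj_iff.1 hh)⟩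
  sep_right l l' hl := ⟨e.injective.ne (h.sep_right l l' hl).1,
    fun hh => (h.sep_right l l' hl).2 (e.map_adj_iff.1 hh)⟩
  dominating x hx := by
    obtain ⟨y, rfl⟩ := e.surjective x
    obtain ⟨l, hl⟩ := h.dominating y fun l hl => hx l (by rw [hl]; rfl)
    exact ⟨l, e.map_adj_iff.2 hl⟩

/-- For `d = 0`, take a dominating vertex and any other vertex. In the step the edge of $K_2$ is
added to the matching; its end also dominates the vertices of the joined clique. -/
theorem exists_isFacetMatching {d n : ℕ} {H : SimpleGraph (Fin n)} (h : IsBGraph d n H) :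
    ∃ a b : Fin (d + 1) → Fin n, IsFacetMatching H a b := by
  classical
  induction d generalizing n with
  | zero =>
    obtain ⟨hn, hmax⟩ := h
    have : Nonempty (Fin n) := ⟨⟨0, by omega⟩⟩
    obtain ⟨v, hv⟩ := H.exists_maximal_degree_vertex
    have huniv : ∀ x, x ≠ v → H.Adj v x := by
      have hsub : H.neighborFinset v ⊆ Finset.univ.erase v := by
        intro x hx
        rw [SimpleGraph.mem_neighborFinset] at hx
        simp [hx.ne.symm]
      have heq := Finset.eq_of_subset_of_card_le hsub (by
        rw [Finset.card_erase_of_mem (Finset.mem_univ _), Finset.card_univ, Fintype.card_fin,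
          SimpleGraph.card_neighborFinset_eq_degree, ← hv]
        convert hmax.ge)
      intro x hx
      rw [← SimpleGraph.mem_neighborFinset, heq]
      simpa using hx
    have : Nontrivial (Fin n) := Fin.nontrivial_iff_two_le.2 hn
    obtain ⟨u, hu⟩ := exists_ne v
    exact ⟨fun _ => v, fun _ => u, fun _ => huniv u hu,
      fun l l' hl => absurd (Fin.ext (by omega)) hl,
      fun l l' hl => absurd (Fin.ext (by omega)) hl,
      fun l l' hl => absurd (Fin.ext (by omega)) hl, fun x hx => ⟨0, huniv x (hx 0)⟩⟩
  | succ d ih =>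
    obtain ⟨m, -, -, H', hH', ⟨e⟩⟩ := h
    obtain ⟨a, b, hab⟩ := ih hH'
    suffices h : IsFacetMatching (graphJoin (⊤ : SimpleGraph (Fin (n - m - 2)))
        ((⊤ : SimpleGraph (Fin 2)) ⊕g H'))
        (Fin.cons (Sum.inr (Sum.inl 0)) fun l => Sum.inr (Sum.inr (a l)))
        (Fin.cons (Sum.inr (Sum.inl 1)) fun l => Sum.inr (Sum.inr (b l))) from
      ⟨_, _, h.map e.symm⟩
    refine ⟨?_, ?_, ?_, ?_, ?_⟩
    · refine Fin.cases ?_ fun l => ?_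
      · simp [graphJoin]
      · simpa [graphJoin] using hab.adj l
    · refine Fin.cases (Fin.cases (by simp) fun l' _ => ?_) fun l => Fin.cases (fun _ => ?_)
        fun l' hl => ?_
      · simp [graphJoin]
      · simp [graphJoin]
      · simpa [graphJoin] using hab.sep_left l l' (by simpa using hl)
    · refine Fin.cases (Fin.cases (by simp) fun l' _ => ?_) fun l => Fin.cases (fun _ => ?_)
        fun l' hl => ?_
      · simp [graphJoin]
      · simp [graphJoin]
      · simpa [graphJoin] using hab.sep_mixed l l' (by simpa using hl)
    · refine Fin.cases (Fin.cases (by simp) fun l' _ => ?_) fun l => Fin.cases (fun _ => ?_)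
        fun l' hl => ?_
      · simp [graphJoin]
      · simp [graphJoin]
      · simpa [graphJoin] using hab.sep_right l l' (by simpa using hl)
    · rintro (x | x | x) hx
      · exact ⟨0, by simp [graphJoin]⟩
      · refine ⟨0, ?_⟩
        have := hx 0
        simp only [Fin.cons_zero, ne_eq, Sum.inr.injEq, Sum.inl.injEq] at this
        simpa [graphJoin] using Ne.symm this
      · obtain ⟨l, hl⟩ := hab.dominating x fun l hl => hx l.succ (by simp [hl])
        exact ⟨l.succ, by simpa [graphJoin] using hl⟩

end Matchings

/-! ### Cross-polytope cycles and the nonvanishing of homology -/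

section Cycles

variable {𝕜 : Type*} [Field 𝕜] {V : Type*} [LinearOrder V]

/-- The sign with which a vertex is added to a face. -/
def faceSign (𝕜 : Type*) [Field 𝕜] (a : V) (σ : Finset V) : 𝕜 := (-1) ^ (σ.filter (· < a)).card

theorem faceSign_mul_self (a : V) (σ : Finset V) : faceSign 𝕜 a σ * faceSign 𝕜 a σ = 1 := by
  rw [faceSign, ← pow_add, ← two_mul, pow_mul]
  simp

theorem faceSign_insert {a v : V} {σ : Finset V} (ha : a ∉ σ) :
    faceSign 𝕜 v (insert a σ) = (if a < v then -1 else 1) * faceSign 𝕜 v σ := by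
  unfold faceSign
  rw [Finset.filter_insert]
  split_ifs with h
  · rw [Finset.card_insert_of_notMem (by simp [ha]), pow_succ']
  · rw [one_mul]

theorem simplicialBoundary_single (σ : Finset V) (r : 𝕜) :
    simplicialBoundary 𝕜 (Finsupp.single σ r) =
      r • ∑ v ∈ σ, Finsupp.single (σ.erase v) (faceSign 𝕜 v σ) := by
  rw [simplicialBoundary, Finsupp.linearCombination_single]
  rfl

variable (𝕜) in
/-- The cone over a chain with apex `a`. -/
def chainCone (a : V) : (Finset V →₀ 𝕜) →ₗ[𝕜] (Finset V →₀ 𝕜) :=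
  Finsupp.linearCombination 𝕜 fun σ => Finsupp.single (insert a σ) (faceSign 𝕜 a σ)

theorem chainCone_single (a : V) (σ : Finset V) (r : 𝕜) :
    chainCone 𝕜 a (Finsupp.single σ r) = r • Finsupp.single (insert a σ) (faceSign 𝕜 a σ) := by
  rw [chainCone, Finsupp.linearCombination_single]

/-- The cone is a contracting homotopy. For each `v` in the face, inserting `a` and erasing `v`
anticommute: exactly one of the two sign counts notices the other vertex. -/
theorem boundary_cone_single {a : V} {σ : Finset V} (ha : a ∉ σ) :
    simplicialBoundary 𝕜 (chainCone 𝕜 a (Finsupp.single σ 1)) =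
      Finsupp.single σ 1 - chainCone 𝕜 a (simplicialBoundary 𝕜 (Finsupp.single σ 1)) := by
  rw [chainCone_single, one_smul, simplicialBoundary_single, simplicialBoundary_single, one_smul,
    Finset.sum_insert ha, Finset.erase_insert ha, faceSign_insert ha, smul_add,
    sub_eq_add_neg, map_sum]
  congr 1
  · simp [faceSign_mul_self]
  · rw [Finset.smul_sum, ← Finset.sum_neg_distrib]
    refine Finset.sum_congr rfl fun v hv => ?_
    have hva : v ≠ a := fun h => ha (h ▸ hv)
    rw [chainCone_single, Finset.erase_insert_of_ne hva.symm, Finsupp.smul_single,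
      Finsupp.smul_single, ← Finsupp.single_neg, faceSign_insert ha]
    congr 1
    -- Relates the sign of `a` in the face to its sign after removing `v`; it flips exactly when `v
    -- < a`.
    have h1 := faceSign_insert (𝕜 := 𝕜) (v := a) (Finset.notMem_erase v σ)
    rw [Finset.insert_erase hv] at h1
    rw [h1, smul_eq_mul, smul_eq_mul]
    rcases lt_or_gt_of_ne hva with h | h
    · rw [if_pos h, if_neg h.not_gt]
      ring
    · rw [if_neg h.not_gt, if_pos h]
      ring

theorem boundary_cone {a : V} {z : Finset V →₀ 𝕜}
    (hz : z ∈ Finsupp.supported 𝕜 𝕜 {σ : Finset V | a ∉ σ}) :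
    simplicialBoundary 𝕜 (chainCone 𝕜 a z) = z - chainCone 𝕜 a (simplicialBoundary 𝕜 z) := by
  rw [Finsupp.supported_eq_span_single] at hz
  induction hz using Submodule.span_induction with
  | mem x hx =>
    obtain ⟨σ, hσ, rfl⟩ := hx
    exact boundary_cone_single hσ
  | zero => simp
  | add x y _ _ hx hy => simp only [map_add, hx, hy]; abel
  | smul r x _ hx => simp only [map_smul, hx, smul_sub]

theorem cone_mem_supported {a : V} {z : Finset V →₀ 𝕜} {s t : Set (Finset V)}
    (hz : z ∈ Finsupp.supported 𝕜 𝕜 s) (h : ∀ σ ∈ s, insert a σ ∈ t) :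
    chainCone 𝕜 a z ∈ Finsupp.supported 𝕜 𝕜 t := by
  rw [Finsupp.supported_eq_span_single] at hz
  induction hz using Submodule.span_induction with
  | mem x hx =>
    obtain ⟨σ, hσ, rfl⟩ := hx
    rw [chainCone_single]
    exact Submodule.smul_mem _ _ (Finsupp.single_mem_supported 𝕜 _ (h σ hσ))
  | zero => simp
  | add x y _ _ hx hy => rw [map_add]; exact Submodule.add_mem _ hx hy
  | smul r x _ hx => rw [map_smul]; exact Submodule.smul_mem _ _ hx

theorem cone_apply_insert {a : V} {z : Finset V →₀ 𝕜}
    (hz : z ∈ Finsupp.supported 𝕜 𝕜 {σ : Finset V | a ∉ σ}) {F : Finset V} (hF : a ∉ F) :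
    chainCone 𝕜 a z (insert a F) = faceSign 𝕜 a F * z F := by
  rw [Finsupp.supported_eq_span_single] at hz
  induction hz using Submodule.span_induction with
  | mem x hx =>
    obtain ⟨σ, hσ, rfl⟩ := hx
    rw [chainCone_single, one_smul]
    by_cases h : σ = F
    · subst h
      simp
    · have : insert a σ ≠ insert a F := fun hh => h (by
        rw [← Finset.erase_insert hσ, hh, Finset.erase_insert hF])
      simp [h, this]
  | zero => simp
  | add x y _ _ hx hy => simp only [map_add, Finsupp.add_apply, hx, hy]; ring
  | smul r x _ hx => simp only [map_smul, Finsupp.smul_apply, hx, smul_eq_mul]; ring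

/-- The cycle is the iterated join of the zero-spheres `a l - b l`: coning a cycle over `a 0` and
over `b 0` gives two chains with the same boundary, and their difference is the next cycle. -/
theorem exists_cycle {G : SimpleGraph V} {c : ℕ} (a b : Fin c → V)
    (hadj : ∀ l, G.Adj (a l) (b l))
    (haa : ∀ l l', l ≠ l' → a l ≠ a l' ∧ ¬ G.Adj (a l) (a l'))
    (hab : ∀ l l', l ≠ l' → a l ≠ b l' ∧ ¬ G.Adj (a l) (b l'))
    (hbb : ∀ l l', l ≠ l' → b l ≠ b l' ∧ ¬ G.Adj (b l) (b l')) :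
    ∃ z : Finset V →₀ 𝕜, simplicialBoundary 𝕜 z = 0 ∧
      z ∈ Finsupp.supported 𝕜 𝕜 {σ : Finset V | G.IsIndepSet (σ : Set V) ∧ σ.card = c ∧
        ∀ x ∈ σ, ∃ l, x = a l ∨ x = b l} ∧ z (Finset.univ.image a) ≠ 0 := by
  induction c with
  | zero =>
    refine ⟨Finsupp.single ∅ 1, ?_, Finsupp.single_mem_supported 𝕜 _ ?_, ?_⟩
    · rw [simplicialBoundary_single]
      simp
    · simp
    · simp
  | succ c ih =>
    obtain ⟨z, hz0, hzs, hzF⟩ := ih (fun l => a l.succ) (fun l => b l.succ)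
      (fun l => hadj _) (fun l l' h => haa _ _ (by simpa using h))
      (fun l l' h => hab _ _ (by simpa using h)) (fun l l' h => hbb _ _ (by simpa using h))
    set s : Set (Finset V) := {σ : Finset V | G.IsIndepSet (σ : Set V) ∧ σ.card = c ∧
        ∀ x ∈ σ, ∃ l : Fin c, x = a l.succ ∨ x = b l.succ} with hs
    have hsa : ∀ σ ∈ s, ∀ x ∈ σ, a 0 ≠ x ∧ ¬ G.Adj (a 0) x := by
      rintro σ ⟨-, -, hσ⟩ x hx
      obtain ⟨l, rfl | rfl⟩ := hσ x hx
      · exact haa _ _ (Fin.succ_ne_zero l).symm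
      · exact hab _ _ (Fin.succ_ne_zero l).symm
    have hsb : ∀ σ ∈ s, ∀ x ∈ σ, b 0 ≠ x ∧ ¬ G.Adj (b 0) x := by
      rintro σ ⟨-, -, hσ⟩ x hx
      obtain ⟨l, rfl | rfl⟩ := hσ x hx
      · have := hab _ _ (Fin.succ_ne_zero l)
        exact ⟨this.1.symm, fun h => this.2 h.symm⟩
      · exact hbb _ _ (Fin.succ_ne_zero l).symm
    have hza : z ∈ Finsupp.supported 𝕜 𝕜 {σ : Finset V | a 0 ∉ σ} :=
      Finsupp.supported_mono (fun σ hσ h => (hsa σ hσ _ h).1 rfl) hzs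
    have hzb : z ∈ Finsupp.supported 𝕜 𝕜 {σ : Finset V | b 0 ∉ σ} :=
      Finsupp.supported_mono (fun σ hσ h => (hsb σ hσ _ h).1 rfl) hzs
    have hins : ∀ x, (x = a 0 ∨ x = b 0) → (∀ σ ∈ s, ∀ y ∈ σ, x ≠ y ∧ ¬ G.Adj x y) → ∀ σ ∈ s,
        insert x σ ∈ {σ : Finset V | G.IsIndepSet (σ : Set V) ∧ σ.card = c + 1 ∧
          ∀ x ∈ σ, ∃ l, x = a l ∨ x = b l} := by
      intro x hx hsx σ hσ
      refine ⟨?_, ?_, ?_⟩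
      · rw [Finset.coe_insert]
        intro u hu v hv huv
        rcases hu with rfl | hu <;> rcases hv with rfl | hv
        · exact absurd rfl huv
        · exact (hsx σ hσ v hv).2
        · exact fun h => (hsx σ hσ u hu).2 h.symm
        · exact hσ.1 hu hv huv
      · rw [Finset.card_insert_of_notMem fun h => (hsx σ hσ x h).1 rfl, hσ.2.1]
      · intro y hy
        rcases Finset.mem_insert.1 hy with rfl | hy
        · exact ⟨0, hx⟩
        · obtain ⟨l, hl⟩ := hσ.2.2 y hy
          exact ⟨l.succ, hl⟩
    refine ⟨chainCone 𝕜 (a 0) z - chainCone 𝕜 (b 0) z, ?_, Submodule.sub_mem _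
      (cone_mem_supported hzs (hins _ (Or.inl rfl) hsa))
      (cone_mem_supported hzs (hins _ (Or.inr rfl) hsb)), ?_⟩
    · rw [map_sub, boundary_cone hza, boundary_cone hzb, hz0]
      simp
    · have hF : (Finset.univ.image a : Finset V) =
          insert (a 0) (Finset.univ.image fun l : Fin c => a l.succ) := by
        rw [Fin.univ_succ, Finset.cons_eq_insert, Finset.image_insert, Finset.map_eq_image,
          Finset.image_image]
        rfl
      have h0 : a 0 ∉ (Finset.univ.image fun l : Fin c => a l.succ) := by
        simp only [Finset.mem_image, Finset.mem_univ, true_and, not_exists]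
        exact fun l => (haa _ _ (Fin.succ_ne_zero l)).1
      -- Faces in the cone over `b 0` contain `b 0`, which is none of the `a l`; so only the other
      -- cone contributes to this coefficient.
      have hb : chainCone 𝕜 (b 0) z (Finset.univ.image a) = 0 := by
        have hmem : chainCone 𝕜 (b 0) z ∈ Finsupp.supported 𝕜 𝕜 {σ : Finset V | b 0 ∈ σ} :=
          cone_mem_supported hzs fun σ _ => Finset.mem_insert_self _ _
        by_contra hne
        have := (Finsupp.mem_supported 𝕜 _).1 hmem (Finsupp.mem_support_iff.2 hne)
        simp only [Set.mem_ofPred_eq, Finset.mem_image, Finset.mem_univ, true_and] at this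
        obtain ⟨l, hl⟩ := this
        rcases eq_or_ne l 0 with rfl | h
        · exact (hadj 0).ne hl
        · exact (hab l 0 h).1 hl
      rw [Finsupp.sub_apply, hb, sub_zero, hF, cone_apply_insert hza h0]
      refine mul_ne_zero ?_ hzF
      intro h
      have := faceSign_mul_self (𝕜 := 𝕜) (a 0) (Finset.univ.image fun l : Fin c => a l.succ)
      rw [h] at this
      simp at this

/-- The set of the `a l` is a facet, so its coefficient vanishes in every boundary, but not in the
cycle of `exists_cycle`. -/
theorem indepHomologyDim_ne_zero [Finite V] {G : SimpleGraph V} {c : ℕ} {a b : Fin c → V}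
    (h : IsFacetMatching G a b) : indepHomologyDim 𝕜 G c ≠ 0 := by
  obtain ⟨z, hz0, hzs, hzF⟩ := exists_cycle (𝕜 := 𝕜) a b h.adj h.sep_left h.sep_mixed h.sep_right
  have hcyc : z ∈ indepCycles 𝕜 G c := by
    refine ⟨Finsupp.supported_mono ?_ hzs, hz0⟩
    exact fun σ hσ => ⟨hσ.1, hσ.2.1⟩
  have hbd : z ∉ indepBoundaries 𝕜 G c := by
    rintro ⟨y, hy, rfl⟩
    refine hzF ?_
    clear hzF hcyc hz0 hzs
    rw [indepChains, Finsupp.supported_eq_span_single, SetLike.mem_coe] at hy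
    induction hy using Submodule.span_induction with
    | mem x hx =>
      obtain ⟨σ, ⟨hσ, -⟩, rfl⟩ := hx
      rw [simplicialBoundary_single, one_smul, Finsupp.finsetSum_apply]
      refine Finset.sum_eq_zero fun v hv => ?_
      rw [Finsupp.single_apply, if_neg]
      -- If removing `v` from an independent set left exactly the `a l`, then `v` would be adjacent
      -- to one of them by domination.
      intro heq
      have hmem : ∀ l, a l ∈ σ.erase v := fun l => by
        rw [heq]
        exact Finset.mem_image_of_mem _ (Finset.mem_univ l)
      obtain ⟨l, hl⟩ := h.dominating v fun l hl => Finset.ne_of_mem_erase (hmem l) hl.symm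
      exact hσ (Finset.mem_of_mem_erase (hmem l)) hv hl.ne hl
    | zero => simp
    | add x y _ _ hx hy => rw [map_add, Finsupp.add_apply, hx, hy, add_zero]
    | smul r x _ hx => rw [map_smul, Finsupp.smul_apply, hx, smul_zero]
  intro h0
  rw [indepHomologyDim, Submodule.finrank_eq_zero] at h0
  have := Submodule.mem_map_of_mem (f := (indepBoundaries 𝕜 G c).mkQ) hcyc
  rw [h0, Submodule.mem_bot, Submodule.mkQ_apply, Submodule.Quotient.mk_eq_zero] at this
  exact hbd this

/-- The vertex set of an induced forbidden graph has `j` elements and so indexes a summand of the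
Betti number. The matching has `j - i - 1` edges, which fits the degree of that summand. -/
theorem bFree_of_edgeIdealBetti_eq_zero {N i j : ℕ} {G : SimpleGraph (Fin N)} (hij : i + 2 ≤ j)
    (h : edgeIdealBetti 𝕜 G i j = 0) : BFree j (j - i - 2) G := by
  rintro H hH ⟨f⟩
  rw [edgeIdealBetti, if_pos (by omega), Finset.sum_eq_zero_iff] at h
  have hW := h (Finset.univ.map f.toEmbedding) (by simp)
  obtain ⟨a, b, hab⟩ := exists_isFacetMatching hH
  have hrange : ∀ x, f x ∈ ((Finset.univ.map f.toEmbedding : Finset (Fin N)) : Set (Fin N)) := by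
    intro x
    simp
  let e : H ≃g G.induce ((Finset.univ.map f.toEmbedding : Finset (Fin N)) : Set (Fin N)) :=
    { toEquiv := Equiv.ofBijective (fun x => ⟨f x, hrange x⟩)
        ⟨fun x y hxy => f.injective (congrArg Subtype.val hxy), fun ⟨y, hy⟩ => by
          obtain ⟨x, -, rfl⟩ := Finset.mem_map.1 (Finset.mem_coe.1 hy)
          exact ⟨x, rfl⟩⟩
      map_rel_iff' := f.map_adj_iff }
  have := indepHomologyDim_ne_zero (𝕜 := 𝕜) (hab.map e)
  rw [show j - i - 2 + 1 = j - i - 1 by omega] at this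
  exact this hW

end Cycles

namespace WordRAM

/-! ### Sweeps over the vertices and over the neighbours of a vertex -/

section Control

/-- `st` and `nb` are the two arrays of adjacency lists of the graph `G`. -/
structure IsAdjTable {N : ℕ} (G : SimpleGraph (Fin N)) (st nb : ℕ → ℕ) : Prop where
  zero : st 0 = 0
  mono : ∀ v < N, st v ≤ st (v + 1)
  bij : ∀ v : Fin N, Set.BijOn nb (Set.Ico (st v) (st (v + 1)))
    ((fun w : Fin N => (w : ℕ)) '' G.neighborSet v)

variable {N : ℕ} {G : SimpleGraph (Fin N)} {st nb : ℕ → ℕ}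

namespace IsAdjTable

theorem ncard_eq (h : IsAdjTable G st nb) (v : Fin N) :
    (G.neighborSet v).ncard = st (v + 1) - st v := by
  have h1 := (h.bij v).injOn.ncard_image
  rw [(h.bij v).image_eq, Set.ncard_image_of_injective _ Fin.val_injective] at h1
  rw [h1, Set.ncard_eq_toFinset_card']
  simp

theorem monotone (h : IsAdjTable G st nb) {v w : ℕ} (hvw : v ≤ w) (hw : w ≤ N) : st v ≤ st w := by
  induction w, hvw using Nat.le_induction with
  | base => exact le_rfl
  | succ w hvw ih => exact (ih (by omega)).trans (h.mono w (by omega))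

theorem eq_sum (h : IsAdjTable G st nb) : st N = ∑ v : Fin N, (G.neighborSet v).ncard := by
  simp only [h.ncard_eq]
  rw [Fin.sum_univ_eq_sum_range fun v => st (v + 1) - st v]
  have : ∀ k ≤ N, st k = ∑ v ∈ Finset.range k, (st (v + 1) - st v) := by
    intro k hk
    induction k with
    | zero => simp [h.zero]
    | succ k ih =>
      rw [Finset.sum_range_succ, ← ih (by omega)]
      have := h.mono k (by omega)
      omega
  exact this N le_rfl

theorem eq_two_mul_ncard (h : IsAdjTable G st nb) : st N = 2 * G.edgeSet.ncard := by
  classical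
  rw [h.eq_sum, ← SimpleGraph.coe_edgeFinset, Set.ncard_coe_finset,
    ← SimpleGraph.sum_degrees_eq_twice_card_edges]
  refine Finset.sum_congr rfl fun v _ => ?_
  rw [Set.ncard_eq_toFinset_card', ← SimpleGraph.card_neighborSet_eq_degree,
    Set.toFinset_card]

theorem le_sq (h : IsAdjTable G st nb) {v : ℕ} (hv : v ≤ N) : st v ≤ N * N := by
  refine (h.monotone hv le_rfl).trans ?_
  rw [h.eq_sum]
  calc ∑ v : Fin N, (G.neighborSet v).ncard ≤ ∑ v : Fin N, N := by
        refine Finset.sum_le_sum fun v _ => ?_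
        have := Set.ncard_le_card (G.neighborSet v)
        simpa using this
    _ = N * N := by simp

end IsAdjTable

/-- Run `body` for all values of register `1` below the value of register `0`. -/
def forVerts (body : Prog) : Prog :=
  block [.mov 1 (.lit 0), .loop (.lt (.reg 1) (.reg 0))
    (block [body, .arith 1 .add (.reg 1) (.lit 1)])]

/-- Run `body` for all neighbours of the vertex in register `1`; the neighbour is put into register
`5`, and register `2` holds the successor of the vertex. -/
def forNbrs (body : Prog) : Prog :=
  block [.arith 2 .add (.reg 1) (.lit 1), .load 3 0 (.reg 1), .load 4 0 (.reg 2),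
    .loop (.lt (.reg 3) (.reg 4))
      (block [.load 5 1 (.reg 3), body, .arith 3 .add (.reg 3) (.lit 1)])]

/-- Run `fetch`, which puts a value depending on register `6` into register `7`, while increasing
register `6`, until the value differs from register `2`. -/
def scan (fetch : Prog) : Prog :=
  block [fetch, .loop (.eq (.reg 7) (.reg 2)) (block [.arith 6 .add (.reg 6) (.lit 1), fetch])]

@[simp] theorem regs_forVerts (p : Prog) : (forVerts p).regs = insert 1 p.regs := by
  ext x; simp [forVerts]

@[simp] theorem arrs_forVerts (p : Prog) : (forVerts p).arrs = p.arrs := by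
  ext x; simp [forVerts]

@[simp] theorem regs_forNbrs (p : Prog) : (forNbrs p).regs = {2, 3, 4, 5} ∪ p.regs := by
  ext x; simp [forNbrs]; tauto

@[simp] theorem arrs_forNbrs (p : Prog) : (forNbrs p).arrs = p.arrs := by
  ext x; simp [forNbrs]

@[simp] theorem regs_scan (p : Prog) : (scan p).regs = insert 6 p.regs := by
  ext x; simp [scan]

@[simp] theorem arrs_scan (p : Prog) : (scan p).arrs = p.arrs := by
  ext x; simp [scan]

variable {B : ℕ}

/-- Costs proportional to degrees telescope along the table `st`, so that a sweep is linear in `st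
N`, twice the number of edges, plus `N`. -/
theorem Ends.forVerts (hG : IsAdjTable G st nb) (hNB : N ≤ B) {body : Prog}
    (hbody : ∀ x ≤ 1, x ∉ body.regs) {a b : ℕ} {I : ℕ → Memory → Prop}
    (hI : ∀ k s x, I k s → I k (s.setReg 1 x))
    (hstep : ∀ (v : Fin N) s, I v s → s.reg 0 = N → s.reg 1 = v →
      Ends B body s (a * (st (v + 1) - st v) + b) (I (v + 1)))
    {s : Memory} (h0 : s.reg 0 = N) (hs : I 0 s) :
    Ends B (forVerts body) s (a * st N + (b + 3) * N + 3) (I N) := by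
  have hloop : Ends B (.loop (.lt (.reg 1) (.reg 0))
      (block [body, .arith 1 .add (.reg 1) (.lit 1)])) (s.setReg 1 0)
      (a * (st N - st ((s.setReg 1 0).reg 1)) + (b + 3) * (N - (s.setReg 1 0).reg 1) + 1)
      (fun s' => (s'.reg 0 = N ∧ s'.reg 1 ≤ N ∧ I (s'.reg 1) s') ∧
        ¬ (Test.lt (.reg 1) (.reg 0)).holds s') := by
    refine Ends.loop (I := fun s' => s'.reg 0 = N ∧ s'.reg 1 ≤ N ∧ I (s'.reg 1) s')
      (Φ := fun s' => a * (st N - st (s'.reg 1)) + (b + 3) * (N - s'.reg 1) + 1)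
      (fun _ _ => by omega) ?_ ⟨by simpa using h0, by simp, by simpa using hI _ _ _ hs⟩
    rintro s ⟨hs0, hs1, hsI⟩ hc
    simp only [Test.holds_lt, Operand.val_reg, hs0] at hc
    refine ⟨1 + 1 + (a * (st (s.reg 1 + 1) - st (s.reg 1)) + b), ?_⟩
    refine Ends.cons_of (hstep ⟨s.reg 1, hc⟩ s hsI hs0 rfl) fun s' hs' hr _ => ?_
    have h0 := hr 0 (hbody 0 (by omega))
    have h1 := hr 1 (hbody 1 (by omega))
    refine Ends.cons_arith (by simp [h1]; omega) (Ends.nil ?_)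
    simp only [Memory.setReg_reg, Operand.val_reg, Operand.val_lit, Arith.val_add, h0, h1, hs0,
      if_true, if_false, zero_ne_one]
    refine ⟨⟨trivial, by omega, hI _ _ _ hs'⟩, ?_⟩
    have h2 := hG.monotone (Nat.le_add_right (s.reg 1) 1) hc
    have h3 := hG.monotone (Nat.succ_le_of_lt hc) le_rfl
    have h4 : st N - st (s.reg 1) =
      (st N - st (s.reg 1 + 1)) + (st (s.reg 1 + 1) - st (s.reg 1)) := by
      simp only [Nat.succ_eq_add_one] at h3
      omega
    have h5 : N - s.reg 1 = (N - (s.reg 1 + 1)) + 1 := by omega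
    rw [h4, h5, mul_add, mul_add]
    omega
  refine (Ends.cons_mov (by simp) (Ends.cons (hloop.mono le_rfl fun s' hs' =>
    Ends.nil (T := 0) ?_))).mono ?_ fun _ h => h
  · obtain ⟨⟨h0, h1, hsI⟩, hc⟩ := hs'
    simp only [Test.holds_lt, Operand.val_reg, h0, not_lt] at hc
    rwa [le_antisymm h1 hc] at hsI
  · simp [hG.zero]
    omega

/-- The invariant is indexed by the set of neighbours handled so far, since the order within an
adjacency list is arbitrary. -/
theorem Ends.forNbrs (hG : IsAdjTable G st nb) (hNB : N ≤ B) (hst : ∀ v ≤ N, st v ≤ B)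
    {body : Prog} (hbody : ∀ x ≤ 4, x ∉ body.regs) (hbody' : ∀ A ≤ 1, A ∉ body.arrs) {τ : ℕ}
    {I : Set (Fin N) → Memory → Prop}
    (hI : ∀ D s r x, 2 ≤ r → r ≤ 5 → I D s → I D (s.setReg r x)) {v : Fin N}
    (hstep : ∀ D (u : Fin N) s, I D s → G.Adj v u → s.reg 1 = v → s.reg 2 = v + 1 → s.reg 5 = u →
      Ends B body s τ (I (insert u D)))
    {s : Memory} (h1 : s.reg 1 = v) (ha0 : s.arr 0 = st) (ha1 : s.arr 1 = nb) (hs : I ∅ s) :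
    Ends B (forNbrs body) s ((τ + 4) * (st (v + 1) - st v) + 5) fun s' =>
      I (G.neighborSet v) s' ∧ s'.reg 2 = v + 1 := by
  have hv := v.2
  have hbij := hG.bij v
  have hnb : ∀ p, st v ≤ p → p < st (v + 1) → ∃ u : Fin N, nb p = u ∧ G.Adj v u := by
    intro p hp hp'
    obtain ⟨u, hu, hup⟩ := hbij.mapsTo ⟨hp, hp'⟩
    exact ⟨u, hup.symm, hu⟩
  let J : Memory → Prop := fun s' => s'.reg 1 = v ∧ s'.reg 2 = v + 1 ∧ s'.reg 4 = st (v + 1) ∧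
    s'.arr 0 = st ∧ s'.arr 1 = nb ∧ st v ≤ s'.reg 3 ∧ s'.reg 3 ≤ st (v + 1) ∧
    I {u | ∃ p, st v ≤ p ∧ p < s'.reg 3 ∧ nb p = u} s'
  have hloop : ∀ s₁, J s₁ → s₁.reg 3 = st v → Ends B (.loop (.lt (.reg 3) (.reg 4))
      (block [.load 5 1 (.reg 3), body, .arith 3 .add (.reg 3) (.lit 1)])) s₁
      ((τ + 4) * (st (v + 1) - st v) + 1) fun s' => J s' ∧
        ¬ (Test.lt (.reg 3) (.reg 4)).holds s' := by
    intro s₁ hJ hs₁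
    rw [← hs₁]
    refine Ends.loop (I := J) (Φ := fun s' => (τ + 4) * (st (v + 1) - s'.reg 3) + 1)
      (fun _ _ => by omega) ?_ hJ
    rintro s ⟨hs1, hs2, hs4, hs0, hsn, hs3, hs3', hsI⟩ hc
    simp only [Test.holds_lt, Operand.val_reg, hs4] at hc
    obtain ⟨u, hu, huv⟩ := hnb _ hs3 hc
    refine ⟨1 + 1 + τ + 1, Ends.cons_load (by simp [hsn, hu]; omega) ?_⟩
    refine Ends.cons_of (hstep _ u _ (hI _ _ 5 _ (by omega) (by omega) hsI) huv (by simpa using hs1)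
      (by simpa using hs2) (by simp [hsn, hu])) fun s' hs' hr har => ?_
    have e1 := hr 1 (hbody 1 (by omega))
    have e2 := hr 2 (hbody 2 (by omega))
    have e3 := hr 3 (hbody 3 (by omega))
    have e4 := hr 4 (hbody 4 (by omega))
    have a0 := har 0 (hbody' 0 (by omega))
    have a1 := har 1 (hbody' 1 (by omega))
    simp only [Memory.setReg_reg, Operand.val_reg, Memory.setReg_arr, OfNat.one_ne_ofNat,
      if_false, Nat.reduceEqDiff, hs1, hs2, hs4, hs0, hsn] at e1 e2 e3 e4 a0 a1
    have hle := hst (v + 1) (by omega)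
    refine Ends.cons_arith (by simp [e3]; omega) (Ends.nil ?_)
    have hset : {w : Fin N | ∃ p, st v ≤ p ∧ p < s.reg 3 + 1 ∧ nb p = w} =
        insert u {w : Fin N | ∃ p, st v ≤ p ∧ p < s.reg 3 ∧ nb p = w} := by
      ext w
      simp only [Set.mem_ofPred_eq, Set.mem_insert_iff]
      constructor
      · rintro ⟨p, hp, hp', hpw⟩
        rcases Nat.lt_succ_iff_lt_or_eq.1 hp' with hlt | rfl
        · exact Or.inr ⟨p, hp, hlt, hpw⟩
        · exact Or.inl (Fin.ext (hpw.symm.trans hu))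
      · rintro (rfl | ⟨p, hp, hp', hpw⟩)
        · exact ⟨_, hs3, by omega, hu⟩
        · exact ⟨p, hp, by omega, hpw⟩
    refine ⟨?_, ?_⟩
    · simp only [J, Memory.setReg_reg, Operand.val_reg, Operand.val_lit, Arith.val_add, e1, e2, e3,
        e4, Memory.setReg_arr, a0, a1, if_true, if_false, OfNat.one_ne_ofNat, Nat.reduceEqDiff,
        hset, true_and]
      exact ⟨by omega, by omega, hI _ _ 3 _ (by omega) (by omega) hs'⟩
    · simp only [Memory.setReg_reg, if_true, Operand.val_reg, Operand.val_lit, Arith.val_add, e3]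
      have : st (v + 1) - s.reg 3 = (st (v + 1) - (s.reg 3 + 1)) + 1 := by omega
      rw [this, mul_add]
      omega
  have hb0 := hst v (by omega)
  have hb1 := hst (v + 1) (by omega)
  refine (Ends.cons_arith (by simp [h1]; omega) (Ends.cons_load (by simp [ha0, h1, hb0])
    (Ends.cons_load (by simp [ha0, h1, hb1]) (Ends.cons ((hloop _ ?_ ?_).mono le_rfl
      fun s' hs' => Ends.nil (T := 0) ?_))))).mono (by omega) fun _ h => h
  · refine ⟨by simp [h1], by simp [h1], by simp [h1, ha0], by simp [ha0], by simp [ha1],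
      by simp [h1, ha0], by simpa [h1, ha0] using hG.mono v hv, ?_⟩
    refine hI _ _ 4 _ (by omega) (by omega) (hI _ _ 3 _ (by omega) (by omega)
      (hI _ _ 2 _ (by omega) (by omega) ?_))
    convert hs
    ext u
    simp only [Memory.setReg_reg, Operand.val_reg, Memory.setReg_arr, ha0, h1]
    simp
    intros
    omega
  · simp [h1, ha0]
  · obtain ⟨⟨hs1, hs2, hs4, hs0, hsn, hs3, hs3', hsI⟩, hc⟩ := hs'
    simp only [Test.holds_lt, Operand.val_reg, hs4, not_lt] at hc
    refine ⟨?_, hs2⟩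
    convert hsI
    ext u
    simp only [SimpleGraph.mem_neighborSet, Set.mem_ofPred_eq, le_antisymm hs3' hc]
    constructor
    · intro hu
      obtain ⟨p, hp, hpu⟩ := hbij.surjOn ⟨u, hu, rfl⟩
      exact ⟨p, hp.1, hp.2, hpu⟩
    · rintro ⟨p, hp, hp', hpu⟩
      obtain ⟨w, hw, hwu⟩ := hnb p hp hp'
      rwa [Fin.ext (hpu.symm.trans hw)]

theorem Ends.scan {fetch : Prog} (hf : ∀ x ∈ fetch.regs, x = 7) {F : ℕ → ℕ} {q₀ n τ vp : ℕ}
    {s : Memory} (hstep : ∀ s', s'.arr = s.arr → q₀ ≤ s'.reg 6 → s'.reg 6 ≤ q₀ + n →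
      Ends B fetch s' τ fun s'' => s''.arr = s.arr ∧ s''.reg 7 = F (s'.reg 6))
    (h2 : s.reg 2 = vp) (h6 : s.reg 6 = q₀) (hB : q₀ + n ≤ B)
    (hlt : ∀ a < n, F (q₀ + a) = vp) (hn : F (q₀ + n) ≠ vp) :
    Ends B (scan fetch) s ((τ + 3) * n + τ + 2) fun s' => s'.arr = s.arr ∧ s'.reg 6 = q₀ + n := by
  have hf2 : 2 ∉ fetch.regs := fun h => absurd (hf _ h) (by omega)
  have hf6 : 6 ∉ fetch.regs := fun h => absurd (hf _ h) (by omega)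
  have hloop : ∀ s₁ : Memory, s₁.arr = s.arr → s₁.reg 2 = vp → s₁.reg 6 = q₀ →
      s₁.reg 7 = F q₀ → Ends B (.loop (.eq (.reg 7) (.reg 2))
      (block [.arith 6 .add (.reg 6) (.lit 1), fetch])) s₁ ((τ + 3) * n + 1)
      fun s' => (s'.arr = s.arr ∧ s'.reg 2 = vp ∧ q₀ ≤ s'.reg 6 ∧ s'.reg 6 ≤ q₀ + n ∧
        s'.reg 7 = F (s'.reg 6)) ∧ ¬ (Test.eq (.reg 7) (.reg 2)).holds s' := by
    intro s₁ ha h2 h6 h7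
    rw [show n = q₀ + n - s₁.reg 6 by omega]
    refine Ends.loop (I := fun s' => s'.arr = s.arr ∧ s'.reg 2 = vp ∧ q₀ ≤ s'.reg 6 ∧
      s'.reg 6 ≤ q₀ + (q₀ + n - s₁.reg 6) ∧ s'.reg 7 = F (s'.reg 6))
      (Φ := fun s' => (τ + 3) * (q₀ + n - s'.reg 6) + 1)
      (fun _ _ => by omega) ?_ ⟨ha, h2, by omega, by omega, by rw [h7, h6]⟩
    rintro s' ⟨ha', h2', h6', h6'', h7'⟩ hc
    simp only [Test.holds_eq, Operand.val_reg, h7', h2'] at hc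
    have hne : s'.reg 6 ≠ q₀ + n := fun h => hn (h ▸ hc)
    refine ⟨0 + 1 + τ + 1, Ends.cons_arith (by simp; omega) (Ends.cons_of (hstep _ ha' (by
      simp; omega) (by simp; omega)) fun s'' hs'' hr _ => Ends.nil ?_)⟩
    have e2 := hr 2 hf2
    have e6 := hr 6 hf6
    simp only [Memory.setReg_reg, Operand.val_reg, Operand.val_lit, Arith.val_add, if_true,
      if_false, Nat.reduceEqDiff, h2'] at e2 e6 hs''
    rw [e6]
    refine ⟨⟨hs''.1, e2, by omega, by omega, hs''.2⟩, ?_⟩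
    rw [show q₀ + n - s'.reg 6 = q₀ + n - (s'.reg 6 + 1) + 1 by omega, mul_add]
    omega
  refine (Ends.cons_of (hstep s rfl (by omega) (by omega)) fun s₁ hs₁ hr _ =>
    Ends.cons ((hloop s₁ hs₁.1 ?_ ?_ ?_).mono le_rfl fun s' hs' =>
      Ends.nil (T := 0) ?_)).mono (by omega) fun _ h => h
  · rw [hr 2 hf2, h2]
  · rw [hr 6 hf6, h6]
  · rw [hs₁.2, h6]
  · obtain ⟨⟨ha', h2', h6', h6'', h7'⟩, hc⟩ := hs'
    refine ⟨ha', ?_⟩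
    simp only [Test.holds_eq, Operand.val_reg, h7', h2'] at hc
    by_contra hne
    refine hc ?_
    have := hlt (s'.reg 6 - q₀) (by omega)
    rwa [show q₀ + (s'.reg 6 - q₀) = s'.reg 6 by omega] at this

end Control
end WordRAM

namespace WordRAM

/-! ### Cliques stored in the rows of an array -/

section Rows

variable {N : ℕ} (G : SimpleGraph (Fin N))

/-- Row `c` of an array with rows of length `N + 2`. -/
def row (N : ℕ) (A : ℕ → ℕ) (c a : ℕ) : ℕ := if a < N + 2 then A (c * (N + 2) + a) else 0

/-- The row `R` holds the successors of the `k` vertices of a clique in `S`. -/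
structure ValidRow (S : Set (Fin N)) (R : ℕ → ℕ) (k : ℕ) : Prop where
  mem : ∀ a < k, ∃ u ∈ S, R a = u + 1
  adj : ∀ a < k, ∀ b < k, a ≠ b → ∀ u w : Fin N, R a = u + 1 → R b = w + 1 → G.Adj u w
  zero : ∀ a, k ≤ a → R a = 0

/-- There is a neighbour of `v` at position `a`. -/
def NbAt (R : ℕ → ℕ) (v : Fin N) (a : ℕ) : Prop := ∃ u : Fin N, R a = u + 1 ∧ G.Adj v u

/-- The first two positions without a neighbour of `v` are `i` and `j`. -/
def TypeRow (R : ℕ → ℕ) (v : Fin N) (i j : ℕ) : Prop :=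
  i < j ∧ ¬ NbAt G R v i ∧ ¬ NbAt G R v j ∧ ∀ a < j, a ≠ i → NbAt G R v a

/-- Adjacent vertices of `S` of the same type miss two vertices of the clique. -/
def StableRow (S : Set (Fin N)) (R : ℕ → ℕ) : Prop :=
  ∀ u ∈ S, ∀ v ∈ S, ∀ i j, TypeRow G R u i j → TypeRow G R v i j → G.Adj u v → R j ≠ 0

variable {G} {S : Set (Fin N)} {R : ℕ → ℕ} {k : ℕ} {u v : Fin N} {i j : ℕ}

theorem row_update_of_ne {A : ℕ → ℕ} {c c' a x : ℕ} (hc : c' ≠ c) (ha : a < N + 2) :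
    row N (Function.update A (c * (N + 2) + a) x) c' = row N A c' := by
  funext b
  unfold row
  split_ifs with hb
  · rw [Function.update_of_ne]
    intro h
    refine hc ?_
    have h1 : (c' * (N + 2) + b) / (N + 2) = c' := by
      rw [mul_comm, Nat.mul_add_div (by omega), Nat.div_eq_of_lt hb, add_zero]
    have h2 : (c * (N + 2) + a) / (N + 2) = c := by
      rw [mul_comm, Nat.mul_add_div (by omega), Nat.div_eq_of_lt ha, add_zero]
    rw [← h1, h, h2]
  · rfl

theorem row_update_self {A : ℕ → ℕ} {c a x : ℕ} (ha : a < N + 2) :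
    row N (Function.update A (c * (N + 2) + a) x) c = Function.update (row N A c) a x := by
  funext b
  unfold row
  rcases eq_or_ne b a with rfl | hb
  · simp [ha]
  · rw [Function.update_of_ne hb]
    split_ifs
    · rw [Function.update_of_ne (by omega)]
    · rfl

theorem row_apply {A : ℕ → ℕ} {c a : ℕ} (ha : a < N + 2) : row N A c a = A (c * (N + 2) + a) :=
  if_pos ha

namespace ValidRow

theorem lt_of_nbAt (h : ValidRow G S R k) {a : ℕ} (ha : NbAt G R v a) : a < k := by
  obtain ⟨u, hu, -⟩ := ha
  by_contra hk
  rw [h.zero a (by omega)] at hu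
  omega

theorem exists_embedding (h : ValidRow G S R k) :
    ∃ K : Fin k → Fin N, (∀ a : Fin k, R a = K a + 1 ∧ K a ∈ S) ∧ Function.Injective K ∧
      ∀ a b, a ≠ b → G.Adj (K a) (K b) := by
  choose K hK hR using fun a : Fin k => h.mem a a.2
  have hadj : ∀ a b, a ≠ b → G.Adj (K a) (K b) := fun a b hab =>
    h.adj a a.2 b b.2 (fun hh => hab (Fin.ext hh)) _ _ (hR a) (hR b)
  refine ⟨K, fun a => ⟨hR a, hK a⟩, fun a b hab => ?_, hadj⟩
  by_contra hne
  exact (hadj a b hne).ne hab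

theorem le_cliqueNum (h : ValidRow G S R k) : k ≤ G.cliqueNum := by
  classical
  obtain ⟨K, -, hinj, hadj⟩ := h.exists_embedding
  have : G.IsClique ((Finset.univ.image K : Finset (Fin N)) : Set (Fin N)) := by
    intro x hx y hy hxy
    simp only [Finset.coe_image, Finset.coe_univ, Set.image_univ, Set.mem_range] at hx hy
    obtain ⟨a, rfl⟩ := hx
    obtain ⟨b, rfl⟩ := hy
    exact hadj a b fun hab => hxy (by rw [hab])
  have := this.card_le_cliqueNum
  rwa [Finset.card_image_of_injective _ hinj, Finset.card_univ, Fintype.card_fin] at this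

theorem le_card (h : ValidRow G S R k) : k ≤ N := by
  obtain ⟨K, -, hinj, -⟩ := h.exists_embedding
  simpa using Fintype.card_le_of_injective K hinj

/-- Every position from `k` on is empty, so two positions without a neighbour always exist. -/
theorem exists_typeRow (h : ValidRow G S R k) (v : Fin N) : ∃ i j, TypeRow G R v i j := by
  classical
  have h1 : ∃ a, ¬ NbAt G R v a := ⟨k, fun hk => (h.lt_of_nbAt hk).false⟩
  have h2 : ∃ a, Nat.find h1 < a ∧ ¬ NbAt G R v a :=
    ⟨max k (Nat.find h1 + 1), by omega, fun hk => by have := h.lt_of_nbAt hk; omega⟩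
  refine ⟨Nat.find h1, Nat.find h2, (Nat.find_spec h2).1, Nat.find_spec h1, (Nat.find_spec h2).2,
    fun a ha hne => ?_⟩
  by_contra hn
  rcases lt_or_gt_of_ne hne with hlt | hlt
  · exact Nat.find_min h1 hlt hn
  · exact Nat.find_min h2 ha ⟨hlt, hn⟩

theorem right_le (h : ValidRow G S R k) (ht : TypeRow G R v i j) : j ≤ k + 1 := by
  by_contra! hlt
  have h0 := fun hne => h.lt_of_nbAt (ht.2.2.2 k (by omega) hne)
  have h1 := fun hne => h.lt_of_nbAt (ht.2.2.2 (k + 1) (by omega) hne)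
  omega

theorem left_le (h : ValidRow G S R k) (ht : TypeRow G R v i j) : i ≤ k := by
  by_contra! hlt
  have := ht.1
  exact (h.lt_of_nbAt (ht.2.2.2 k (by omega) (by omega))).false

theorem right_lt (h : ValidRow G S R k) (ht : TypeRow G R v i j) : j < N + 2 := by
  have := h.right_le ht
  have := h.le_card
  omega

/-- All positions below `j` except `i` hold distinct neighbours of `v`. This is what lets the scan
be charged to the degree. -/
theorem right_le_ncard (h : ValidRow G S R k) (ht : TypeRow G R v i j) :
    j ≤ (G.neighborSet v).ncard + 1 := by
  classical
  have h1 : ∀ a : ((Finset.range j).erase i : Finset ℕ), ∃ u : Fin N, R a = u + 1 ∧ G.Adj v u := by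
    rintro ⟨a, ha⟩
    simp only [Finset.mem_erase, Finset.mem_range] at ha
    exact ht.2.2.2 a ha.2 ha.1
  choose f hf hadj using h1
  have hinj : Function.Injective f := by
    intro a b hab
    by_contra hne
    have hlt : ∀ a : ((Finset.range j).erase i : Finset ℕ), (a : ℕ) < k := fun a =>
      h.lt_of_nbAt ⟨f a, hf a, hadj a⟩
    exact (h.adj a (hlt a) b (hlt b) (fun hh => hne (Subtype.ext hh)) _ _ (hf a) (hf b)).ne hab
  have := Set.ncard_le_ncard (s := Set.range f) (t := G.neighborSet v)
    (by rintro _ ⟨a, rfl⟩; exact hadj a) (Set.toFinite _)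
  rw [← Set.image_univ, Set.ncard_image_of_injective _ hinj, Set.ncard_univ,
    Nat.card_eq_fintype_card, Fintype.card_coe, Finset.card_erase_of_mem (by simpa using ht.1),
    Finset.card_range] at this
  omega

/-- Both vertices see everything below position `j` except at `i`, so they may be placed at `i` and
`j`. The clique grows by one if `j = k`, and by two for the type `(k, k + 1)`. -/
theorem augment (h : ValidRow G S R k) (hu : u ∈ S) (hv : v ∈ S) (huv : G.Adj u v)
    (tu : TypeRow G R u i j) (tv : TypeRow G R v i j) (h0 : R j = 0) :
    k < j + 1 ∧
      ValidRow G S (Function.update (Function.update R i (u + 1)) j (v + 1)) (j + 1) := by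
  have hk : k ≤ j := by
    by_contra! hlt
    obtain ⟨w, -, hw⟩ := h.mem j hlt
    omega
  set R' := Function.update (Function.update R i (u + 1)) j (v + 1) with hR'
  have hij := tu.1
  have cases : ∀ a < j + 1, (a = j ∧ R' a = v + 1) ∨ (a = i ∧ R' a = u + 1) ∨
      (a < k ∧ R' a = R a ∧ (∀ w : Fin N, R a = w + 1 → G.Adj u w ∧ G.Adj v w)) := by
    intro a ha
    rcases eq_or_ne a j with rfl | haj
    · exact Or.inl ⟨rfl, Function.update_self ..⟩
    rcases eq_or_ne a i with rfl | hai
    · exact Or.inr (Or.inl ⟨rfl, by rw [hR', Function.update_of_ne haj, Function.update_self]⟩)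
    obtain ⟨x, hx, hux⟩ := tu.2.2.2 a (by omega) hai
    obtain ⟨y, hy, hvy⟩ := tv.2.2.2 a (by omega) hai
    refine Or.inr (Or.inr ⟨h.lt_of_nbAt ⟨x, hx, hux⟩,
      by rw [hR', Function.update_of_ne haj, Function.update_of_ne hai], fun w hw => ?_⟩)
    rw [show w = x from Fin.ext (by omega)]
    rw [show y = x from Fin.ext (by omega)] at hvy
    exact ⟨hux, hvy⟩
  refine ⟨by omega, ?_, ?_, ?_⟩
  · intro a ha
    rcases cases a ha with ⟨-, h1⟩ | ⟨-, h1⟩ | ⟨h2, h1, -⟩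
    · exact ⟨v, hv, h1⟩
    · exact ⟨u, hu, h1⟩
    · rw [h1]
      exact h.mem a h2
  · intro a ha b hb hab x y hx hy
    rcases cases a ha with ⟨a1, a2⟩ | ⟨a1, a2⟩ | ⟨a1, a2, a3⟩ <;>
      rcases cases b hb with ⟨b1, b2⟩ | ⟨b1, b2⟩ | ⟨b1, b2, b3⟩
    · omega
    · rw [show x = v from Fin.ext (by omega), show y = u from Fin.ext (by omega)]
      exact huv.symm
    · rw [show x = v from Fin.ext (by omega)]
      exact (b3 y (by omega)).2
    · rw [show x = u from Fin.ext (by omega), show y = v from Fin.ext (by omega)]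
      exact huv
    · omega
    · rw [show x = u from Fin.ext (by omega)]
      exact (b3 y (by omega)).1
    · rw [show y = v from Fin.ext (by omega)]
      exact (a3 x (by omega)).2.symm
    · rw [show y = u from Fin.ext (by omega)]
      exact (a3 x (by omega)).1.symm
    · exact h.adj a a1 b b1 hab x y (by omega) (by omega)
  · intro a ha
    rw [hR', Function.update_of_ne (by omega), Function.update_of_ne (by omega)]
    exact h.zero a (by omega)

/-- Passes from the array encoding to the combinatorial structure used for counting colors; `v₀`
only fills the sequence beyond the clique. -/
theorem exists_isSplit (h : ValidRow G S R k) (hS : StableRow G S R) (v₀ : Fin N)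
    {i j : Fin N → ℕ} (ht : ∀ v, v ∈ S → TypeRow G R v (i v) (j v)) :
    ∃ K : ℕ → Fin N, IsSplit G S k K i j := by
  obtain ⟨K, hK, -, hadj⟩ := h.exists_embedding
  have hnb : ∀ v, ∀ a (ha : a < k), NbAt G R v a ↔ G.Adj v (K ⟨a, ha⟩) := by
    intro v a ha
    have h1 : R a = K ⟨a, ha⟩ + 1 := (hK ⟨a, ha⟩).1
    constructor
    · rintro ⟨u, hu, hvu⟩
      rwa [show K ⟨a, ha⟩ = u from Fin.ext (by omega)]
    · exact fun hv => ⟨_, h1, hv⟩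
  have hK' : ∀ a (ha : a < k), (if ha : a < k then K ⟨a, ha⟩ else v₀) = K ⟨a, ha⟩ := fun a ha =>
    dif_pos ha
  refine ⟨fun a => if ha : a < k then K ⟨a, ha⟩ else v₀, ?_, ?_, ?_, ?_, ?_, ?_, ?_⟩
  · intro a ha
    rw [hK' a ha]
    exact (hK _).2
  · intro a ha b hb hab
    rw [hK' a ha, hK' b hb]
    exact hadj _ _ fun hh => hab (congrArg Fin.val hh)
  · exact fun v hv => (ht v hv).1
  · intro v hv a ha hne
    have h1 := (ht v hv).2.2.2 a ha hne
    have h2 := h.lt_of_nbAt h1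
    refine ⟨h2, ?_⟩
    rw [hK' a h2]
    exact (hnb v a h2).1 h1
  · intro v hv hlt
    rw [hK' _ hlt, ← hnb]
    exact (ht v hv).2.1
  · intro v hv hlt
    rw [hK' _ hlt, ← hnb]
    exact (ht v hv).2.2.1
  · intro u hu v hv hi hj hk huv
    refine hS u hu v hv (i v) (j v) ?_ (ht v hv) huv (h.zero _ hk)
    rw [← hi, ← hj]
    exact ht u hu

end ValidRow

theorem mul_add_injective {N c c' a a' : ℕ} (ha : a < N) (ha' : a' < N)
    (h : c * N + a = c' * N + a') : c = c' ∧ a = a' := by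
  have h1 : (c * N + a) / N = c := by
    rw [mul_comm, Nat.mul_add_div (by omega), Nat.div_eq_of_lt ha, add_zero]
  have h2 : (c' * N + a') / N = c' := by
    rw [mul_comm, Nat.mul_add_div (by omega), Nat.div_eq_of_lt ha', add_zero]
  have hc : c = c' := by rw [← h1, h, h2]
  subst hc
  exact ⟨rfl, by omega⟩

theorem TypeRow.unique {i' j' : ℕ} (h : TypeRow G R v i j) (h' : TypeRow G R v i' j') :
    i = i' ∧ j = j' := by
  obtain ⟨h1, h2, h3, h4⟩ := h
  obtain ⟨h1', h2', h3', h4'⟩ := h'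
  have a1 : i = i' ∨ j' ≤ i := by by_contra! h; exact h2 (h4' i h.2 h.1)
  have a2 : j = i' ∨ j' ≤ j := by by_contra! h; exact h3 (h4' j h.2 h.1)
  have a3 : i' = i ∨ j ≤ i' := by by_contra! h; exact h2' (h4 i' h.2 h.1)
  have a4 : j' = i ∨ j ≤ j' := by by_contra! h; exact h3' (h4 j' h.2 h.1)
  omega

/-- The new label is an injective encoding of old label and type. The absolute addresses `P` and `Q`
serve as they are, with no need to extract `i` and `j`. -/
theorem refines_of_rows {lab : Fin N → ℕ} {A : ℕ → ℕ} {k : ℕ → ℕ} (v₀ : Fin N)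
    (hV : ∀ c, ValidRow G {v | lab v = c} (row N A c) (k c))
    (hS : ∀ c, StableRow G {v | lab v = c} (row N A c)) {P Q : Fin N → ℕ}
    (ht : ∀ v, ∃ i j, TypeRow G (row N A (lab v)) v i j ∧ P v = lab v * (N + 2) + i ∧
      Q v = lab v * (N + 2) + j) :
    Refines G lab fun v => P v * (N + 2) + Q v := by
  choose i j ht hP hQ using ht
  intro c
  obtain ⟨K, hK⟩ := (hV c).exists_isSplit (hS c) v₀ (i := i) (j := j) (by
    rintro v rfl
    exact ht v)
  refine ⟨k c, K, i, j, hK, ?_⟩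
  rintro u v rfl
  have hlt : ∀ v, i v < j v ∧ j v < N + 2 := fun v => ⟨(ht v).1, (hV _).right_lt (ht v)⟩
  constructor
  · intro h
    have hu := hlt u
    have hv := hlt v
    -- `Q` is not a digit in base `N + 2`, but `Q - P = j - i` is one in base `N + 3`; so `P` and `j
    -- - i` can be read off.
    have key : ∀ w, P w * (N + 2) + Q w = P w * (N + 3) + (j w - i w) := by
      intro w
      have := hlt w
      have h1 := hP w
      have h2 := hQ w
      have : P w * (N + 3) = P w * (N + 2) + P w := by ring
      omega
    simp only [key] at h
    obtain ⟨h1, h2⟩ := mul_add_injective (by omega) (by omega) h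
    rw [hP, hP] at h1
    obtain ⟨h3, h4⟩ := mul_add_injective (by omega) (by omega) h1
    exact ⟨h3.symm, h4, by omega⟩
  · rintro ⟨h1, h2, h3⟩
    simp only [hP, hQ, h1, h2, h3]

end Rows
end WordRAM

namespace WordRAM

/-! ### The types of the vertices with respect to the cliques of their classes -/

section Types

/-- What all parts of the program rely on: register `0` holds `N`, register `11` holds `N + 2`, and
arrays `0` and `1` hold the graph. -/
structure Ctx (N : ℕ) (st nb : ℕ → ℕ) (s : Memory) : Prop where
  reg_zero : s.reg 0 = N
  reg_eleven : s.reg 11 = N + 2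
  arr_zero : s.arr 0 = st
  arr_one : s.arr 1 = nb

theorem Ctx.of_frame {N : ℕ} {st nb : ℕ → ℕ} {s s' : Memory} (h : Ctx N st nb s)
    (h0 : s'.reg 0 = s.reg 0) (h11 : s'.reg 11 = s.reg 11) (ha : s'.arr 0 = s.arr 0)
    (hb : s'.arr 1 = s.arr 1) : Ctx N st nb s' :=
  ⟨h0.trans h.1, h11.trans h.2, ha.trans h.3, hb.trans h.4⟩

/-- A cell `x` that is stamped with the successor of `v` belongs to a neighbour of `v`. -/
structure Stamped {N : ℕ} (G : SimpleGraph (Fin N)) (S : ℕ → ℕ) : Prop where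
  le : ∀ x, S x ≤ N
  adj : ∀ x (v : Fin N), S x = v + 1 → ∃ u : Fin N, x = u + 1 ∧ G.Adj v u

/-- Stamp the neighbours of the vertex in register `1`. -/
def mark : Prog :=
  forNbrs (block [.arith 5 .add (.reg 5) (.lit 1), .store 4 (.reg 5) (.reg 2)])

/-- Look up the stamp of the vertex in cell `q` of array `A`, where register `6` holds `q`. -/
def fetch (A : ℕ) : Prog := block [.load 7 A (.reg 6), .load 7 4 (.reg 7)]

/-- Find the addresses in array `A` of the first two vertices of the clique that are not
neighbours of the vertex in register `1`. -/
def findType (A : ℕ) : Prog :=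
  block [mark, .load 6 3 (.reg 1), .arith 6 .mul (.reg 6) (.reg 11), scan (fetch A),
    .store 5 (.reg 1) (.reg 6), .arith 6 .add (.reg 6) (.lit 1), scan (fetch A),
    .store 6 (.reg 1) (.reg 6)]

variable {N : ℕ} {G : SimpleGraph (Fin N)} {st nb : ℕ → ℕ} {B : ℕ}

/-- Stamps left by earlier sweeps may survive: a stamp of `v` marks a true neighbour of `v` whenever
it was written, so nothing has to be cleared. -/
theorem ends_mark (hG : IsAdjTable G st nb) (hNB : N ≤ B) (hst : ∀ v ≤ N, st v ≤ B) {v : Fin N}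
    {s : Memory} (hs : Ctx N st nb s) (h1 : s.reg 1 = v) (hS : Stamped G (s.arr 4)) :
    Ends B mark s (7 * (st (v + 1) - st v) + 5) fun s' => Stamped G (s'.arr 4) ∧
      (∀ u, G.Adj v u → s'.arr 4 (u + 1) = v + 1) ∧ s'.reg 2 = v + 1 := by
  refine (Ends.forNbrs hG hNB hst (τ := 3) (v := v) (I := fun D s' => Stamped G (s'.arr 4) ∧
    ∀ u ∈ D, s'.arr 4 (u + 1) = v + 1) (by simp; omega) (by simp; omega) (by simp) ?_ h1
    hs.arr_zero hs.arr_one ⟨hS, by simp⟩).mono le_rfl fun s' h => ⟨h.1.1, h.1.2, h.2⟩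
  rintro D u s ⟨hS, hD⟩ huv h1 h2 h5
  refine Ends.cons_arith (by simp [h5]; omega) (Ends.cons_store (by simp [h2]; omega)
    (Ends.nil (T := 0) ?_))
  simp only [Memory.setArr_arr, Memory.setReg_arr, Memory.setReg_reg, Operand.val_reg,
    Operand.val_lit, Arith.val_add, if_true, if_false, Nat.reduceEqDiff, h2, h5]
  refine ⟨⟨fun x => ?_, fun x w => ?_⟩, ?_⟩
  · rw [Function.update_apply]
    split_ifs
    · omega
    · exact hS.le x
  · rw [Function.update_apply]
    split_ifs with hx
    · intro hw
      rw [show w = v from Fin.ext (by omega)]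
      exact ⟨u, hx, huv⟩
    · exact hS.adj x w
  · intro w hw
    rw [Function.update_apply]
    split_ifs with hx
    · rfl
    · refine hD w (hw.resolve_left ?_)
      rintro rfl
      exact hx rfl

theorem ends_fetch {A : ℕ} {s : Memory} (h : s.arr A (s.reg 6) ≤ B)
    (hS : s.arr 4 (s.arr A (s.reg 6)) ≤ B) :
    Ends B (fetch A) s 3 fun s' => s'.arr = s.arr ∧ s'.reg 7 = s.arr 4 (s.arr A (s.reg 6)) := by
  refine Ends.cons_load (by simpa using h) (Ends.cons_load (by simpa using hS)
    (Ends.nil (T := 0) ?_))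
  simp

theorem ValidRow.apply_le {S : Set (Fin N)} {R : ℕ → ℕ} {k : ℕ} (h : ValidRow G S R k) (a : ℕ) :
    R a ≤ N := by
  rcases lt_or_ge a k with ha | ha
  · obtain ⟨u, -, hu⟩ := h.mem a ha
    omega
  · rw [h.zero a ha]
    exact Nat.zero_le _

theorem ends_findType (hG : IsAdjTable G st nb) (hNB : N ≤ B) (hst : ∀ v ≤ N, st v ≤ B) {A : ℕ}
    (hA : 10 ≤ A) {v : Fin N} {s : Memory} (hs : Ctx N st nb s) (h1 : s.reg 1 = v)
    (hS : Stamped G (s.arr 4)) {c k : ℕ} (hc : s.arr 3 v = c) {T : Set (Fin N)}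
    (hV : ValidRow G T (row N (s.arr A) c) k) (hB : c * (N + 2) + (N + 1) ≤ B) :
    Ends B (findType A) s (19 * (st (v + 1) - st v) + 40) fun s' => Stamped G (s'.arr 4) ∧
      ∃ i j, TypeRow G (row N (s.arr A) c) v i j ∧
        s'.arr 5 = Function.update (s.arr 5) v (c * (N + 2) + i) ∧
        s'.arr 6 = Function.update (s.arr 6) v (c * (N + 2) + j) := by
  obtain ⟨i, j, ht⟩ := hV.exists_typeRow v
  have hj := hV.right_lt ht
  have hij := ht.1
  have hjd := hV.right_le_ncard ht
  rw [hG.ncard_eq] at hjd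
  have hcN : c ≤ B := by
    have : c ≤ c * (N + 2) := Nat.le_mul_of_pos_right c (by omega)
    omega
  refine (Ends.cons_of (ends_mark hG hNB hst hs h1 hS) (T := 12 * (st (v + 1) - st v) + 20)
    fun s₁ ⟨hS₁, hmark, h2⟩ hr har => ?_).mono (by omega) fun _ h => h
  simp only [mark, regs_forNbrs, arrs_forNbrs, regs_block_cons, regs_block_nil, arrs_block_cons,
    arrs_block_nil, Prog.regs, Prog.arrs] at hr har
  have e1 : s₁.reg 1 = v := (hr 1 (by simp)).trans h1
  have e11 : s₁.reg 11 = N + 2 := (hr 11 (by simp)).trans hs.reg_eleven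
  have a3 : s₁.arr 3 = s.arr 3 := har 3 (by simp)
  have a5 : s₁.arr 5 = s.arr 5 := har 5 (by simp)
  have a6 : s₁.arr 6 = s.arr 6 := har 6 (by simp)
  have aA : s₁.arr A = s.arr A := har A (by simp; omega)
  -- An empty position holds zero, and cell zero of the stamps never carries the stamp of a vertex;
  -- so the stamp test also recognises the end of the clique.
  have hF : ∀ a < N + 2, s₁.arr 4 (s.arr A (c * (N + 2) + a)) = v + 1 ↔
      NbAt G (row N (s.arr A) c) v a := by
    intro a ha
    rw [NbAt, row_apply ha]
    constructor
    · intro h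
      obtain ⟨u, hu, hvu⟩ := hS₁.adj _ v h
      exact ⟨u, hu, hvu⟩
    · rintro ⟨u, hu, hvu⟩
      rw [hu]
      exact hmark u hvu
  have hfetch : ∀ q₀ n, c * (N + 2) ≤ q₀ → q₀ + n ≤ c * (N + 2) + (N + 1) → ∀ s' : Memory,
      s'.arr A = s.arr A → s'.arr 4 = s₁.arr 4 → ∀ s'' : Memory, s''.arr = s'.arr →
      q₀ ≤ s''.reg 6 → s''.reg 6 ≤ q₀ + n → Ends B (fetch A) s'' 3 fun s₃ => s₃.arr = s'.arr ∧
        s₃.reg 7 = (fun q => s₁.arr 4 (s.arr A q)) (s''.reg 6) := by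
    intro q₀ n hq hn s' hA' h4 s'' hs'' hl hu
    have hle : s.arr A (s''.reg 6) ≤ N := by
      have := hV.apply_le (s''.reg 6 - c * (N + 2))
      rwa [row_apply (by omega), show c * (N + 2) + (s''.reg 6 - c * (N + 2)) = s''.reg 6 by omega]
        at this
    refine (ends_fetch ?_ ?_).mono le_rfl ?_
    · rw [hs'', hA']
      omega
    · rw [hs'', hA', h4]
      exact (hS₁.le _).trans hNB
    · rw [hs'', hA', h4]
      exact fun _ h => h
  -- The two scans pass over `i` and `j - i - 1` positions, in total at most the degree of `v`.
  refine Ends.mono (T := (0 + 1 + 1 + (6 * (j - i - 1) + 5) + 1 + 1 + (6 * i + 5) + 1 + 1))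
    (Ends.cons_load (by simpa [e1, a3, hc] using hcN) (Ends.cons_arith (by
      simp [e1, a3, hc, e11]; omega) ?_)) (by omega) fun _ h => h
  simp only [Memory.setReg_reg, Operand.val_reg, Arith.val_mul, if_true,
    Nat.reduceEqDiff, if_false, e1, a3, hc, e11]
  refine Ends.cons_of (Ends.scan (F := fun q => s₁.arr 4 (s.arr A q)) (q₀ := c * (N + 2)) (n := i)
    (τ := 3) (vp := v + 1) (by simp [fetch]) (hfetch _ _ le_rfl (by omega) _ (by simpa using aA)
    (by simp)) (by simpa using h2) (by simp) (by omega) (fun a ha => (hF a (by omega)).2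
      (ht.2.2.2 a (by omega) (by omega))) (fun h => ht.2.1 ((hF i (by omega)).1 h)))
    fun s₂ ⟨ha₂, h6₂⟩ hr₂ _ => ?_
  simp only [regs_scan, fetch, regs_block_cons, regs_block_nil, Prog.regs] at hr₂
  have f1 : s₂.reg 1 = v := (hr₂ 1 (by simp)).trans (by simpa using e1)
  have f2 : s₂.reg 2 = v + 1 := (hr₂ 2 (by simp)).trans (by simpa using h2)
  simp only [Memory.setReg_arr] at ha₂
  refine Ends.cons_store (by simp [h6₂]; omega) (Ends.cons_arith (by simp [h6₂]; omega) ?_)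
  simp only [Memory.setArr_reg, Operand.val_reg, Operand.val_lit, Arith.val_add, h6₂, f1]
  refine Ends.cons_of (Ends.scan (F := fun q => s₁.arr 4 (s.arr A q)) (q₀ := c * (N + 2) + i + 1)
    (n := j - i - 1) (τ := 3) (vp := v + 1) (by simp [fetch]) (hfetch _ _ (by omega) (by omega) _
      ?_ ?_) (by simpa using f2) (by simp) (by omega) (fun a ha => ?_) ?_)
    fun s₃ ⟨ha₃, h6₃⟩ hr₃ _ => ?_
  · simp [ha₂, aA, show A ≠ 5 by omega]
  · simp [ha₂]
  · rw [show c * (N + 2) + i + 1 + a = c * (N + 2) + (i + 1 + a) by ring]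
    exact (hF _ (by omega)).2 (ht.2.2.2 _ (by omega) (by omega))
  · rw [show c * (N + 2) + i + 1 + (j - i - 1) = c * (N + 2) + j by omega]
    exact fun h => ht.2.2.1 ((hF j (by omega)).1 h)
  · simp only [regs_scan, fetch, regs_block_cons, regs_block_nil, Prog.regs] at hr₃
    have g1 : s₃.reg 1 = v := (hr₃ 1 (by simp)).trans (by simpa using f1)
    refine Ends.cons_store (by simp [h6₃]; omega) (Ends.nil (T := 0) ?_)
    simp only [Memory.setArr_arr, ha₃, Memory.setReg_arr, Operand.val_reg, g1, h6₃, ha₂, a5, a6,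
      if_true, if_false, Nat.reduceEqDiff]
    refine ⟨hS₁, i, j, ht, rfl, ?_⟩
    rw [show c * (N + 2) + i + 1 + (j - i - 1) = c * (N + 2) + j by omega]

end Types
end WordRAM

namespace WordRAM

/-! ### Enlarging the cliques -/

section Enlarge

variable {N : ℕ} {G : SimpleGraph (Fin N)} {st nb : ℕ → ℕ} {B : ℕ}

@[simp] theorem regs_findType (A : ℕ) : (findType A).regs = {2, 3, 4, 5, 6, 7} := by
  ext x; simp [findType, mark, fetch]; omega

@[simp] theorem arrs_findType (A : ℕ) : (findType A).arrs = {4, 5, 6} := by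
  ext x; simp [findType, mark, fetch]; omega

/-- The addresses `P v` and `Q v` encode the label and the type of `v`. -/
def HasTypes (G : SimpleGraph (Fin N)) (lab : Fin N → ℕ) (A : ℕ → ℕ) (P Q : Fin N → ℕ) : Prop :=
  ∀ v, ∃ i j, TypeRow G (row N A (lab v)) v i j ∧ P v = lab v * (N + 2) + i ∧
    Q v = lab v * (N + 2) + j

theorem ends_findTypes (hG : IsAdjTable G st nb) (hNB : N ≤ B) (hst : ∀ v ≤ N, st v ≤ B) {A : ℕ}
    (hA : 10 ≤ A) {s : Memory} (hs : Ctx N st nb s) (hS : Stamped G (s.arr 4)) {lab : Fin N → ℕ}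
    (hlab : ∀ v : Fin N, s.arr 3 v = lab v) {k : ℕ → ℕ}
    (hV : ∀ c, ValidRow G {v | lab v = c} (row N (s.arr A) c) (k c))
    (hB : ∀ v, lab v * (N + 2) + (N + 1) ≤ B) :
    Ends B (forVerts (findType A)) s (19 * st N + 43 * N + 3) fun s' => Stamped G (s'.arr 4) ∧
      HasTypes G lab (s.arr A) (fun v => s'.arr 5 v) (fun v => s'.arr 6 v) := by
  refine (Ends.forVerts hG hNB (by simp; omega) (a := 19) (b := 40)
    (I := fun m s' => Ctx N st nb s' ∧ Stamped G (s'.arr 4) ∧ s'.arr 3 = s.arr 3 ∧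
      s'.arr A = s.arr A ∧ ∀ v : Fin N, (v : ℕ) < m → ∃ i j,
        TypeRow G (row N (s.arr A) (lab v)) v i j ∧ s'.arr 5 v = lab v * (N + 2) + i ∧
        s'.arr 6 v = lab v * (N + 2) + j)
    ?_ ?_ hs.reg_zero ⟨hs, hS, rfl, rfl, by simp⟩).mono le_rfl
      fun s' h => ⟨h.2.1, fun v => h.2.2.2.2 v v.2⟩
  · rintro m s' x ⟨h1, h2⟩
    exact ⟨h1.of_frame (by simp) (by simp) rfl rfl, h2⟩
  · rintro v s' ⟨hc, hS', h3, hA', hv⟩ - h1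
    refine (ends_findType hG hNB hst hA hc h1 hS' (c := lab v) (k := k (lab v))
      (T := {w | lab w = lab v}) (by rw [h3, hlab]) (by rw [hA']; exact hV _) (hB v)).framed.mono
      le_rfl ?_
    rintro s'' ⟨⟨hS'', i, j, ht, h5, h6⟩, hr, har⟩
    simp only [regs_findType, arrs_findType] at hr har
    refine ⟨hc.of_frame (hr 0 (by simp)) (hr 11 (by simp)) (har 0 (by simp)) (har 1 (by simp)),
      hS'', (har 3 (by simp)).trans h3, (har A (by simp; omega)).trans hA', fun w hw => ?_⟩
    rcases Nat.lt_succ_iff_lt_or_eq.1 hw with hlt | heq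
    · rw [h5, h6, Function.update_of_ne (by omega), Function.update_of_ne (by omega)]
      exact hv w hlt
    · rw [h5, h6, show w = v from Fin.ext heq, Function.update_self, Function.update_self]
      rw [hA'] at ht
      exact ⟨i, j, ht, rfl, rfl⟩

/-- Compare the vertex in register `1` with its neighbour in register `5`, and enlarge the clique of
their class if this is possible and has not been done before in the same round. -/
def enlargeAt (A F : ℕ) : Prog :=
  block [.load 15 5 (.reg 5), .load 16 6 (.reg 5),
    .ite (.eq (.reg 15) (.reg 8))
      (.ite (.eq (.reg 16) (.reg 9))
        (block [.load 7 A (.reg 9), .load 17 F (.reg 10),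
          .ite (.eq (.reg 7) (.lit 0))
            (.ite (.eq (.reg 17) (.reg 12)) .skip
              (block [.store A (.reg 8) (.reg 2), .arith 5 .add (.reg 5) (.lit 1),
                .store A (.reg 9) (.reg 5), .store F (.reg 10) (.reg 12), .mov 13 (.lit 1)]))
            .skip])
        .skip)
      .skip]

/-- The loop body of the sweep that enlarges the cliques. -/
def enlarge (A F : ℕ) : Prog :=
  block [.load 10 3 (.reg 1), .load 8 5 (.reg 1), .load 9 6 (.reg 1), forNbrs (enlargeAt A F)]

@[simp] theorem regs_enlargeAt (A F : ℕ) : (enlargeAt A F).regs = {5, 7, 13, 15, 16, 17} := by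
  ext x; simp [enlargeAt]; omega

@[simp] theorem arrs_enlargeAt (A F : ℕ) : (enlargeAt A F).arrs = {A, F} := by
  ext x; simp [enlargeAt]; tauto

@[simp] theorem regs_enlarge (A F : ℕ) :
    (enlarge A F).regs = {2, 3, 4, 5, 7, 8, 9, 10, 13, 15, 16, 17} := by
  ext x; simp [enlarge]; omega

@[simp] theorem arrs_enlarge (A F : ℕ) : (enlarge A F).arrs = {A, F} := by
  ext x; simp [enlarge]

/-- The invariant of the sweep that enlarges the cliques: `A₀` is the state of array `A` at the
beginning, and the pairs in `D` have been dealt with. -/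
structure Enlarging (G : SimpleGraph (Fin N)) (st nb : ℕ → ℕ) (lab : Fin N → ℕ) (P Q : Fin N → ℕ)
    (A F : ℕ) (A₀ : ℕ → ℕ) (k : ℕ → ℕ) (r : ℕ) (D : Fin N → Fin N → Prop) (s : Memory) : Prop where
  ctx : Ctx N st nb s
  lab_eq : ∀ v : Fin N, s.arr 3 v = lab v
  left_eq : ∀ v : Fin N, s.arr 5 v = P v
  right_eq : ∀ v : Fin N, s.arr 6 v = Q v
  round_eq : s.reg 12 = r
  flag_le : ∀ c, s.arr F c ≤ r
  cls : ∀ c, (s.arr F c = r ∧ s.reg 13 = 1 ∧ ¬ StableRow G {v | lab v = c} (row N A₀ c) ∧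
      ∃ k', k c < k' ∧ ValidRow G {v | lab v = c} (row N (s.arr A) c) k') ∨
    (s.arr F c ≠ r ∧ row N (s.arr A) c = row N A₀ c ∧ ∀ v u, D v u → lab v = c → lab u = c →
      G.Adj v u → ∀ i j, TypeRow G (row N A₀ c) v i j → TypeRow G (row N A₀ c) u i j →
        row N A₀ c j ≠ 0)
  changed : s.reg 13 = 0 ∨ s.reg 13 = 1 ∧ ∃ c, s.arr F c = r

variable {lab : Fin N → ℕ} {P Q : Fin N → ℕ} {A F : ℕ} {A₀ : ℕ → ℕ} {k : ℕ → ℕ} {r : ℕ}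
  {D D' : Fin N → Fin N → Prop} {s s' : Memory}

theorem Enlarging.of_frame (h : Enlarging G st nb lab P Q A F A₀ k r D s) (ha : s'.arr = s.arr)
    (hr : ∀ x, x = 0 ∨ x = 11 ∨ x = 12 ∨ x = 13 → s'.reg x = s.reg x) :
    Enlarging G st nb lab P Q A F A₀ k r D s' := by
  obtain ⟨h1, h2, h3, h4, h5, h6, h7, h8⟩ := h
  rw [← hr 12 (by simp)] at h5
  simp only [← hr 13 (by simp), ← ha] at h2 h3 h4 h6 h7 h8
  exact ⟨h1.of_frame (hr 0 (by simp)) (hr 11 (by simp)) (by rw [ha]) (by rw [ha]), h2, h3, h4, h5,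
    h6, h7, h8⟩

theorem Enlarging.mono (h : Enlarging G st nb lab P Q A F A₀ k r D s)
    (hD : ∀ v u, D' v u → D v u ∨ ∀ c, lab v = c → lab u = c → s.arr F c ≠ r →
      row N (s.arr A) c = row N A₀ c → G.Adj v u → ∀ i j, TypeRow G (row N A₀ c) v i j →
        TypeRow G (row N A₀ c) u i j → row N A₀ c j ≠ 0) :
    Enlarging G st nb lab P Q A F A₀ k r D' s := by
  obtain ⟨h1, h2, h3, h4, h5, h6, h7, h8⟩ := h
  refine ⟨h1, h2, h3, h4, h5, h6, fun c => (h7 c).imp_right ?_, h8⟩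
  rintro ⟨a1, a2, a3⟩
  refine ⟨a1, a2, fun v u hvu hv hu => ?_⟩
  rcases hD v u hvu with h | h
  · exact a3 v u h hv hu
  · exact h c hv hu a1 a2

/-- The stored types refer to the row as it was at the start of the round. Once the clique has been
enlarged they are out of date, and the flag then blocks further changes until the next round. -/
theorem ends_enlargeAt (hNB : N + 1 ≤ B) (hrB : r ≤ B) (hA : 10 ≤ A) (hF : 10 ≤ F) (hAF : A ≠ F)
    (hV : ∀ c, ValidRow G {v | lab v = c} (row N A₀ c) (k c)) (ht : HasTypes G lab A₀ P Q)
    (hPB : ∀ v, P v ≤ B) (hQB : ∀ v, Q v ≤ B) {v u : Fin N} (huv : G.Adj v u)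
    (h : Enlarging G st nb lab P Q A F A₀ k r D s) (h2 : s.reg 2 = v + 1) (h5 : s.reg 5 = u)
    (h8 : s.reg 8 = P v) (h9 : s.reg 9 = Q v) (h10 : s.reg 10 = lab v) :
    Ends B (enlargeAt A F) s 16
      (Enlarging G st nb lab P Q A F A₀ k r fun a b => D a b ∨ a = v ∧ b = u) := by
  obtain ⟨i, j, tv, hPv, hQv⟩ := ht v
  obtain ⟨i', j', tu, hPu, hQu⟩ := ht u
  have hj := (hV _).right_lt tv
  have hj' := (hV _).right_lt tu
  have hij := tv.1
  have hij' := tu.1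
  have hrow : s.arr A (Q v) = row N (s.arr A) (lab v) j := by rw [row_apply hj, hQv]
  have hAle : s.arr A (Q v) ≤ N := by
    rw [hrow]
    rcases h.cls (lab v) with ⟨-, -, -, k', -, hk'⟩ | ⟨-, he, -⟩
    · exact hk'.apply_le j
    · rw [he]
      exact (hV _).apply_le j
  -- Common to all branches that leave the arrays alone: the pair is recorded as harmless for an
  -- unflagged class.
  have hdone : (∀ c, lab v = c → lab u = c → s.arr F c ≠ r → row N (s.arr A) c = row N A₀ c →
      TypeRow G (row N A₀ c) v i j → TypeRow G (row N A₀ c) u i j → row N A₀ c j ≠ 0) →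
      Enlarging G st nb lab P Q A F A₀ k r (fun a b => D a b ∨ a = v ∧ b = u) s := by
    intro hh
    refine h.mono ?_
    rintro a b (hab | ⟨rfl, rfl⟩)
    · exact Or.inl hab
    · refine Or.inr ?_
      rintro c rfl hc hFc hrc - i₁ j₁ t1 t2
      obtain ⟨rfl, rfl⟩ := t1.unique tv
      exact hh _ rfl hc hFc hrc t1 t2
  have hsame : ∀ c, lab v = c → lab u = c → TypeRow G (row N A₀ c) u i j → P u = P v ∧ Q u = Q v := by
    rintro c rfl hc t
    rw [hc] at tu
    obtain ⟨rfl, rfl⟩ := t.unique tu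
    rw [hPu, hPv, hQu, hQv, hc]
    exact ⟨rfl, rfl⟩
  refine Ends.cons_load (by simp [h5, h.left_eq, hPB]) (Ends.cons_load
    (by simp [h5, h.right_eq, hQB]) (Ends.cons (T' := 1) (T := 13) ?_))
  simp only [Memory.setReg_reg, Operand.val_reg, Memory.setReg_arr, Nat.reduceEqDiff, if_false, h5,
    h.left_eq, h.right_eq]
  refine Ends.ite (fun e1 => ?_) fun e1 => (Ends.skip (Ends.nil (T := 0) ?_)).mono (by omega)
    fun _ h => h
  swap
  · simp [h8] at e1
    exact (hdone fun c hv hu _ _ _ t => absurd (hsame c hv hu t).1 e1).of_frame rfl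
      (by rintro x (rfl | rfl | rfl | rfl) <;> simp)
  refine Ends.ite (fun e2 => ?_) fun e2 => (Ends.skip (Ends.nil (T := 0) ?_)).mono (by omega)
    fun _ h => h
  swap
  · simp [h9] at e2
    exact (hdone fun c hv hu _ _ _ t => absurd (hsame c hv hu t).2 e2).of_frame rfl
      (by rintro x (rfl | rfl | rfl | rfl) <;> simp)
  simp [h8] at e1
  simp [h9] at e2
  rw [hPu, hPv] at e1
  -- Equal addresses force equal labels as well as equal positions, so no separate comparison of
  -- labels is needed.
  obtain ⟨hlab, rfl⟩ := mul_add_injective (by omega) (by omega) e1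
  rw [hQu, hQv, hlab] at e2
  obtain rfl : j' = j := by omega
  rw [hlab] at tu
  refine Ends.cons_load (by simp [h9]; omega) (Ends.cons_load (by
    simp [h10]; exact (h.flag_le _).trans hrB) (Ends.cons (T' := 1) (T := 8) ?_))
  simp only [Memory.setReg_reg, Operand.val_reg, Memory.setReg_arr, Nat.reduceEqDiff, if_false, h9,
    h10]
  refine Ends.ite (fun e3 => ?_) fun e3 => (Ends.skip (Ends.nil (T := 0) (Ends.nil (T := 0) ?_))).mono
    (by omega) fun _ h => h
  swap
  · simp [hrow] at e3
    refine (hdone ?_).of_frame rfl (by rintro x (rfl | rfl | rfl | rfl) <;> simp)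
    rintro c rfl - - hrc - -
    rwa [← hrc]
  refine Ends.ite (fun e4 => (Ends.skip (Ends.nil (T := 0) (Ends.nil (T := 0) ?_))).mono
    (by omega) fun _ h => h) fun e4 => ?_
  · simp [h.round_eq] at e4
    refine (hdone ?_).of_frame rfl (by rintro x (rfl | rfl | rfl | rfl) <;> simp)
    rintro c rfl - hne
    exact absurd e4 hne
  simp [hrow] at e3
  simp [h.round_eq] at e4
  have hcls : row N (s.arr A) (lab v) = row N A₀ (lab v) := by
    rcases h.cls (lab v) with ⟨h, -⟩ | ⟨-, h, -⟩
    · exact absurd h e4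
    · exact h
  rw [hcls] at e3
  obtain ⟨hk, hnew⟩ := (hV (lab v)).augment (u := v) (v := u) rfl hlab huv tv tu e3
  refine Ends.cons_store (by simp [h2]; omega) (Ends.cons_arith (by simp [h5]; omega)
    (Ends.cons_store (by simp [h5]; omega) (Ends.cons_store (by simp [h.round_eq, hrB])
    (Ends.cons_mov (by simp; omega) (Ends.nil (T := 0) (Ends.nil (T := 0) (Ends.nil (T := 0) ?_)))))))
  refine ⟨h.ctx.of_frame (by simp) (by simp) ?_ ?_, ?_, ?_, ?_, ?_, ?_, ?_, ?_⟩
  all_goals simp only [Memory.setReg_reg, Operand.val_reg, Memory.setReg_arr, Nat.reduceEqDiff,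
    if_false, Memory.setArr_arr, Memory.setArr_reg, Operand.val_lit, if_true, h2, h5, h8, h9,
    h10, h.round_eq, hAF, hAF.symm, Arith.val_add, show 0 ≠ A by omega, show 0 ≠ F by omega,
    show 1 ≠ A by omega, show 1 ≠ F by omega, show 3 ≠ A by omega, show 3 ≠ F by omega,
    show 5 ≠ A by omega, show 5 ≠ F by omega, show 6 ≠ A by omega, show 6 ≠ F by omega]
  · exact h.lab_eq
  · exact h.left_eq
  · exact h.right_eq
  · intro c
    rw [Function.update_apply]
    split_ifs
    · exact le_rfl
    · exact h.flag_le c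
  · intro c
    rcases eq_or_ne c (lab v) with rfl | hc
    · refine Or.inl ⟨Function.update_self .., trivial, ?_, _, hk, ?_⟩
      · exact fun hst => hst v rfl u hlab i' j' tv tu huv e3
      · rw [hPv, hQv, row_update_self hj, row_update_self (by omega), hcls]
        exact hnew
    · rw [Function.update_of_ne hc, hPv, hQv, row_update_of_ne hc hj,
        row_update_of_ne hc (by omega)]
      refine (h.cls c).imp (fun hh => ⟨hh.1, trivial, hh.2.2⟩) fun hh => ⟨hh.1, hh.2.1, ?_⟩
      rintro a b (hab | ⟨rfl, rfl⟩) ha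
      · exact hh.2.2 a b hab ha
      · exact absurd ha.symm hc
  · exact Or.inr ⟨trivial, lab v, Function.update_self ..⟩

theorem ends_enlarge (hG : IsAdjTable G st nb) (hst : ∀ v ≤ N, st v ≤ B) (hNB : N + 1 ≤ B)
    (hrB : r ≤ B) (hA : 10 ≤ A) (hF : 10 ≤ F) (hAF : A ≠ F)
    (hV : ∀ c, ValidRow G {v | lab v = c} (row N A₀ c) (k c)) (ht : HasTypes G lab A₀ P Q)
    (hlB : ∀ v, lab v ≤ B) (hPB : ∀ v, P v ≤ B) (hQB : ∀ v, Q v ≤ B)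
    (h : Enlarging G st nb lab P Q A F A₀ k r (fun _ _ => False) s) :
    Ends B (forVerts (enlarge A F)) s (20 * st N + 12 * N + 3)
      (Enlarging G st nb lab P Q A F A₀ k r fun _ _ => True) := by
  refine (Ends.forVerts hG (by omega) (by simp; omega) (a := 20) (b := 9)
    (I := fun m => Enlarging G st nb lab P Q A F A₀ k r fun a b => (a : ℕ) < m ∧ G.Adj a b)
    ?_ ?_ h.ctx.reg_zero (h.mono (by simp))).mono le_rfl fun s' h => h.mono ?_
  · intro m s x h
    exact h.of_frame rfl (by rintro x (rfl | rfl | rfl | rfl) <;> simp)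
  · intro v s h h0 h1
    refine Ends.mono (T := 1 + (20 * (st (v + 1) - st v) + 5) + 1 + 1 + 1)
      (Ends.cons_load (by simp [h1, h.lab_eq, hlB]) (Ends.cons_load
      (by simp [h1, h.left_eq, hPB]) (Ends.cons_load (by simp [h1, h.right_eq, hQB])
      (Ends.cons (T' := 1) ?_)))) (by omega) fun _ h => h
    simp only [Memory.setReg_reg, Operand.val_reg, Memory.setReg_arr, if_false,
      OfNat.one_ne_ofNat, h1, h.left_eq, h.right_eq, h.lab_eq]
    refine (Ends.forNbrs hG (by omega) hst (τ := 16) (v := v)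
      (I := fun E s' => Enlarging G st nb lab P Q A F A₀ k r
        (fun a b => ((a : ℕ) < v ∧ G.Adj a b) ∨ a = v ∧ b ∈ E) s' ∧ s'.reg 8 = P v ∧
        s'.reg 9 = Q v ∧ s'.reg 10 = lab v) (by simp; omega) (by simp; omega) ?_ ?_
      (by simpa using h1) (by simpa using h.ctx.arr_zero) (by simpa using h.ctx.arr_one)
      ?_).mono (by omega) fun s' hs' => Ends.nil (T := 0) (hs'.1.1.mono ?_)
    · rintro E s r' x h2 h5 ⟨hE, h8, h9, h10⟩
      refine ⟨hE.of_frame rfl ?_, ?_, ?_, ?_⟩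
      · intro y hy
        rw [Memory.setReg_reg, if_neg (by omega)]
      · rw [Memory.setReg_reg, if_neg (by omega), h8]
      · rw [Memory.setReg_reg, if_neg (by omega), h9]
      · rw [Memory.setReg_reg, if_neg (by omega), h10]
    · rintro E u s ⟨hE, h8, h9, h10⟩ huv - h2 h5
      refine (ends_enlargeAt hNB hrB hA hF hAF hV ht hPB hQB huv hE h2 h5 h8 h9 h10).framed.mono
        le_rfl ?_
      rintro s' ⟨hs', hr, -⟩
      simp only [regs_enlargeAt] at hr
      refine ⟨hs'.mono ?_, (hr 8 (by simp)).trans h8, (hr 9 (by simp)).trans h9,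
        (hr 10 (by simp)).trans h10⟩
      rintro a b (hab | ⟨rfl, rfl | hb⟩)
      · exact Or.inl (Or.inl (Or.inl hab))
      · exact Or.inl (Or.inr ⟨rfl, rfl⟩)
      · exact Or.inl (Or.inl (Or.inr ⟨rfl, hb⟩))
    · refine ⟨(h.mono ?_).of_frame rfl ?_, by simp, by simp, by simp⟩
      · rintro a b (hab | ⟨-, hb⟩)
        · exact Or.inl hab
        · exact hb.elim
      · rintro x (rfl | rfl | rfl | rfl) <;> simp
    · rintro a b ⟨hab, hadj⟩
      left
      rcases Nat.lt_succ_iff_lt_or_eq.1 hab with hlt | heq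
      · exact Or.inl ⟨hlt, hadj⟩
      · obtain rfl : a = v := Fin.ext heq
        exact Or.inr ⟨rfl, hadj⟩
  -- All adjacent pairs have been visited, and non-adjacent pairs are harmless; an unflagged row is
  -- therefore stable.
  · rintro a b -
    by_cases hab : G.Adj a b
    · exact Or.inl ⟨a.2, hab⟩
    · exact Or.inr fun c _ _ _ _ hh => absurd hh hab

end Enlarge
end WordRAM

namespace WordRAM

/-! ### Refining the labels -/

section Refinement

variable {N : ℕ} {G : SimpleGraph (Fin N)} {st nb : ℕ → ℕ} {B : ℕ}

/-- One round: find all types and enlarge the cliques. -/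
def round (A F : ℕ) : Prog :=
  block [.mov 13 (.lit 0), .arith 12 .add (.reg 12) (.lit 1), forVerts (findType A),
    forVerts (enlarge A F)]

/-- The loop body of the sweep that puts in place the new labels. -/
def relabel : Prog :=
  block [.load 8 5 (.reg 1), .load 9 6 (.reg 1), .arith 8 .mul (.reg 8) (.reg 11),
    .arith 8 .add (.reg 8) (.reg 9), .store 3 (.reg 1) (.reg 8)]

/-- Refine the labels in array `3`; arrays `A` and `F` are used for this. -/
def refineLabels (A F : ℕ) : Prog :=
  block [.mov 12 (.lit 0), .mov 13 (.lit 1), .loop (.lt (.lit 0) (.reg 13)) (round A F),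
    forVerts relabel]

@[simp] theorem regs_round (A F : ℕ) :
    (round A F).regs = {1, 2, 3, 4, 5, 6, 7, 8, 9, 10, 12, 13, 15, 16, 17} := by
  ext x; simp [round]; omega

@[simp] theorem arrs_round (A F : ℕ) : (round A F).arrs = {4, 5, 6, A, F} := by
  ext x; simp [round]; tauto

@[simp] theorem regs_relabel : relabel.regs = {8, 9} := by
  ext x; simp [relabel]; omega

@[simp] theorem arrs_relabel : relabel.arrs = {3} := by
  ext x; simp [relabel]

@[simp] theorem regs_refineLabels (A F : ℕ) :
    (refineLabels A F).regs = {1, 2, 3, 4, 5, 6, 7, 8, 9, 10, 12, 13, 15, 16, 17} := by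
  ext x; simp [refineLabels]; omega

@[simp] theorem arrs_refineLabels (A F : ℕ) : (refineLabels A F).arrs = {3, 4, 5, 6, A, F} := by
  ext x; simp [refineLabels]

/-- The invariant of the loop over the rounds. -/
structure Refining (G : SimpleGraph (Fin N)) (st nb : ℕ → ℕ) (lab : Fin N → ℕ) (A F : ℕ)
    (s : Memory) : Prop where
  ctx : Ctx N st nb s
  stamped : Stamped G (s.arr 4)
  lab_eq : ∀ v : Fin N, s.arr 3 v = lab v
  flag_le : ∀ c, s.arr F c ≤ s.reg 12
  valid : ∀ c, ∃ k, ValidRow G {v | lab v = c} (row N (s.arr A) c) k ∧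
    (s.reg 12 ≤ k ∨ StableRow G {v | lab v = c} (row N (s.arr A) c))
  changed : s.reg 13 = 1 ∧ s.reg 12 ≤ G.cliqueNum ∨ s.reg 13 = 0 ∧ s.reg 12 ≤ G.cliqueNum + 1 ∧
    HasTypes G lab (s.arr A) (fun v => s.arr 5 v) (fun v => s.arr 6 v) ∧
    ∀ c, StableRow G {v | lab v = c} (row N (s.arr A) c)

variable {lab : Fin N → ℕ} {A F : ℕ} {s : Memory}

theorem cliqueNum_le (G : SimpleGraph (Fin N)) : G.cliqueNum ≤ N := by
  obtain ⟨t, ht⟩ := G.exists_isNClique_cliqueNum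
  rw [← ht.card_eq]
  simpa using Finset.card_le_univ t

/-- Progress: a class not yet stable has a clique at least as long as the number of rounds made.
Enlarging it preserves this for one more round, and stable classes stay untouched. -/
theorem ends_round (hG : IsAdjTable G st nb) (hst : ∀ v ≤ N, st v ≤ B) (hNB : N + 1 ≤ B)
    (hA : 10 ≤ A) (hF : 10 ≤ F) (hAF : A ≠ F) (hB : ∀ v, lab v * (N + 2) + (N + 1) ≤ B)
    (h : Refining G st nb lab A F s) (h13 : s.reg 13 ≠ 0) :
    Ends B (round A F) s (39 * st N + 55 * N + 10) fun s' => Refining G st nb lab A F s' ∧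
      s'.reg 12 = s.reg 12 + 1 := by
  have hωN := cliqueNum_le G
  obtain ⟨-, hr⟩ : s.reg 13 = 1 ∧ s.reg 12 ≤ G.cliqueNum := by
    rcases h.changed with h | h
    · exact h
    · exact absurd h.1 h13
  choose k hk hkr using h.valid
  have hlB : ∀ v, lab v ≤ B := fun v => by
    have := hB v
    have : lab v ≤ lab v * (N + 2) := Nat.le_mul_of_pos_right _ (by omega)
    omega
  refine Ends.mono (T := 0 + 1 + (20 * st N + 12 * N + 3) + (19 * st N + 43 * N + 3) + 1 + 1)
    (Ends.cons_mov (by simp) (Ends.cons_arith (by simp; omega) ?_)) (by omega) fun _ h => h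
  refine Ends.cons_of (ends_findTypes hG (by omega) hst hA (h.ctx.of_frame (by simp) (by simp)
    (by simp) (by simp)) (by simpa using h.stamped) (by simpa using h.lab_eq) (by simpa using hk) hB)
    fun s₁ ⟨hS₁, ht₁⟩ hr₁ ha₁ => ?_
  simp only [regs_forVerts, arrs_forVerts, regs_findType, arrs_findType] at hr₁ ha₁
  simp only [Memory.setReg_arr] at ha₁ ht₁
  have a4 := ha₁ A (by simp; omega)
  have e12 : s₁.reg 12 = s.reg 12 + 1 := (hr₁ 12 (by simp)).trans (by simp)
  have hE : Enlarging G st nb lab (fun v => s₁.arr 5 v) (fun v => s₁.arr 6 v) A F (s.arr A) k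
      (s.reg 12 + 1) (fun _ _ => False) s₁ := by
    refine ⟨h.ctx.of_frame (by simp [hr₁ 0]) (by simp [hr₁ 11]) (ha₁ 0 (by simp))
      (ha₁ 1 (by simp)), ?_, fun _ => rfl, fun _ => rfl, e12, ?_, ?_, Or.inl (by simp [hr₁ 13])⟩
    · rw [ha₁ 3 (by simp)]
      exact h.lab_eq
    · rw [ha₁ F (by simp; omega)]
      exact fun c => (h.flag_le c).trans (Nat.le_succ _)
    · intro c
      rw [ha₁ F (by simp; omega), a4]
      exact Or.inr ⟨((h.flag_le c).trans_lt (Nat.lt_succ_self _)).ne, rfl, fun _ _ h => h.elim⟩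
  have hlt : ∀ v, s₁.arr 5 (v : Fin N) ≤ B ∧ s₁.arr 6 v ≤ B := by
    intro v
    obtain ⟨i, j, ht, h5, h6⟩ := ht₁ v
    have := (hk _).right_lt ht
    have := ht.1
    have := hB v
    dsimp only at h5 h6
    omega
  refine Ends.cons_of (ends_enlarge hG hst hNB (by omega) hA hF hAF hk ht₁ hlB (fun v => (hlt v).1)
    (fun v => (hlt v).2) hE) fun s₂ h₂ hr₂ ha₂ => Ends.nil (T := 0) ⟨?_, h₂.round_eq⟩
  simp only [regs_forVerts, arrs_forVerts, regs_enlarge, arrs_enlarge] at hr₂ ha₂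
  have hstab : ∀ c, (∀ v u, True → lab v = c → lab u = c → G.Adj v u → ∀ i j,
      TypeRow G (row N (s.arr A) c) v i j → TypeRow G (row N (s.arr A) c) u i j →
        row N (s.arr A) c j ≠ 0) → StableRow G {v | lab v = c} (row N (s.arr A) c) :=
    fun c hc u hu v hv i j tu tv huv => hc u v trivial hu hv huv i j tu tv
  refine ⟨h₂.ctx, ?_, h₂.lab_eq, ?_, ?_, ?_⟩
  · rw [ha₂ 4 (by simp; omega)]
    exact hS₁
  · rw [h₂.round_eq]
    exact h₂.flag_le
  · intro c
    rw [h₂.round_eq]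
    rcases h₂.cls c with ⟨-, -, hns, k', hk', hV'⟩ | ⟨-, he, hst'⟩
    · refine ⟨k', hV', Or.inl ?_⟩
      have := (hkr c).resolve_right hns
      omega
    · rw [he]
      exact ⟨k c, hk c, Or.inr (hstab c hst')⟩
  · rw [h₂.round_eq]
    -- If nothing changed, all rows are stable and the types just computed are still current.
    -- Otherwise some clique has at least as many vertices as there were rounds, and the clique
    -- number bounds the count.
    rcases h₂.changed with h0 | ⟨h1, c, hc⟩
    · right
      have hall : ∀ c, row N (s₂.arr A) c = row N (s.arr A) c ∧
          StableRow G {v | lab v = c} (row N (s.arr A) c) := by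
        intro c
        rcases h₂.cls c with ⟨-, h1, -⟩ | ⟨-, he, hst'⟩
        · omega
        · exact ⟨he, hstab c hst'⟩
      refine ⟨h0, by omega, ?_, fun c => ?_⟩
      · rw [ha₂ 5 (by simp; omega), ha₂ 6 (by simp; omega)]
        intro v
        rw [(hall _).1]
        exact ht₁ v
      · rw [(hall c).1]
        exact (hall c).2
    · left
      refine ⟨h1, ?_⟩
      rcases h₂.cls c with ⟨-, -, hns, k', hk', hV'⟩ | ⟨hne, -⟩
      · have := (hkr c).resolve_right hns
        have := hV'.le_cliqueNum
        omega
      · exact absurd hc hne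

theorem ends_relabel (hG : IsAdjTable G st nb) (hNB : N ≤ B) (hs : Ctx N st nb s)
    {P Q : Fin N → ℕ} (hP : ∀ v : Fin N, s.arr 5 v = P v) (hQ : ∀ v : Fin N, s.arr 6 v = Q v)
    (hB : ∀ v, P v * (N + 2) + Q v ≤ B) :
    Ends B (forVerts relabel) s (9 * N + 3) fun s' =>
      ∀ v : Fin N, s'.arr 3 v = P v * (N + 2) + Q v := by
  refine (Ends.forVerts hG hNB (by simp; omega) (a := 0) (b := 6)
    (I := fun m s' => Ctx N st nb s' ∧ s'.arr 5 = s.arr 5 ∧ s'.arr 6 = s.arr 6 ∧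
      ∀ v : Fin N, (v : ℕ) < m → s'.arr 3 v = P v * (N + 2) + Q v)
    ?_ ?_ hs.reg_zero ⟨hs, rfl, rfl, by simp⟩).mono (by omega) fun s' h v => h.2.2.2 v v.2
  · rintro m s' x ⟨h1, h2⟩
    exact ⟨h1.of_frame (by simp) (by simp) rfl rfl, h2⟩
  · rintro v s' ⟨hc, h5, h6, hv⟩ - h1
    have hPv := hB v
    have hle : P v ≤ P v * (N + 2) := Nat.le_mul_of_pos_right _ (by omega)
    refine Ends.mono (T := 0 + 1 + 1 + 1 + 1 + 1 + 1) (Ends.cons_load (by simp [h1, h5, hP]; omega)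
      (Ends.cons_load (by simp [h1, h6, hQ]; omega)
      (Ends.cons_arith (by simp [h1, h5, hP, hc.reg_eleven]; omega)
      (Ends.cons_arith (by simp [h1, h5, hP, h6, hQ, hc.reg_eleven]; omega)
      (Ends.cons_store (by simp [h1, h5, hP, h6, hQ, hc.reg_eleven]; omega)
      (Ends.nil ?_)))))) (by omega) fun _ h => h
    simp only [Memory.setArr_arr, Memory.setReg_arr, Memory.setReg_reg, Operand.val_reg, if_true,
      if_false, Nat.reduceEqDiff, OfNat.one_ne_ofNat, h1, h5, h6, hP, hQ, hc.reg_eleven,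
      Arith.val_add, Arith.val_mul, true_and]
    refine ⟨hc.of_frame (by simp) (by simp) (by simp) (by simp), fun w hw => ?_⟩
    rcases Nat.lt_succ_iff_lt_or_eq.1 hw with hlt | heq
    · rw [Function.update_of_ne (by omega)]
      exact hv w hlt
    · rw [show w = v from Fin.ext heq, Function.update_self]

theorem ends_refineLabels (hG : IsAdjTable G st nb) (hN : 0 < N) (hst : ∀ v ≤ N, st v ≤ B)
    (hA : 10 ≤ A) (hF : 10 ≤ F) (hAF : A ≠ F) {Λ : ℕ} (hlab : ∀ v : Fin N, s.arr 3 v = lab v)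
    (hΛ : ∀ v, lab v ≤ Λ) (hB : (Λ * (N + 2) + (N + 1)) * (N + 3) ≤ B) (hs : Ctx N st nb s)
    (hS : Stamped G (s.arr 4)) (hA0 : ∀ x, s.arr A x = 0) (hF0 : ∀ x, s.arr F x = 0) :
    Ends B (refineLabels A F) s (100 * ((G.cliqueNum + 1) * (st N + N))) fun s' =>
      Ctx N st nb s' ∧ Stamped G (s'.arr 4) ∧ Refines G lab (fun v => s'.arr 3 v) ∧
      ∀ v : Fin N, s'.arr 3 v ≤ (Λ * (N + 2) + (N + 1)) * (N + 3) := by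
  set ω := G.cliqueNum with hω
  have hB' : Λ * (N + 2) + (N + 1) ≤ B := (Nat.le_mul_of_pos_right _ (by omega)).trans hB
  have hlB : ∀ v, lab v * (N + 2) + (N + 1) ≤ Λ * (N + 2) + (N + 1) := fun v =>
    Nat.add_le_add_right (Nat.mul_le_mul_right _ (hΛ v)) _
  have hrow : ∀ c, row N (fun _ => 0) c = fun _ => 0 := by
    intro c
    funext a
    simp [row]
  -- At most `ω + 1` rounds, the last one confirming stability, and then one sweep to relabel.
  refine Ends.mono (T := 0 + 1 + (9 * N + 3) + ((ω + 1 - 0) * (39 * st N + 55 * N + 11) + 1) + 1 + 1)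
    (Ends.cons_mov (by simp) (Ends.cons_mov (by simp; omega) ?_)) ?_ fun _ h => h
  · refine Ends.cons_of (R := fun s' => Refining G st nb lab A F s' ∧ s'.reg 13 = 0) ?_ ?_
    · refine (Ends.loop (I := Refining G st nb lab A F)
        (Φ := fun s' => (ω + 1 - s'.reg 12) * (39 * st N + 55 * N + 11) + 1)
        (fun _ _ => by omega) ?_ ?_).mono (by simp) fun s' h => ⟨h.1, ?_⟩
      · intro s' h hc
        simp only [Test.holds_lt, Operand.val_lit, Operand.val_reg] at hc
        refine ⟨_, (ends_round hG hst (by omega) hA hF hAF (fun v => (hlB v).trans hB') h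
          (by omega)).mono le_rfl fun s'' h'' => ⟨h''.1, ?_⟩⟩
        have : s'.reg 12 ≤ ω := by
          rcases h.changed with h | h
          · exact h.2
          · omega
        rw [h''.2, show ω + 1 - s'.reg 12 = ω + 1 - (s'.reg 12 + 1) + 1 by omega, add_mul]
        omega
      · refine ⟨hs.of_frame (by simp) (by simp) (by simp) (by simp), by simpa using hS,
          by simpa using hlab, by simp [hF0], ?_, ?_⟩
        · intro c
          -- The fresh zero array encodes the empty clique in every class.
          refine ⟨0, ?_, Or.inl (by simp)⟩
          simp only [Memory.setReg_arr]
          rw [show s.arr A = fun _ => 0 from funext hA0, hrow]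
          exact ⟨fun a ha => absurd ha (by omega), fun a ha => absurd ha (by omega), fun _ _ => rfl⟩
        · exact Or.inl ⟨by simp, by simp⟩
      · have := h.2
        simp only [Test.holds_lt, Operand.val_lit, Operand.val_reg] at this
        omega
    · rintro s₁ ⟨h, h13⟩ _ _
      obtain ⟨-, -, ht, hstab⟩ := h.changed.resolve_left (by omega)
      choose k hk _ using h.valid
      have hPQ : ∀ v, s₁.arr 5 (v : Fin N) * (N + 2) + s₁.arr 6 v ≤
          (Λ * (N + 2) + (N + 1)) * (N + 3) := by
        intro v
        obtain ⟨i, j, ht, h5, h6⟩ := ht v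
        have := (hk _).right_lt ht
        have := ht.1
        have := hlB v
        dsimp only at h5 h6
        calc _ ≤ (Λ * (N + 2) + (N + 1)) * (N + 2) + (Λ * (N + 2) + (N + 1)) :=
              add_le_add (Nat.mul_le_mul_right _ (by omega)) (by omega)
          _ = _ := by ring
      refine Ends.cons_of (ends_relabel hG (by omega) h.ctx (fun _ => rfl) (fun _ => rfl)
        fun v => (hPQ v).trans hB) fun s₂ h₂ hr₂ ha₂ => Ends.nil (T := 0) ?_
      simp only [regs_forVerts, arrs_forVerts, regs_relabel, arrs_relabel] at hr₂ ha₂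
      refine ⟨h.ctx.of_frame (hr₂ 0 (by simp)) (hr₂ 11 (by simp)) (ha₂ 0 (by simp))
        (ha₂ 1 (by simp)), ?_, ?_, ?_⟩
      · rw [ha₂ 4 (by simp)]
        exact h.stamped
      · simp only [h₂]
        exact refines_of_rows ⟨0, hN⟩ hk hstab ht
      · intro v
        rw [h₂]
        exact hPQ v
  · have h1 : (ω + 1) * (39 * st N + 55 * N + 11) ≤ (ω + 1) * (66 * (st N + N)) :=
      Nat.mul_le_mul_left _ (by omega)
    have h2 : (ω + 1) * (66 * (st N + N)) = 66 * ((ω + 1) * (st N + N)) := by ring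
    have h3 : st N + N ≤ (ω + 1) * (st N + N) := Nat.le_mul_of_pos_left _ (by omega)
    rw [Nat.sub_zero]
    omega

end Refinement
end WordRAM

namespace WordRAM

/-! ### The final greedy coloring -/

section Greedy

variable {N : ℕ} {G : SimpleGraph (Fin N)} {st nb : ℕ → ℕ} {B : ℕ}

/-- Stamp the codes of the neighbours of the vertex in register `1`. -/
def markCodes : Prog := forNbrs (block [.load 15 7 (.reg 5), .store 8 (.reg 15) (.reg 2)])

/-- Give to the vertex in register `1` the first code of its class that no neighbour has, and
the number of this code as its color. -/
def greedy : Prog :=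
  block [markCodes, .load 6 3 (.reg 1), .arith 6 .mul (.reg 6) (.reg 11),
    .arith 6 .add (.reg 6) (.lit 1), scan (.load 7 8 (.reg 6)), .store 7 (.reg 1) (.reg 6),
    .load 7 9 (.reg 6),
    .ite (.eq (.reg 7) (.lit 0))
      (block [.arith 14 .add (.reg 14) (.lit 1), .store 9 (.reg 6) (.reg 14), .mov 7 (.reg 14)])
      .skip,
    .arith 7 .sub (.reg 7) (.lit 1), .store 2 (.reg 1) (.reg 7)]

@[simp] theorem regs_greedy : greedy.regs = {2, 3, 4, 5, 6, 7, 14, 15} := by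
  ext x; simp [greedy, markCodes]; omega

/-- The number of neighbours of `v` in its class. -/
def classDegree (G : SimpleGraph (Fin N)) (lab : Fin N → ℕ) (v : Fin N) : ℕ :=
  {w | G.Adj v w ∧ lab w = lab v}.ncard

theorem classDegree_lt (lab : Fin N → ℕ) (v : Fin N) : classDegree G lab v < N := by
  have : {w | G.Adj v w ∧ lab w = lab v} ⊂ Set.univ := by
    rw [Set.ssubset_univ_iff]
    intro h
    have : v ∈ {w | G.Adj v w ∧ lab w = lab v} := h ▸ Set.mem_univ v
    exact this.1.ne rfl
  simpa [classDegree] using Set.ncard_lt_ncard this (Set.toFinite _)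

theorem classDegree_le (hG : IsAdjTable G st nb) (lab : Fin N → ℕ) (v : Fin N) :
    classDegree G lab v ≤ st (v + 1) - st v := by
  rw [← hG.ncard_eq]
  exact Set.ncard_le_ncard (fun w hw => hw.1) (Set.toFinite _)

/-- Pigeonhole: codes of different classes lie in disjoint blocks of length `N + 2`, so only the
neighbours in the class of `v` can occupy codes of its block. Code zero means not yet colored. -/
theorem exists_free_code {lab code : Fin N → ℕ} (hcode : ∀ u, code u = 0 ∨
      lab u * (N + 2) + 1 ≤ code u ∧ code u ≤ lab u * (N + 2) + classDegree G lab u + 1)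
    (v : Fin N) : ∃ n ≤ classDegree G lab v,
      (∀ a < n, ∃ u, G.Adj v u ∧ code u = lab v * (N + 2) + 1 + a) ∧
      ¬ ∃ u, G.Adj v u ∧ code u = lab v * (N + 2) + 1 + n := by
  classical
  suffices h : ∃ n ≤ classDegree G lab v,
      ¬ ∃ u, G.Adj v u ∧ code u = lab v * (N + 2) + 1 + n by
    obtain ⟨n, hn, hn'⟩ := h
    have hex : ∃ n, ¬ ∃ u, G.Adj v u ∧ code u = lab v * (N + 2) + 1 + n := ⟨n, hn'⟩
    exact ⟨Nat.find hex, (Nat.find_min' hex hn').trans hn,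
      fun a ha => not_not.1 (Nat.find_min hex ha), Nat.find_spec hex⟩
  by_contra! hall
  choose f hf hfc using fun a : Fin (classDegree G lab v + 1) => hall a (by omega)
  have hlt := classDegree_lt (G := G) lab v
  have hmem : ∀ a, f a ∈ {w | G.Adj v w ∧ lab w = lab v} := by
    intro a
    refine ⟨hf a, ?_⟩
    have h1 := hfc a
    have h2 := classDegree_lt (G := G) lab (f a)
    rcases hcode (f a) with h | h
    · omega
    · have h3 : lab (f a) * (N + 2) + (code (f a) - lab (f a) * (N + 2)) =
          lab v * (N + 2) + (1 + a) := by omega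
      exact (mul_add_injective (by omega) (by omega) h3).1
  have hinj : Function.Injective f := by
    intro a b hab
    have h1 := hfc a
    rw [hab, hfc b] at h1
    exact Fin.ext (by omega)
  have := Set.ncard_le_ncard (Set.range_subset_iff.2 hmem) (Set.toFinite _)
  rw [← Set.image_univ, Set.ncard_image_of_injective _ hinj, Set.ncard_univ, Nat.card_fin] at this
  exact absurd this (by simp [classDegree])

/-- The invariant of the greedy coloring, when the vertices below `m` have been colored. -/
structure Coloring (G : SimpleGraph (Fin N)) (st nb : ℕ → ℕ) (lab : Fin N → ℕ) (m : ℕ)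
    (s : Memory) : Prop where
  ctx : Ctx N st nb s
  lab_eq : ∀ v : Fin N, s.arr 3 v = lab v
  stamp_le : ∀ x, s.arr 8 x ≤ m
  code_zero : ∀ v : Fin N, m ≤ v → s.arr 7 v = 0
  le_code : ∀ v : Fin N, v < m → lab v * (N + 2) + 1 ≤ s.arr 7 v
  code_le : ∀ v : Fin N, v < m → s.arr 7 v ≤ lab v * (N + 2) + classDegree G lab v + 1
  code_ne : ∀ u v : Fin N, u < m → v < m → G.Adj u v → s.arr 7 u ≠ s.arr 7 v
  count_eq : s.reg 14 = ((fun v : Fin N => s.arr 7 v) '' {v | v < m}).ncard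
  num_zero : ∀ x, s.arr 9 x = 0 ↔ x ∉ (fun v : Fin N => s.arr 7 v) '' {v | v < m}
  num_le : ∀ x, s.arr 9 x ≤ s.reg 14
  num_inj : ∀ x y, s.arr 9 x ≠ 0 → s.arr 9 x = s.arr 9 y → x = y
  out_eq : ∀ v : Fin N, v < m → s.arr 2 v + 1 = s.arr 9 (s.arr 7 v)

variable {lab : Fin N → ℕ} {s s' : Memory}

/-- Vertices are swept in increasing order, so older stamps are at most `v` and cannot be mistaken
for `v + 1`. Uncolored neighbours stamp only cell zero, which is no code. -/
theorem ends_markCodes (hG : IsAdjTable G st nb) (hNB : N ≤ B) (hst : ∀ v ≤ N, st v ≤ B)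
    {v : Fin N} (hs : Ctx N st nb s) (h1 : s.reg 1 = v) (hS : ∀ x, s.arr 8 x ≤ v)
    (hB : ∀ u : Fin N, s.arr 7 u ≤ B) :
    Ends B markCodes s (7 * (st (v + 1) - st v) + 5) fun s' => (∀ x, s'.arr 8 x ≤ v + 1) ∧
      (∀ x, s'.arr 8 x = v + 1 ↔ ∃ u, G.Adj v u ∧ s.arr 7 u = x) ∧ s'.reg 2 = v + 1 := by
  refine (Ends.forNbrs hG hNB hst (τ := 3) (v := v) (I := fun D s' => s'.arr 7 = s.arr 7 ∧
    (∀ x, s'.arr 8 x ≤ v + 1) ∧ ∀ x, s'.arr 8 x = v + 1 ↔ ∃ u ∈ D, s.arr 7 u = x)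
    (by simp; omega) (by simp; omega) (by simp) ?_ h1 hs.arr_zero hs.arr_one
    ⟨rfl, fun x => (hS x).trans (Nat.le_succ _), ?_⟩).mono le_rfl
    fun s' h => ⟨h.1.2.1, h.1.2.2, h.2⟩
  · rintro D u s₁ ⟨h7, h8, hD⟩ huv h1 h2 h5
    have hu := hB u
    refine Ends.cons_load (by simpa [h5, h7]) (Ends.cons_store (by simp [h2]; omega)
      (Ends.nil (T := 0) ?_))
    simp only [Memory.setArr_arr, Memory.setReg_arr, Memory.setReg_reg, Operand.val_reg,
      if_true, if_false, Nat.reduceEqDiff, h2, h5, h7, true_and]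
    refine ⟨fun x => ?_, fun x => ?_⟩
    · rw [Function.update_apply]
      split_ifs
      · exact le_rfl
      · exact h8 x
    · rw [Function.update_apply]
      split_ifs with hx
      · simp [hx]
      · rw [hD]
        simp [Ne.symm hx]
  · intro x
    have := hS x
    simp
    omega

/-- Codes are large numbers; array `9` numbers the distinct codes consecutively as they appear. So
the final colors lie below the number of codes used. -/
theorem ends_greedy (hG : IsAdjTable G st nb) (hNB : N + 1 ≤ B) (hst : ∀ v ≤ N, st v ≤ B)
    (hB : ∀ v, lab v * (N + 2) + (N + 1) ≤ B) {v : Fin N} (h : Coloring G st nb lab v s)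
    (h1 : s.reg 1 = v) :
    Ends B greedy s (11 * (st (v + 1) - st v) + 21) (Coloring G st nb lab (v + 1)) := by
  have hcode : ∀ u : Fin N, s.arr 7 u = 0 ∨ lab u * (N + 2) + 1 ≤ s.arr 7 u ∧
      s.arr 7 u ≤ lab u * (N + 2) + classDegree G lab u + 1 := by
    intro u
    rcases lt_or_ge (u : ℕ) v with hu | hu
    · exact Or.inr ⟨h.le_code u hu, h.code_le u hu⟩
    · exact Or.inl (h.code_zero u hu)
  have hcB : ∀ u : Fin N, s.arr 7 u ≤ B := by
    intro u
    have := hB u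
    have := classDegree_lt (G := G) lab u
    rcases hcode u with h | h <;> omega
  obtain ⟨n, hn, hlt, hfree⟩ := exists_free_code hcode v
  have hdeg := classDegree_lt (G := G) lab v
  have hdeg' := classDegree_le hG lab v
  have hBv := hB v
  have hvN : (v : ℕ) < N := v.2
  set y := lab v * (N + 2) + 1 + n with hy
  have hcount : s.reg 14 ≤ N := by
    rw [h.count_eq]
    refine (Set.ncard_image_le (Set.toFinite _)).trans ?_
    simpa using Set.ncard_le_card {u : Fin N | (u : ℕ) < v}
  refine Ends.mono (T := 4 * n + 16 + (7 * (st (v + 1) - st v) + 5)) (Ends.cons_of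
    (ends_markCodes hG (by omega) hst h.ctx h1 h.stamp_le hcB) fun s₁ ⟨h8, h8', h2⟩ hr har => ?_)
    (by omega) fun _ h => h
  simp only [markCodes, regs_forNbrs, arrs_forNbrs, regs_block_cons, regs_block_nil,
    arrs_block_cons, arrs_block_nil, Prog.regs, Prog.arrs] at hr har
  have e0 : s₁.reg 0 = s.reg 0 := hr 0 (by simp)
  have e1 : s₁.reg 1 = v := (hr 1 (by simp)).trans h1
  have e11 : s₁.reg 11 = N + 2 := (hr 11 (by simp)).trans h.ctx.reg_eleven
  have e14 : s₁.reg 14 = s.reg 14 := hr 14 (by simp)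
  have a0 : s₁.arr 0 = s.arr 0 := har 0 (by simp)
  have a1 : s₁.arr 1 = s.arr 1 := har 1 (by simp)
  have a2 : s₁.arr 2 = s.arr 2 := har 2 (by simp)
  have a3 : s₁.arr 3 = s.arr 3 := har 3 (by simp)
  have a7 : s₁.arr 7 = s.arr 7 := har 7 (by simp)
  have a9 : s₁.arr 9 = s.arr 9 := har 9 (by simp)
  have hlB : lab v ≤ lab v * (N + 2) := Nat.le_mul_of_pos_right _ (by omega)
  refine Ends.mono (T := 10 + (4 * n + 3) + 1 + 1 + 1)
    (Ends.cons_load (by simp [e1, a3, h.lab_eq]; omega)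
    (Ends.cons_arith (by simp [e1, a3, h.lab_eq, e11]; omega)
    (Ends.cons_arith (by simp [e1, a3, h.lab_eq, e11]; omega) ?_))) (by omega) fun _ h => h
  simp only [Memory.setReg_reg, Operand.val_reg, Operand.val_lit, Arith.val_mul,
    Arith.val_add, if_true, if_false, Nat.reduceEqDiff, e1, a3, h.lab_eq, e11]
  refine Ends.cons_of (Ends.scan (F := s₁.arr 8) (q₀ := lab v * (N + 2) + 1) (n := n) (τ := 1)
    (vp := v + 1) (by simp) ?_ (by simpa using h2) (by simp) (by omega)
    (fun a ha => (h8' _).2 (hlt a ha)) fun hh => hfree ((h8' _).1 hh)) fun s₂ ⟨ha₂, h6₂⟩ hr₂ _ => ?_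
  · intro s' ha' _ _
    simp only [Memory.setReg_arr] at ha'
    refine Ends.load (by simpa [ha'] using (h8 _).trans (by omega)) ?_
    simp [ha']
  simp only [regs_scan, Prog.regs] at hr₂
  simp only [Memory.setReg_arr] at ha₂
  have f0 : s₂.reg 0 = s.reg 0 := (hr₂ 0 (by simp)).trans (by simpa using e0)
  have f1 : s₂.reg 1 = v := (hr₂ 1 (by simp)).trans (by simpa using e1)
  have f11 : s₂.reg 11 = N + 2 := (hr₂ 11 (by simp)).trans (by simpa using e11)
  have f14 : s₂.reg 14 = s.reg 14 := (hr₂ 14 (by simp)).trans (by simpa using e14)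
  rw [← hy] at h6₂
  have hnum := h.num_le y
  refine Ends.cons_store (T := 9) (by simp [h6₂]; omega) (Ends.cons_load (T := 8)
    (by simp [h6₂, ha₂, a9]; omega) ?_)
  simp only [Memory.setArr_reg, Memory.setArr_arr, Operand.val_reg, Nat.reduceEqDiff, if_false, h6₂,
    f1, ha₂, a9]
  refine Ends.cons (T' := 3) (T := 5) ?_
  -- What holds after the branch, whether the code is new or already numbered; the remaining two
  -- instructions are treated once for both cases.
  let Pre : Memory → Prop := fun s' => s'.reg 0 = N ∧ s'.reg 1 = v ∧ s'.reg 11 = N + 2 ∧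
    s'.arr 0 = st ∧ s'.arr 1 = nb ∧ s'.arr 2 = s.arr 2 ∧ s'.arr 3 = s.arr 3 ∧
    s'.arr 7 = Function.update (s.arr 7) v y ∧ s'.arr 8 = s₁.arr 8 ∧ s'.reg 7 = s'.arr 9 y ∧
    1 ≤ s'.arr 9 y ∧ s'.arr 9 y ≤ B ∧
    s'.reg 14 = (insert y ((fun v : Fin N => s.arr 7 v) '' {u | (u : ℕ) < v})).ncard ∧
    (∀ x, s'.arr 9 x = 0 ↔ x ∉ insert y ((fun v : Fin N => s.arr 7 v) '' {u | (u : ℕ) < v})) ∧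
    (∀ x, s'.arr 9 x ≤ s'.reg 14) ∧ (∀ x x', s'.arr 9 x ≠ 0 → s'.arr 9 x = s'.arr 9 x' → x = x') ∧
    ∀ x, s.arr 9 x ≠ 0 → s'.arr 9 x = s.arr 9 x
  have key : ∀ s', Pre s' → Ends B (block [.arith 7 .sub (.reg 7) (.lit 1),
      .store 2 (.reg 1) (.reg 7)]) s' 3 (Coloring G st nb lab (v + 1)) := by
    rintro s' ⟨p0, p1, p11, b0, b1, b2, b3, b7, b8, b9, b9', b9'', p14, hz, hl, hi, hold⟩
    refine Ends.cons_arith (by simp; omega) (Ends.cons_store (by simp; omega)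
      (Ends.nil (T := 0) ?_))
    have hset : (fun u : Fin N => Function.update (s.arr 7) v y u) '' {u | (u : ℕ) < v + 1} =
        insert y ((fun v : Fin N => s.arr 7 v) '' {u | (u : ℕ) < v}) := by
      have : {u : Fin N | (u : ℕ) < v + 1} = insert v {u : Fin N | (u : ℕ) < v} := by
        ext u
        simp only [Set.mem_ofPred_eq, Set.mem_insert_iff, Fin.ext_iff]
        omega
      rw [this, Set.image_insert_eq, Function.update_self]
      congr 1
      refine Set.image_congr fun u hu => ?_
      rw [Function.update_of_ne]
      exact Nat.ne_of_lt hu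
    have hv_of : ∀ u : Fin N, (u : ℕ) < v + 1 → u = v ∨ (u : ℕ) < v := fun u hu => by
      rcases Nat.lt_succ_iff_lt_or_eq.1 hu with h | h
      · exact Or.inr h
      · exact Or.inl (Fin.ext h)
    refine ⟨⟨by simpa using p0, by simpa using p11, by simpa using b0, by simpa using b1⟩,
      ?_, ?_, ?_, ?_, ?_, ?_, ?_, ?_, ?_, ?_, ?_⟩
    all_goals simp only [Memory.setReg_reg, Memory.setReg_arr, Memory.setArr_reg,
      Memory.setArr_arr, Operand.val_reg, Operand.val_lit, Arith.val_sub, if_true, if_false,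
      Nat.reduceEqDiff, OfNat.one_ne_ofNat, b2, b3, b7, b8, b9, p1, hset]
    · exact h.lab_eq
    · exact h8
    · intro u hu
      rw [Function.update_of_ne (by omega)]
      exact h.code_zero u (by omega)
    · intro u hu
      rcases hv_of u hu with rfl | hu'
      · rw [Function.update_self]
        omega
      · rw [Function.update_of_ne hu'.ne]
        exact h.le_code u hu'
    · intro u hu
      rcases hv_of u hu with rfl | hu'
      · rw [Function.update_self]
        omega
      · rw [Function.update_of_ne hu'.ne]
        exact h.code_le u hu'
    · intro u w hu hw huw
      rcases hv_of u hu with rfl | hu' <;> rcases hv_of w hw with rfl | hw'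
      · exact absurd rfl huw.ne
      · rw [Function.update_self, Function.update_of_ne hw'.ne]
        exact fun hh => hfree ⟨w, huw, hh.symm⟩
      · rw [Function.update_self, Function.update_of_ne hu'.ne]
        exact fun hh => hfree ⟨u, huw.symm, hh⟩
      · rw [Function.update_of_ne hu'.ne, Function.update_of_ne hw'.ne]
        exact h.code_ne u w hu' hw' huw
    · exact p14
    · exact hz
    · exact hl
    · exact hi
    · intro u hu
      rcases hv_of u hu with rfl | hu'
      · rw [Function.update_self, Function.update_self]
        omega
      · rw [Function.update_of_ne hu'.ne, Function.update_of_ne hu'.ne, h.out_eq u hu']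
        refine (hold _ fun hh => ?_).symm
        exact (h.num_zero _).1 hh ⟨u, hu', rfl⟩
  refine Ends.ite (T := 4) (fun hc => ?_) fun hc => (Ends.skip (key _ ?_)).mono (by omega)
    fun _ h => h
  · simp only [Test.holds_eq, Operand.val_reg, Operand.val_lit, Memory.setReg_reg, if_true] at hc
    have hnot := (h.num_zero y).1 hc
    refine Ends.cons_arith (by simp [f14]; omega) (Ends.cons_store (by simp [f14]; omega)
      (Ends.cons_mov (by simp [f14]; omega) (Ends.nil (T := 0) (key _ ?_))))
    simp only [Pre, Memory.setReg_reg, Memory.setReg_arr, Memory.setArr_reg,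
      Memory.setArr_arr, Operand.val_reg, Operand.val_lit, Arith.val_add, if_true, if_false,
      Nat.reduceEqDiff, OfNat.one_ne_ofNat, OfNat.zero_ne_ofNat, h6₂, f0, f1, f11, f14, ha₂, a0,
      a1, a2, a3, a7, a9, h.ctx.reg_zero, h.ctx.arr_zero, h.ctx.arr_one, Function.update_self, true_and]
    refine ⟨by omega, by omega, ?_, ?_, ?_, ?_, ?_⟩
    · rw [Set.ncard_insert_of_notMem hnot (Set.toFinite _), h.count_eq]
    · intro x
      rw [Function.update_apply]
      split_ifs with hx
      · simp [hx]
      · rw [h.num_zero]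
        simp only [Set.mem_insert_iff, hx, false_or]
    · intro x
      rw [Function.update_apply]
      split_ifs
      · exact le_rfl
      · exact (h.num_le x).trans (Nat.le_succ _)
    · intro x x'
      have hx1 := h.num_le x
      have hx2 := h.num_le x'
      have hx3 := h.num_inj x x'
      rw [Function.update_apply, Function.update_apply]
      split_ifs with g1 g2 g2
      · exact fun _ _ => g1.trans g2.symm
      · intros
        omega
      · intros
        omega
      · exact hx3
    · intro x hx
      rw [Function.update_of_ne]
      rintro rfl
      exact hx hc
  · simp only [Test.holds_eq, Operand.val_reg, Operand.val_lit, Memory.setReg_reg, if_true] at hc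
    have hmem : y ∈ (fun v : Fin N => s.arr 7 v) '' {u | (u : ℕ) < v} :=
      not_not.1 fun hh => hc ((h.num_zero y).2 hh)
    simp only [Pre, Memory.setReg_reg, Memory.setReg_arr, Memory.setArr_reg,
      Memory.setArr_arr, if_true, if_false,
      Nat.reduceEqDiff, OfNat.one_ne_ofNat, OfNat.zero_ne_ofNat, f0, f1, f11, f14, ha₂, a0, a1, a2, a3,
      a7, a9, h.ctx.reg_zero, h.ctx.arr_zero, h.ctx.arr_one, true_and, Set.insert_eq_of_mem hmem]
    exact ⟨by omega, by omega, h.count_eq, h.num_zero, h.num_le, h.num_inj, fun _ _ => trivial⟩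

end Greedy
end WordRAM

namespace WordRAM

/-! ### The program -/

section Main

variable {N : ℕ} {G : SimpleGraph (Fin N)} {st nb : ℕ → ℕ} {B : ℕ}

/-- Refine the labels `d` times, each time with two new arrays. -/
def refineAll : ℕ → Prog
  | 0 => .skip
  | d + 1 => .seq (refineLabels (10 + 2 * d) (11 + 2 * d)) (refineAll d)

/-- The coloring program for `B_{n,d}`-free graphs; it does not depend on `n`. -/
def colorProg (d : ℕ) : Prog :=
  block [.arith 11 .add (.reg 0) (.lit 2), refineAll d, forVerts greedy]

theorem regs_refineAll (d : ℕ) : ∀ x ∈ (refineAll d).regs, x ≠ 0 ∧ x ≠ 14 := by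
  induction d with
  | zero => simp [refineAll]
  | succ d ih =>
    rintro x (hx | hx)
    · simp only [regs_refineLabels, Set.mem_insert_iff, Set.mem_singleton_iff] at hx
      omega
    · exact ih x hx

theorem arrs_refineAll (d : ℕ) : ∀ A ∈ (refineAll d).arrs, A ≠ 7 ∧ A ≠ 8 ∧ A ≠ 9 := by
  induction d with
  | zero => simp [refineAll]
  | succ d ih =>
    rintro x (hx | hx)
    · simp only [arrs_refineLabels, Set.mem_insert_iff, Set.mem_singleton_iff] at hx
      omega
    · exact ih x hx

/-- Each refinement multiplies the size of labels by a bounded power of `N + 1`, so for fixed `d`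
the words stay polynomial. Fresh arrays make initialisation unnecessary. -/
theorem ends_refineAll (hG : IsAdjTable G st nb) (hN : 0 < N) (hst : ∀ v ≤ N, st v ≤ B) {d e : ℕ}
    (hB : (N + 1) ^ (e + 5 * d) ≤ B) {lab : Fin N → ℕ} {s : Memory}
    (hlab : ∀ v : Fin N, s.arr 3 v = lab v) (hΛ : ∀ v, lab v ≤ (N + 1) ^ e)
    (hs : Ctx N st nb s) (hS : Stamped G (s.arr 4))
    (h0 : ∀ A, 10 ≤ A → A < 10 + 2 * d → ∀ x, s.arr A x = 0) :
    Ends B (refineAll d) s (d * (100 * ((G.cliqueNum + 1) * (st N + N))) + 1) fun s' =>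
      Ctx N st nb s' ∧ (∀ v : Fin N, s'.arr 3 v ≤ (N + 1) ^ (e + 5 * d)) ∧
      ∀ code, IsLayered G 0 (fun v => s'.arr 3 v) code → IsLayered G d lab code := by
  induction d generalizing e lab s with
  | zero =>
    refine (Ends.skip ⟨hs, ?_, ?_⟩).mono (by omega) fun _ h => h
    · simpa [hlab] using hΛ
    · simp only [hlab]
      exact fun _ h => h
  | succ d ih =>
    -- The exponent grows by five: two each for the factors `N + 2` and `N + 3`, and one for a
    -- factor `2 ≤ N + 1`.
    have hX : ((N + 1) ^ e * (N + 2) + (N + 1)) * (N + 3) ≤ (N + 1) ^ (e + 5) := by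
      have h1 : N + 3 ≤ (N + 1) ^ 2 := by nlinarith
      have h2 : 1 ≤ (N + 1) ^ e := Nat.one_le_pow _ _ (by omega)
      have h3 : N + 1 ≤ (N + 1) ^ e * (N + 1) ^ 2 := by
        calc N + 1 ≤ 1 * (N + 1) ^ 2 := by nlinarith
          _ ≤ _ := Nat.mul_le_mul_right _ h2
      calc ((N + 1) ^ e * (N + 2) + (N + 1)) * (N + 3)
          ≤ ((N + 1) ^ e * (N + 1) ^ 2 + (N + 1) ^ e * (N + 1) ^ 2) * (N + 1) ^ 2 :=
            Nat.mul_le_mul (add_le_add (Nat.mul_le_mul_left _ (by omega)) h3) h1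
        _ = (N + 1) ^ (e + 4) * 2 := by ring
        _ ≤ (N + 1) ^ (e + 4) * (N + 1) := Nat.mul_le_mul_left _ (by omega)
        _ = _ := by ring
    have hexp : e + 5 * (d + 1) = e + 5 + 5 * d := by ring
    rw [hexp] at hB ⊢
    have hXB : (N + 1) ^ (e + 5) ≤ B := (Nat.pow_le_pow_right (by omega) (by omega)).trans hB
    refine (Ends.seq ((ends_refineLabels hG hN hst (by omega) (by omega) (by omega) hlab hΛ
      (hX.trans hXB) hs hS (h0 _ (by omega) (by omega)) (h0 _ (by omega) (by omega))).framed.mono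
      le_rfl fun s₁ h₁ => ?_) (T' := d * (100 * ((G.cliqueNum + 1) * (st N + N))) + 1)).mono
      (le_of_eq (by ring)) fun _ h => h
    obtain ⟨⟨hc, hS₁, hR, hle⟩, -, ha⟩ := h₁
    refine (ih hB (fun _ => rfl) (fun v => (hle v).trans hX) hc hS₁ ?_).mono le_rfl
      fun s₂ ⟨hc₂, hle₂, h₂⟩ => ⟨hc₂, hle₂, fun code hcode => ⟨_, hR, h₂ code hcode⟩⟩
    intro A h1 h2 x
    rw [ha A (by simp; omega)]
    exact h0 A h1 (by omega) x

theorem HoldsAdjLists.isAdjTable {s : Memory} (h : HoldsAdjLists G s) :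
    IsAdjTable G (s.arr 0) (s.arr 1) :=
  ⟨h.start_zero, h.start_mono, h.neighbours⟩

theorem bFreeOn_of_bFree {n d : ℕ} (h : BFree n d G) (S : Set (Fin N)) :
    BFreeOn G n d S := by
  intro H hH f
  exact (h H hH ⟨f⟩).elim

theorem findsColoring_colorProg {d n : ℕ} (hn : 2 * (d + 1) ≤ n) (hN : 0 < N) (hB : BFree n d G) :
    (colorProg d).FindsColoring (5 * d + 4) G (gBound d n G.cliqueNum)
      ((400 * d + 200) * G.cliqueNum * (G.edgeSet.ncard + N)) := by
  intro s hs
  have hG := hs.isAdjTable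
  set st := s.arr 0 with hst_def
  have hω : 1 ≤ G.cliqueNum := by
    have : G.IsClique (({⟨0, hN⟩} : Finset (Fin N)) : Set (Fin N)) := by simp
    simpa using this.card_le_cliqueNum
  have hpow : ∀ a ≤ 5 * d + 4, (N + 1) ^ a ≤ (N + 1) ^ (5 * d + 4) := fun a ha =>
    Nat.pow_le_pow_right (by omega) ha
  have hX2 : N + 2 ≤ (N + 1) ^ 2 := by nlinarith
  have hst : ∀ v ≤ N, st v ≤ (N + 1) ^ (5 * d + 4) := fun v hv =>
    (hG.le_sq hv).trans (le_trans (by nlinarith) (hpow 2 (by omega)))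
  have hcode : (N + 1) ^ (5 * d) * (N + 2) + (N + 1) ≤ (N + 1) ^ (5 * d + 4) := by
    have h2 : 1 ≤ (N + 1) ^ (5 * d) := Nat.one_le_pow _ _ (by omega)
    calc (N + 1) ^ (5 * d) * (N + 2) + (N + 1)
        ≤ (N + 1) ^ (5 * d) * (N + 1) ^ 2 + (N + 1) ^ (5 * d) * (N + 1) ^ 2 := by
          refine add_le_add (Nat.mul_le_mul_left _ hX2) ?_
          calc N + 1 ≤ 1 * (N + 1) ^ 2 := by omega
            _ ≤ _ := Nat.mul_le_mul_right _ h2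
      _ = (N + 1) ^ (5 * d + 2) * 2 := by ring
      _ ≤ (N + 1) ^ (5 * d + 2) * (N + 1) := Nat.mul_le_mul_left _ (by omega)
      _ = (N + 1) ^ (5 * d + 3) := by ring
      _ ≤ _ := hpow _ (by omega)
  have hNB : N + 2 ≤ (N + 1) ^ (5 * d + 4) := hX2.trans (hpow 2 (by omega))
  have hmain : Ends ((N + 1) ^ (5 * d + 4)) (colorProg d) s
      (0 + 1 + (11 * st N + 24 * N + 3) + (d * (100 * ((G.cliqueNum + 1) * (st N + N))) + 1) + 1)
      fun s' => ∃ lab, Coloring G st (s.arr 1) lab N s' ∧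
        ∀ code, IsLayered G 0 lab code → IsLayered G d (fun _ => 0) code := by
    refine Ends.cons_arith (by simpa [hs.order] using hNB) ?_
    refine Ends.cons_of (ends_refineAll hG hN hst (d := d) (e := 0) (lab := fun _ => 0)
      (hpow _ (by omega)) (by simp [hs.arr_other]) (by simp) ⟨?_, ?_, rfl, rfl⟩ ?_ ?_)
      fun s₁ ⟨hc, hle, hlay⟩ hr ha => ?_
    · simpa using hs.order
    · simp [hs.order]
    · rw [Memory.setReg_arr]
      exact ⟨fun x => by simp [hs.arr_other 4], fun x v hx => by simp [hs.arr_other 4] at hx⟩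
    · intro A hA _ x
      simpa using hs.arr_other A (by omega) x
    · simp only [zero_add] at hle
      have e14 : s₁.reg 14 = 0 := by
        rw [hr 14 fun h => (regs_refineAll d 14 h).2 rfl]
        simpa using hs.reg_other 14 (by omega)
      have a7 : ∀ x, s₁.arr 7 x = 0 := fun x => by
        rw [ha 7 fun h => (arrs_refineAll d 7 h).1 rfl]
        simpa using hs.arr_other 7 (by omega) x
      have a8 : ∀ x, s₁.arr 8 x = 0 := fun x => by
        rw [ha 8 fun h => (arrs_refineAll d 8 h).2.1 rfl]
        simpa using hs.arr_other 8 (by omega) x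
      have a9 : ∀ x, s₁.arr 9 x = 0 := fun x => by
        rw [ha 9 fun h => (arrs_refineAll d 9 h).2.2 rfl]
        simpa using hs.arr_other 9 (by omega) x
      refine Ends.cons ((Ends.forVerts hG (by omega) (by simp; omega) (a := 11) (b := 21)
        (I := fun m s' => Coloring G st (s.arr 1) (fun v => s₁.arr 3 v) m s') ?_ ?_ hc.reg_zero
        ?_).mono le_rfl fun s' h => Ends.nil (T := 0) ⟨_, h, hlay⟩)
      · rintro m s' x ⟨c1, c2, c3, c4, c5, c6, c7, c8, c9, c10, c11, c12⟩
        exact ⟨c1.of_frame (by simp) (by simp) rfl rfl, c2, c3, c4, c5, c6, c7, by simpa using c8,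
          c9, by simpa using c10, c11, c12⟩
      · intro v s' h _ h1
        exact ends_greedy hG (by omega) hst (fun v => (Nat.add_le_add_right
          (Nat.mul_le_mul_right _ (hle v)) _).trans hcode) h h1
      · refine ⟨hc, fun _ => rfl, ?_, ?_, ?_, ?_, ?_, ?_, ?_, ?_, ?_, ?_⟩ <;> simp [a7, a8, a9, e14]
  obtain ⟨s', t, hexec, ht, lab, hcol, hlay⟩ := hmain
  refine ⟨s', t, hexec, ht.trans ?_, ?_⟩
  · rw [hG.eq_two_mul_ncard]
    set m := G.edgeSet.ncard
    set ω := G.cliqueNum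
    have h1 : m + N ≤ ω * (m + N) := Nat.le_mul_of_pos_left _ hω
    have h2 : (ω + 1) * (2 * m + N) ≤ 2 * ω * (2 * (m + N)) :=
      Nat.mul_le_mul (by omega) (by omega)
    have h3 : d * (100 * ((ω + 1) * (2 * m + N))) ≤ d * (100 * (2 * ω * (2 * (m + N)))) :=
      Nat.mul_le_mul_left _ (Nat.mul_le_mul_left _ h2)
    have h4 : d * (100 * (2 * ω * (2 * (m + N)))) = 400 * d * ω * (m + N) := by ring
    have h5 : (400 * d + 200) * ω * (m + N) = 400 * d * ω * (m + N) + 200 * (ω * (m + N)) := by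
      ring
    omega
  · let code : Fin N → ℕ := fun v => s'.arr 7 v
    have hL : IsLayered G 0 lab code :=
      ⟨N + 2, fun v => ⟨hcol.le_code v v.2, hcol.code_le v v.2⟩⟩
    -- At the start all vertices carry label zero, so the count for class zero bounds the number of
    -- all codes.
    have hcount : s'.reg 14 ≤ gBound d n G.cliqueNum := by
      have := ncard_image_le_gBound (hlay code hL) hn hω (c := 0) (bFreeOn_of_bFree hB _)
        fun T _ hT => hT.card_le_cliqueNum
      rw [hcol.count_eq]
      refine le_trans (le_of_eq ?_) this
      congr 2
      ext v
      simp
    have hlt : ∀ v : Fin N, s'.arr 2 v < gBound d n G.cliqueNum := by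
      intro v
      have h1 := hcol.out_eq v v.2
      have h2 := hcol.num_le (s'.arr 7 v)
      omega
    refine ⟨SimpleGraph.Coloring.mk (fun v => ⟨s'.arr 2 v, hlt v⟩) ?_, fun v => rfl⟩
    intro u v huv heq
    have h1 := hcol.out_eq u u.2
    have h2 := hcol.out_eq v v.2
    have h3 : s'.arr 2 u = s'.arr 2 v := congrArg Fin.val heq
    exact hcol.code_ne u v u.2 v.2 huv (hcol.num_inj _ _ (by omega) (by omega))

/-- `Prog.FindsColoring` speaks about all inputs encoding the graph; that there is one makes it
imply colorability. -/
theorem exists_holdsAdjLists (G : SimpleGraph (Fin N)) : ∃ s, HoldsAdjLists G s := by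
  classical
  let st : ℕ → ℕ := fun k => if k ≤ N then
    ∑ v ∈ Finset.univ.filter (fun v : Fin N => (v : ℕ) < k), (G.neighborSet v).ncard else 0
  have hst : ∀ v : Fin N, st (v + 1) = st v + (G.neighborSet v).ncard := by
    intro v
    have hv := v.2
    have : Finset.univ.filter (fun u : Fin N => (u : ℕ) < v + 1) =
        insert v (Finset.univ.filter fun u : Fin N => (u : ℕ) < v) := by
      ext u
      simp only [Finset.mem_filter, Finset.mem_univ, true_and, Finset.mem_insert, Fin.ext_iff]
      omega
    simp only [st]
    rw [if_pos (by omega), if_pos (by omega), this, Finset.sum_insert (by simp), add_comm]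
  have hmono : ∀ v < N, st v ≤ st (v + 1) := fun v hv => by
    rw [hst ⟨v, hv⟩]
    exact Nat.le_add_right _ _
  have hmono' : ∀ v w, v ≤ w → w ≤ N → st v ≤ st w := by
    intro v w hvw hw
    induction w, hvw using Nat.le_induction with
    | base => exact le_rfl
    | succ w hvw ih => exact (ih (by omega)).trans (hmono w (by omega))
  have hbij : ∀ v : Fin N, ∃ f : ℕ → ℕ, Set.BijOn f (Set.Ico (st v) (st (v + 1)))
      ((fun w : Fin N => (w : ℕ)) '' G.neighborSet v) := by
    intro v
    refine Set.Finite.exists_bijOn_of_encard_eq (Set.finite_Ico _ _) ?_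
    rw [← (Set.finite_Ico _ _).cast_ncard_eq, ← ((Set.toFinite _).image _).cast_ncard_eq,
      Set.ncard_image_of_injective _ Fin.val_injective, Set.ncard_eq_toFinset_card']
    simp [hst]
  choose f hf using hbij
  let nb : ℕ → ℕ := fun p =>
    if h : ∃ v : Fin N, st v ≤ p ∧ p < st (v + 1) then f h.choose p else 0
  have hnb : ∀ v : Fin N, Set.EqOn (f v) nb (Set.Ico (st v) (st (v + 1))) := by
    rintro v p ⟨hp, hp'⟩
    have h : ∃ v : Fin N, st v ≤ p ∧ p < st (v + 1) := ⟨v, hp, hp'⟩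
    have hc := h.choose_spec
    have hcN := h.choose.2
    have hvN := v.2
    -- The intervals of distinct vertices are disjoint because the table is monotone.
    have : h.choose = v := by
      refine le_antisymm (not_lt.1 fun hlt => ?_) (not_lt.1 fun hlt => ?_)
      · have := hmono' (v + 1) h.choose hlt (by omega)
        omega
      · have := hmono' (h.choose + 1) v hlt (by omega)
        omega
    simp only [nb]
    rw [dif_pos h, this]
  refine ⟨⟨fun x => if x = 0 then N else 0, fun A => if A = 0 then st else if A = 1 then nb else
    fun _ => 0⟩, rfl, ?_, hmono, fun v => (hf v).congr (hnb v), ?_, ?_, ?_, ?_⟩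
  · simp [st]
  · intro x hx
    simp [hx]
  · intro v hv
    simp [st, hv]
  · intro p hp
    simp only [if_true, if_false, one_ne_zero] at hp ⊢
    simp only [nb]
    rw [dif_neg]
    rintro ⟨v, -, hv⟩
    have := hmono' (v + 1) N v.2 le_rfl
    omega
  · intro A hA p
    simp [show A ≠ 0 by omega, show A ≠ 1 by omega]

theorem Prog.FindsColoring.colorable {p : Prog} {c K T : ℕ} (h : p.FindsColoring c G K T) :
    G.Colorable K := by
  obtain ⟨s, hs⟩ := exists_holdsAdjLists G
  obtain ⟨-, -, -, -, col, -⟩ := h s hs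
  exact ⟨col⟩

theorem Prog.FindsColoring.mono {p : Prog} {c K K' T T' : ℕ} (h : p.FindsColoring c G K T)
    (hK : K ≤ K') (hT : T ≤ T') : p.FindsColoring c G K' T' := by
  intro s hs
  obtain ⟨s', t, he, ht, col, hcol⟩ := h s hs
  exact ⟨s', t, he, ht.trans hT, SimpleGraph.Coloring.mk (fun v => Fin.castLE hK (col v))
    fun huv heq => col.valid huv (Fin.castLE_injective hK heq), hcol⟩

theorem ncard_edgeSet_add_le (G : SimpleGraph (Fin N)) : G.edgeSet.ncard + N ≤ 2 * N ^ 2 := by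
  obtain ⟨s, hs⟩ := exists_holdsAdjLists G
  have h1 := hs.isAdjTable.eq_two_mul_ncard
  have h2 := hs.isAdjTable.le_sq le_rfl
  have h3 : N ≤ N ^ 2 := Nat.le_self_pow (by omega) N
  nlinarith

end Main

end WordRAM

end

/-! ### Assembly of the three statements -/

theorem mainTheorem8 :
    -- `B_{n,d}`-free graphs are colored with `g_{n,d}(ω)` colors in time `C ω (m' + n')`
    (∀ d n : ℕ, 2 * (d + 1) ≤ n →
      ∃ (p : WordRAM.Prog) (c C : ℕ), ∀ (N : ℕ) (G : SimpleGraph (Fin N)), 0 < N →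
        BFree n d G →
          G.Colorable (gBound d n G.cliqueNum) ∧
          p.FindsColoring c G (gBound d n G.cliqueNum)
            (C * G.cliqueNum * (G.edgeSet.ncard + N))) ∧
    -- graphs with `β_{i,j}(I_G) = 0`
    (∀ i j : ℕ, 0 < i → i + 2 ≤ j → j ≤ 2 * i + 2 →
      ∃ (p : WordRAM.Prog) (c C : ℕ), ∀ (N : ℕ) (G : SimpleGraph (Fin N)), 0 < N →
        ∀ (𝕜 : Type*) [Field 𝕜], edgeIdealBetti 𝕜 G i j = 0 →
          G.Colorable
            ((G.cliqueNum - 1 + 2 * (j - i - 2)).choose (2 * (j - i - 2)) +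
              (j - 2).choose (2 * (j - i - 2) + 1)) ∧
          p.FindsColoring c G
            ((G.cliqueNum - 1 + 2 * (j - i - 2)).choose (2 * (j - i - 2)) +
              (j - 2).choose (2 * (j - i - 2) + 1))
            (C * N ^ 3)) ∧
    -- triangle-free graphs with `β_{i,j}(I_G) = 0`
    (∀ i j : ℕ, 0 < i → i + 2 ≤ j → j ≤ 2 * i + 2 →
      ∃ (p : WordRAM.Prog) (c C : ℕ), ∀ (N : ℕ) (G : SimpleGraph (Fin N)), 0 < N →
        G.CliqueFree 3 → ∀ (𝕜 : Type*) [Field 𝕜], edgeIdealBetti 𝕜 G i j = 0 →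
          G.Colorable (j - 1) ∧
          p.FindsColoring c G (j - 1) (C * N ^ 2)) := by
  have hω : ∀ {N : ℕ} (G : SimpleGraph (Fin N)), 0 < N → 1 ≤ G.cliqueNum := by
    intro N G hN
    have : G.IsClique (({⟨0, hN⟩} : Finset (Fin N)) : Set (Fin N)) := by simp
    simpa using this.card_le_cliqueNum
  -- In the last two parts `n = j` and `d = j - i - 2`; then `2 * (d + 1) ≤ n` is the hypothesis `j
  -- ≤ 2 * i + 2`.
  refine ⟨fun d n hn => ⟨WordRAM.colorProg d, 5 * d + 4, 400 * d + 200, fun N G hN hB => ?_⟩,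
    fun i j hi hij hji => ⟨WordRAM.colorProg (j - i - 2), 5 * (j - i - 2) + 4,
      2 * (400 * (j - i - 2) + 200), fun N G hN 𝕜 _ hβ => ?_⟩,
    fun i j hi hij hji => ⟨WordRAM.colorProg (j - i - 2), 5 * (j - i - 2) + 4,
      4 * (400 * (j - i - 2) + 200), fun N G hN hG 𝕜 _ hβ => ?_⟩⟩
  · have h := WordRAM.findsColoring_colorProg hn hN hB
    exact ⟨h.colorable, h⟩
  · have h := (WordRAM.findsColoring_colorProg (by omega) hN
      (bFree_of_edgeIdealBetti_eq_zero hij hβ)).mono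
      (gBound_le_choose_add_choose (by omega) (hω G hN))
      (T' := 2 * (400 * (j - i - 2) + 200) * N ^ 3) ?_
    · exact ⟨h.colorable, h⟩
    -- The cubic bound comes from `ω ≤ N` and at most quadratically many edges; with `ω ≤ 2` the
    -- same time is quadratic.
    · calc (400 * (j - i - 2) + 200) * G.cliqueNum * (G.edgeSet.ncard + N)
          ≤ (400 * (j - i - 2) + 200) * N * (2 * N ^ 2) :=
            Nat.mul_le_mul (Nat.mul_le_mul_left _ (WordRAM.cliqueNum_le G))
              (WordRAM.ncard_edgeSet_add_le G)
        _ = _ := by ring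
  · have hω2 : G.cliqueNum ≤ 2 := by
      by_contra! hlt
      obtain ⟨t, ht⟩ := G.exists_isNClique_cliqueNum
      exact hG.mono hlt t ht
    have hle : gBound (j - i - 2) j G.cliqueNum ≤ j - 1 := by
      rcases hω2.lt_or_eq with hlt | heq
      · rw [gBound_of_le_one (by omega)]
        omega
      · rw [heq, gBound_two (by omega)]
    have h := (WordRAM.findsColoring_colorProg (by omega) hN
      (bFree_of_edgeIdealBetti_eq_zero hij hβ)).mono hle
      (T' := 4 * (400 * (j - i - 2) + 200) * N ^ 2) ?_
    · exact ⟨h.colorable, h⟩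
    · calc (400 * (j - i - 2) + 200) * G.cliqueNum * (G.edgeSet.ncard + N)
          ≤ (400 * (j - i - 2) + 200) * 2 * (2 * N ^ 2) :=
            Nat.mul_le_mul (Nat.mul_le_mul_left _ hω2) (WordRAM.ncard_edgeSet_add_le G)
        _ = _ := by ring
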